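/- Let $\varphi:[0,\infty)\to\mathbb R$ be locally Lipschitz with $\varphi(\rho)\ge\nu_0>0$ for all $\rho\ge 0$. Consider on $\mathbb R^n$, $n\ge 1$, the Cauchy problem $$\partial_t^2u-\varphi\big(\|\nabla u(t)\|_{L^2}^2\big)\Delta u=0,\qquad u(0)=u_0,\quad \partial_tu(0)=u_1. \tag{K}$$ For $s>1$, $\eta>0$, $\sigma\ge 0$ let $(-\Delta)^{-\sigma/2}\gamma^s_{\eta,L^2}$ be the space of tempered distributions $f$ whose Fourier transform $\hat f$ is a locally integrable function with $$\int_{\mathbb R^n}|\xi|^{2\sigma}e^{\eta|\xi|^{1/s}}|\hat f(\xi)|^2\,d\xi<\infty ,$$ with the square root of this integral as norm, and let $\|f\|_{\dot H^\sigma}^2=\int|\xi|^{2\sigma}|\hat f(\xi)|^2d\xi$. (Here $\hat f$ is the unitary Fourier transform in the angular frequency $\xi$.) Put $$\mathcal H(u;t)=\|\partial_tu(t)\|_{L^2}^2+\int_0^{\|\nabla u(t)\|_{L^2}^2}\varphi(\rho)\,d\rho,\qquad \mathcal E_{3/2}(u;t)=\varphi\big(\|\nabla u(t)\|^2_{L^2}\big)\|u(t)\|_{\dot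 H^{3/2}}^2+\|\partial_tu(t)\|_{\dot H^{1/2}}^2 .$$ **Proposition.** There is a function $\tau:\mathbb R^2\to(0,\infty)$, depending only on $\varphi$ and $\nu_0$, and for each $n\ge1$ a life span $T_m=T_m(u_0,u_1)\in(0,\infty]$, a function of the data alone, such that the following holds for all $s>1$, $\eta>0$ and all nontrivial data $$(u_0,u_1)\in(-\Delta)^{-3/4}\gamma^s_{\eta,L^2}\times(-\Delta)^{-1/4}\gamma^s_{\eta,L^2}\quad\text{with}\quad \nabla u_0\in L^2,\ u_1\in L^2$$ (that is, with $\mathcal H(u;0)<\infty$). First, $T_m\ge\tau\big(\mathcal H(u;0),\mathcal E_{3/2}(u;0)\big)$. Secondly, (K) has a solution $u$ on $[0,T_m)$ in the class $$C\big([0,T_m);(-\Delta)^{-3/4}\gamma^s_{\eta,L^2}\big)\cap C^1\big([0,T_m);(-\Delta)^{-1/4}\gamma^s_{\eta,L^2}\big), \tag{C}$$ and for every $T\in(0,T_m]$ any solution on $[0,T)$ in the corresponding class coincides with $u$ on $[0,T)$. Moreover one of the following is true: (i) $T_m=+\infty$; (ii) $T_m<+\infty$ and $\limsup_{t\to T_m^-}\mathcal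 E_{3/2}(u;t)=+\infty$. Here membership in the second space of (C) means that $u-u_0\in C^1([0,T_m);(-\Delta)^{-1/4}\gamma^s_{\eta,L^2})$ (which is the same as $u\in C^1([0,T_m);(-\Delta)^{-1/4}\gamma^s_{\eta,L^2})$ if $u_0$ belongs to $(-\Delta)^{-1/4}\gamma^s_{\eta,L^2}$, for instance if $u_0\in L^2$). A solution has $\nabla u(t)\in L^2$ for all $t$ and satisfies, for every Schwartz function $\psi$ and every $t\in(0,T)$, $\frac{d}{dt}\langle\partial_tu(t),\psi\rangle=\varphi(\|\nabla u(t)\|_{L^2}^2)\langle\Delta u(t),\psi\rangle$. -/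

import Mathlib

open MeasureTheory Filter Topology Set
open scoped SchwartzMap FourierTransform Laplacian LineDeriv ENNReal

noncomputable section

namespace Kirchhoff

/-- The space `ℝⁿ` with its Euclidean norm. -/
abbrev Rn (n : ℕ) : Type := EuclideanSpace ℝ (Fin n)

/-- The Fourier transform of the tempered distribution `f` is the locally integrable function `g`
(equality in the sense of distributions, i.e. against compactly supported test functions). The
transform is Mathlib's, with kernel `exp (-2πi x·ξ)`; so the usual frequency variable is `2πξ`. -/
def HasFourierFunction {n : ℕ} (f : 𝓢'(Rn n, ℂ)) (g : Rn n → ℂ) : Prop :=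
  LocallyIntegrable g volume ∧
    ∀ ψ : 𝓢(Rn n, ℂ), HasCompactSupport (ψ : Rn n → ℂ) → (𝓕 f) ψ = ∫ ξ, ψ ξ * g ξ

/-- The weighted square norm `∫ w(ξ) |(𝓕 f)(ξ)|² dξ`. It is `∞` if `𝓕 f` is not a locally integrable
function (the infimum runs over the representatives of `𝓕 f`, which agree almost everywhere). -/
def fourierNormSq {n : ℕ} (w : Rn n → ℝ) (f : 𝓢'(Rn n, ℂ)) : ℝ≥0∞ :=
  ⨅ (g : Rn n → ℂ) (_ : HasFourierFunction f g), ∫⁻ ξ, ENNReal.ofReal (w ξ) * ‖g ξ‖ₑ ^ 2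

/-- The square of the norm of the homogeneous Sobolev space `Ḣ^σ = (-Δ)^(-σ/2) L²`. The symbol of
`-Δ` is `(2π|ξ|)²`. -/
def homSobolevNormSq {n : ℕ} (σ : ℝ) (f : 𝓢'(Rn n, ℂ)) : ℝ≥0∞ :=
  fourierNormSq (fun ξ => (2 * Real.pi * ‖ξ‖) ^ (2 * σ)) f

/-- The square of the norm of `(-Δ)^(-σ/2) γ^s_{η,L²}`, that is `‖(-Δ)^(σ/2) f‖²` in the Gevrey space
with the norm `‖h‖² = ∫ exp(η|ξ|^(1/s)) |ĥ(ξ)|² dξ` (the latter in the variable `2πξ`). -/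
def homGevreyNormSq {n : ℕ} (σ s η : ℝ) (f : 𝓢'(Rn n, ℂ)) : ℝ≥0∞ :=
  fourierNormSq (fun ξ => (2 * Real.pi * ‖ξ‖) ^ (2 * σ) *
    Real.exp (η * (2 * Real.pi * ‖ξ‖) ^ (1 / s))) f

/-- The square of the `L²(ℝⁿ)` norm of a tempered distribution, `∞` if it is not in `L²`. -/
def l2NormSq {n : ℕ} (f : 𝓢'(Rn n, ℂ)) : ℝ≥0∞ :=
  ⨅ (g : Lp ℂ 2 (volume : Measure (Rn n))) (_ : (g : 𝓢'(Rn n, ℂ)) = f), ‖g‖ₑ ^ 2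

/-- `‖∇f‖²` in `L²(ℝⁿ)`, with the distributional gradient. -/
def gradNormSq {n : ℕ} (f : 𝓢'(Rn n, ℂ)) : ℝ≥0∞ :=
  ∑ i : Fin n, l2NormSq (∂_{EuclideanSpace.single i (1 : ℝ)} f)

/-- The Hamiltonian `‖u_t‖² + ∫_0^{‖∇u‖²} φ(ρ) dρ` at a time at which `u = f` and `u_t = g`. -/
def hamiltonian {n : ℕ} (φ : ℝ → ℝ) (f g : 𝓢'(Rn n, ℂ)) : ℝ :=
  (l2NormSq g).toReal + ∫ ρ in (0 : ℝ)..(gradNormSq f).toReal, φ ρ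

/-- The energy of order `3/2`, `φ(‖∇u‖²) ‖u‖²_{Ḣ^{3/2}} + ‖u_t‖²_{Ḣ^{1/2}}`, at a time at which `u = f`
and `u_t = g`. -/
def energy32 {n : ℕ} (φ : ℝ → ℝ) (f g : 𝓢'(Rn n, ℂ)) : ℝ :=
  φ (gradNormSq f).toReal * (homSobolevNormSq (3 / 2) f).toReal
    + (homSobolevNormSq (1 / 2) g).toReal

/-- The time interval `[0, T)`, where `T` may be infinite. -/
def timeInterval (T : EReal) : Set ℝ := {t : ℝ | 0 ≤ t ∧ (t : EReal) < T}

/-- `u ∈ C([0,T); X)`, where `X` is the space with square norm `N`. -/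
structure IsC0Curve {n : ℕ} (N : 𝓢'(Rn n, ℂ) → ℝ≥0∞) (T : EReal) (u : ℝ → 𝓢'(Rn n, ℂ)) :
    Prop where
  mem : ∀ t ∈ timeInterval T, N (u t) < ∞
  continuous : ∀ t ∈ timeInterval T,
    Tendsto (fun r => N (u r - u t)) (𝓝[timeInterval T] t) (𝓝 0)

/-- `u ∈ C¹([0,T); X)` with derivative `v`, where `X` is the space with square norm `N`. -/
structure IsC1Curve {n : ℕ} (N : 𝓢'(Rn n, ℂ) → ℝ≥0∞) (T : EReal) (u v : ℝ → 𝓢'(Rn n, ℂ)) :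
    Prop where
  mem : ∀ t ∈ timeInterval T, N (u t) < ∞
  hasDeriv : ∀ t ∈ timeInterval T,
    Tendsto (fun r => N ((((r - t : ℝ) : ℂ)⁻¹) • (u r - u t) - v t))
      (𝓝[timeInterval T \ {t}] t) (𝓝 0)
  deriv_isC0 : IsC0Curve N T v

/-- `u`, with time derivative `v`, solves on `[0,T)` the Cauchy problem
`u_tt - φ(‖∇u‖²) Δu = 0`, `u(0) = u₀`, `u_t(0) = u₁`, in the class
`C([0,T); (-Δ)^(-3/4) γ^s_{η,L²}) ∩ C¹([0,T); (-Δ)^(-1/4) γ^s_{η,L²})`.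
As `(-Δ)^(-3/4) γ^s_{η,L²}` is not contained in `(-Δ)^(-1/4) γ^s_{η,L²}` (low frequencies), the second
membership is required of `u - u(0)`; it is the same as that of `u` if `u(0)` belongs to the
latter space. -/
structure IsSolution {n : ℕ} (φ : ℝ → ℝ) (s η : ℝ) (u₀ u₁ : 𝓢'(Rn n, ℂ)) (T : EReal)
    (u v : ℝ → 𝓢'(Rn n, ℂ)) : Prop where
  init : u 0 = u₀
  init_deriv : v 0 = u₁
  isC0 : IsC0Curve (homGevreyNormSq (3 / 2) s η) T u
  isC1 : IsC1Curve (homGevreyNormSq (1 / 2) s η) T (fun t => u t - u 0) v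
  grad_finite : ∀ t ∈ timeInterval T, gradNormSq (u t) < ∞
  /-- The equation `∂_t (u_t) = φ(‖∇u‖²) Δu` in `𝓢'(ℝⁿ)`, at every time `t ∈ (0,T)`. -/
  equation : ∀ t ∈ timeInterval T, 0 < t → ∀ ψ : 𝓢(Rn n, ℂ),
    HasDerivAt (fun r => v r ψ) ((φ (gradNormSq (u t)).toReal : ℂ) * (Δ (u t)) ψ) t

end Kirchhoff

end

/-!
On the Fourier side the equation decouples: if `c(t) = φ(‖∇u(t)‖²)` were known, then at each
frequency `m = 2π|ξ|` the function `û(t, ξ)` would solve the oscillator equation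
`y'' + c(t) m² y = 0`. For a Lipschitz speed `c ≥ ν > 0` the density `c m² |y|² + |y'|²` is bounded
by a multiple of its initial value that does not depend on `m`. Hence every Fourier weight in which
the data have finite energy is propagated, without loss.

Thus `u` is determined by the scalar function `r(t) = ‖∇u(t)‖²`, and the equation becomes the fixed
point problem `r = ‖∇u_{φ ∘ r}‖²`, where `u_c` is the wave with speed `c`. By the duality of
`Ḣ^{1/2}` and `Ḣ^{3/2}` the derivative of `r` is controlled by the energy of order `3/2`, so that
the problem is a contraction on Lipschitz functions `r`, on a time interval whose length depends
only on a bound of `r` and of this energy. This gives the lower bound of the life span and the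
blow-up alternative.

Uniqueness has two parts. In the class of the theorem `‖∇u‖²` is Lipschitz, so every solution is
the unique solution of the linear wave equation with its own speed; and the fixed point `r` is
unique.
-/

open scoped NNReal

noncomputable section

namespace Kirchhoff

/-! ### Density of compactly supported test functions -/

section Cutoff

variable {E F : Type*} [NormedAddCommGroup E] [InnerProductSpace ℝ E] [FiniteDimensional ℝ E]
  [NormedAddCommGroup F]

theorem abs_one_sub_bump_smul_le (χ : ContDiffBump (0 : E)) (hχ : χ.rIn = 1) {ε : ℝ} (hε : 0 < ε)
    (x : E) : |1 - χ (ε • x)| ≤ ε * ‖x‖ := by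
  rw [abs_of_nonneg (sub_nonneg.mpr χ.le_one)]
  by_cases hx : ‖ε • x‖ ≤ 1
  · rw [χ.one_of_mem_closedBall (by simpa [hχ] using hx), sub_self]
    positivity
  · rw [norm_smul, Real.norm_of_nonneg hε.le] at hx
    linarith [χ.nonneg (x := ε • x)]

theorem exists_norm_iteratedFDeriv_one_sub_bump_smul_le (χ : ContDiffBump (0 : E)) {i : ℕ}
    (hi : i ≠ 0) : ∃ C : ℝ, 0 ≤ C ∧ ∀ ε : ℝ, 0 < ε → ε ≤ 1 → ∀ x : E,
      ‖iteratedFDeriv ℝ i (fun y : E => 1 - χ (ε • y)) x‖ ≤ C * ε := by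
  obtain ⟨C, hC₀, hC⟩ := (χ.hasCompactSupport.toSchwartzMap χ.contDiff).decay 0 i
  have hbound : ∀ z, ‖iteratedFDeriv ℝ i (fun y : E => 1 - χ y) z‖ ≤ C := fun z => by
    have hdecay := hC z
    rw [pow_zero, one_mul] at hdecay
    rw [show (fun y : E => 1 - χ y) = (fun _ => (1 : ℝ)) - (χ : E → ℝ) from rfl,
      iteratedFDeriv_sub_apply contDiff_const.contDiffAt χ.contDiff.contDiffAt,
      iteratedFDeriv_const_of_ne hi, Pi.zero_apply, zero_sub, norm_neg]
    exact hdecay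
  refine ⟨C, hC₀.le, fun ε hε hε₁ x => ?_⟩
  have hsmooth : ContDiff ℝ (i : ℕ∞) (fun y : E => 1 - χ y) := contDiff_const.sub χ.contDiff
  rw [congrFun (iteratedFDeriv_comp_const_smul (𝕜 := ℝ) (i := i) ε hsmooth) x, norm_smul, norm_pow,
    Real.norm_of_nonneg hε.le, mul_comm C]
  exact mul_le_mul (pow_le_of_le_one hε.le hε₁ hi) (hbound _) (norm_nonneg _) hε.le

theorem exists_norm_iteratedFDeriv_one_sub_bump_smul_le_linear (χ : ContDiffBump (0 : E))
    (hχ : χ.rIn = 1) (i : ℕ) : ∃ C : ℝ, 0 ≤ C ∧ ∀ ε : ℝ, 0 < ε → ε ≤ 1 → ∀ x : E,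
      ‖iteratedFDeriv ℝ i (fun y : E => 1 - χ (ε • y)) x‖ ≤ C * ε * (1 + ‖x‖) := by
  rcases eq_or_ne i 0 with rfl | hi
  · refine ⟨1, zero_le_one, fun ε hε _ x => ?_⟩
    rw [norm_iteratedFDeriv_zero, Real.norm_eq_abs]
    linarith [abs_one_sub_bump_smul_le χ hχ hε x]
  · obtain ⟨C, hC₀, hC⟩ := exists_norm_iteratedFDeriv_one_sub_bump_smul_le χ hi
    refine ⟨C, hC₀, fun ε hε hε₁ x => (hC ε hε hε₁ x).trans ?_⟩
    exact le_mul_of_one_le_right (by positivity) (by linarith [norm_nonneg x])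

variable [NormedSpace ℝ F]

theorem hasTemperateGrowth_bump_smul (χ : ContDiffBump (0 : E)) {ε : ℝ} (hε : ε ≠ 0) :
    (fun x : E => χ (ε • x)).HasTemperateGrowth :=
  (χ.hasCompactSupport.comp_smul hε).hasTemperateGrowth
    (χ.contDiff.comp (contDiff_const_smul ε))

theorem exists_seminorm_smulLeftCLM_bump_sub_le (χ : ContDiffBump (0 : E)) (hχ : χ.rIn = 1)
    (ψ : 𝓢(E, F)) (k n : ℕ) : ∃ S : ℝ, ∀ ε : ℝ, 0 < ε → ε ≤ 1 →
      SchwartzMap.seminorm ℝ k n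
        (SchwartzMap.smulLeftCLM F (fun x : E => χ (ε • x)) ψ - ψ) ≤ S * ε := by
  choose C hC₀ hC using exists_norm_iteratedFDeriv_one_sub_bump_smul_le_linear χ hχ
  let S : ℝ := ∑ i ∈ Finset.range (n + 1), (n.choose i : ℝ) * C i *
    (SchwartzMap.seminorm ℝ k (n - i) ψ + SchwartzMap.seminorm ℝ (k + 1) (n - i) ψ)
  have hS : 0 ≤ S := Finset.sum_nonneg fun i _ => by have := hC₀ i; positivity
  refine ⟨S, fun ε hε hε₁ =>
    SchwartzMap.seminorm_le_bound ℝ k n _ (mul_nonneg hS hε.le) fun x => ?_⟩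
  have hdiff : ((SchwartzMap.smulLeftCLM F (fun x : E => χ (ε • x)) ψ - ψ : 𝓢(E, F)) : E → F) =
      -fun y => (1 - χ (ε • y)) • ψ y := by
    ext y
    simp [SchwartzMap.smulLeftCLM_apply_apply (hasTemperateGrowth_bump_smul χ hε.ne'), sub_smul]
  rw [hdiff, iteratedFDeriv_neg_apply, norm_neg]
  have hleibniz := norm_iteratedFDeriv_smul_le (𝕜 := ℝ) (N := (⊤ : ℕ∞)) (n := n)
    (f := fun y : E => 1 - χ (ε • y)) (g := ψ)
    (contDiff_const.sub (χ.contDiff.comp (contDiff_const_smul _))) (ψ.smooth ⊤) x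
    (by exact_mod_cast le_top)
  refine (mul_le_mul_of_nonneg_left hleibniz (by positivity)).trans ?_
  rw [Finset.mul_sum, Finset.sum_mul]
  refine Finset.sum_le_sum fun i _ => ?_
  have hC₀i := hC₀ i
  calc ‖x‖ ^ k * ((n.choose i : ℝ) * ‖iteratedFDeriv ℝ i (fun y : E => 1 - χ (ε • y)) x‖ *
        ‖iteratedFDeriv ℝ (n - i) ψ x‖)
      ≤ ‖x‖ ^ k * ((n.choose i : ℝ) * (C i * ε * (1 + ‖x‖)) *
        ‖iteratedFDeriv ℝ (n - i) ψ x‖) := by gcongr; exact hC i ε hε hε₁ x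
    _ = (n.choose i : ℝ) * C i * (‖x‖ ^ k * ‖iteratedFDeriv ℝ (n - i) ψ x‖ +
        ‖x‖ ^ (k + 1) * ‖iteratedFDeriv ℝ (n - i) ψ x‖) * ε := by ring
    _ ≤ _ := by
        gcongr
        exacts [SchwartzMap.le_seminorm ℝ k (n - i) ψ x,
          SchwartzMap.le_seminorm ℝ (k + 1) (n - i) ψ x]

theorem exists_hasCompactSupport_tendsto (ψ : 𝓢(E, F)) :
    ∃ Ψ : ℕ → 𝓢(E, F), (∀ N, HasCompactSupport (Ψ N : E → F)) ∧ Tendsto Ψ atTop (𝓝 ψ) := by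
  let χ : ContDiffBump (0 : E) := ⟨1, 2, one_pos, one_lt_two⟩
  let ε : ℕ → ℝ := fun N => 1 / ((N : ℝ) + 1)
  have hε : ∀ N, 0 < ε N := fun N => Nat.one_div_pos_of_nat
  have hε₁ : ∀ N, ε N ≤ 1 := fun N => by
    rw [div_le_one (by positivity)]
    linarith [N.cast_nonneg (α := ℝ)]
  refine ⟨fun N => SchwartzMap.smulLeftCLM F (fun x : E => χ (ε N • x)) ψ, fun N => ?_, ?_⟩
  · rw [SchwartzMap.smulLeftCLM_apply (hasTemperateGrowth_bump_smul χ (hε N).ne')]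
    exact (χ.hasCompactSupport.comp_smul (hε N).ne').smul_right
  · rw [(schwartz_withSeminorms ℝ E F).tendsto_nhds]
    rintro ⟨k, n⟩ δ hδ
    obtain ⟨S, hS⟩ := exists_seminorm_smulLeftCLM_bump_sub_le χ rfl ψ k n
    have hlim : Tendsto (fun N => S * ε N) atTop (𝓝 0) := by
      simpa only [mul_zero] using (tendsto_one_div_add_atTop_nhds_zero_nat (𝕜 := ℝ)).const_mul S
    filter_upwards [hlim.eventually (gt_mem_nhds hδ)] with N hN
    exact (hS (ε N) (hε N) (hε₁ N)).trans_lt hN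

theorem temperedDistribution_ext_of_hasCompactSupport {F : Type*} [NormedAddCommGroup F]
    [NormedSpace ℂ F] {f g : 𝓢'(E, F)}
    (h : ∀ ψ : 𝓢(E, ℂ), HasCompactSupport (ψ : E → ℂ) → f ψ = g ψ) : f = g := by
  ext ψ
  obtain ⟨Ψ, hΨ, hlim⟩ := exists_hasCompactSupport_tendsto ψ
  refine tendsto_nhds_unique ((map_continuous f).continuousAt.tendsto.comp hlim) ?_
  exact ((map_continuous g).continuousAt.tendsto.comp hlim).congr fun N => (h _ (hΨ N)).symm

end Cutoff

/-! ### Fourier transforms that are functions -/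

section LpTwo

variable {α E : Type*} [NormedAddCommGroup E] {_ : MeasurableSpace α} {μ : Measure α} {g : α → E}

theorem eLpNorm_two_sq (g : α → E) (μ : Measure α) :
    eLpNorm g 2 μ ^ 2 = ∫⁻ x, ‖g x‖ₑ ^ 2 ∂μ := by
  simpa using eLpNorm_nnreal_pow_eq_lintegral (f := g) (μ := μ) (p := 2) two_ne_zero

theorem memLp_two_of_lintegral_sq_lt_top (hg : AEStronglyMeasurable g μ)
    (h : ∫⁻ x, ‖g x‖ₑ ^ 2 ∂μ < ∞) : MemLp g 2 μ :=
  ⟨hg, by simpa [← eLpNorm_two_sq] using h⟩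

theorem enorm_toLp_sq (hg : MemLp g 2 μ) : ‖hg.toLp g‖ₑ ^ 2 = ∫⁻ x, ‖g x‖ₑ ^ 2 ∂μ := by
  rw [Lp.enorm_toLp, eLpNorm_two_sq]

theorem Lp_enorm_sq (h : Lp E 2 μ) : ‖h‖ₑ ^ 2 = ∫⁻ x, ‖h x‖ₑ ^ 2 ∂μ := by
  rw [← enorm_toLp_sq (Lp.memLp h), Lp.toLp_coeFn]

end LpTwo

variable {n : ℕ}

/-- The angular frequency `|2πξ|` of the Fourier variable `ξ` of Mathlib's transform: the symbol of
`√(-Δ)`. -/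
def freq (ξ : Rn n) : ℝ := 2 * Real.pi * ‖ξ‖

theorem measurable_freq : Measurable (freq : Rn n → ℝ) := measurable_norm.const_mul _

theorem freq_nonneg (ξ : Rn n) : 0 ≤ freq ξ := by unfold freq; positivity

theorem one_le_freq {ξ : Rn n} (h : 1 < ‖ξ‖) : 1 ≤ freq ξ := by
  unfold freq
  nlinarith [Real.pi_gt_three]

theorem mul_eq_add_indicator {α : Type*} (f g : α → ℂ) (s : Set α) :
    (fun x => f x * g x) = fun x => f x * sᶜ.indicator g x + f x * s.indicator g x := by
  ext x
  rw [← mul_add, ← Pi.add_apply, indicator_compl_add_self]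

/-- Functions that are locally integrable, and square integrable away from the origin: a class of
densities of tempered distributions that contains the Fourier transforms of the homogeneous spaces
`(-Δ)^(-σ/2) L²` for `σ ≥ 0`. -/
structure IsTemperedFunction (g : Rn n → ℂ) : Prop where
  locallyIntegrable : LocallyIntegrable g volume
  lintegral_lt_top : ∫⁻ ξ in {ξ : Rn n | 1 < ‖ξ‖}, ‖g ξ‖ₑ ^ 2 < ∞

namespace IsTemperedFunction

variable {g : Rn n → ℂ}

theorem of_lintegral_lt_top (hg : LocallyIntegrable g volume) {w : Rn n → ℝ}
    (hw : ∀ ξ, 1 < ‖ξ‖ → 1 ≤ w ξ) (h : ∫⁻ ξ, ENNReal.ofReal (w ξ) * ‖g ξ‖ₑ ^ 2 < ∞) :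
    IsTemperedFunction g := by
  refine ⟨hg, lt_of_le_of_lt ?_ h⟩
  refine (setLIntegral_mono' (measurableSet_lt measurable_const measurable_norm)
    fun ξ hξ => ?_).trans (setLIntegral_le_lintegral _ _)
  exact le_mul_of_one_le_left bot_le (ENNReal.one_le_ofReal.2 (hw ξ hξ))

theorem memLp_one_indicator (hg : IsTemperedFunction g) :
    MemLp ({ξ : Rn n | 1 < ‖ξ‖}ᶜ.indicator g) 1 volume := by
  rw [memLp_one_iff_integrable,
    integrable_indicator_iff (measurableSet_lt measurable_const measurable_norm).compl]
  refine (hg.locallyIntegrable.integrableOn_isCompact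
    (isCompact_closedBall (0 : Rn n) 1)).mono_set fun ξ hξ => ?_
  simpa using hξ

theorem memLp_two_indicator (hg : IsTemperedFunction g) :
    MemLp ({ξ : Rn n | 1 < ‖ξ‖}.indicator g) 2 volume := by
  rw [memLp_indicator_iff_restrict (measurableSet_lt measurable_const measurable_norm)]
  exact memLp_two_of_lintegral_sq_lt_top hg.locallyIntegrable.aestronglyMeasurable.restrict
    hg.lintegral_lt_top

/-- The tempered distribution with density `g`. -/
def toTemperedDistribution (hg : IsTemperedFunction g) : 𝓢'(Rn n, ℂ) :=
  (hg.memLp_one_indicator.toLp _ : 𝓢'(Rn n, ℂ)) + (hg.memLp_two_indicator.toLp _ : 𝓢'(Rn n, ℂ))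

theorem integrable_mul_indicator_compl (hg : IsTemperedFunction g) (ψ : 𝓢(Rn n, ℂ)) :
    Integrable (fun ξ => ψ ξ * {ξ : Rn n | 1 < ‖ξ‖}ᶜ.indicator g ξ) volume :=
  (memLp_one_iff_integrable.1 hg.memLp_one_indicator).bdd_mul
    ψ.continuous.aestronglyMeasurable (.of_forall (SchwartzMap.norm_le_seminorm ℝ ψ))

theorem integrable_mul_indicator (hg : IsTemperedFunction g) (ψ : 𝓢(Rn n, ℂ)) :
    Integrable (fun ξ => ψ ξ * {ξ : Rn n | 1 < ‖ξ‖}.indicator g ξ) volume :=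
  (ψ.memLp 2 volume).integrable_mul hg.memLp_two_indicator

theorem integrable_mul (hg : IsTemperedFunction g) (ψ : 𝓢(Rn n, ℂ)) :
    Integrable (fun ξ => ψ ξ * g ξ) volume := by
  rw [mul_eq_add_indicator ψ g {ξ | 1 < ‖ξ‖}]
  exact (hg.integrable_mul_indicator_compl ψ).add (hg.integrable_mul_indicator ψ)

theorem toTemperedDistribution_apply (hg : IsTemperedFunction g) (ψ : 𝓢(Rn n, ℂ)) :
    hg.toTemperedDistribution ψ = ∫ ξ, ψ ξ * g ξ := by
  rw [mul_eq_add_indicator ψ g {ξ | 1 < ‖ξ‖},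
    integral_add (hg.integrable_mul_indicator_compl ψ) (hg.integrable_mul_indicator ψ),
    toTemperedDistribution, add_apply, Lp.toTemperedDistribution_apply,
    Lp.toTemperedDistribution_apply]
  congr 1 <;> refine integral_congr_ae ?_
  · filter_upwards [hg.memLp_one_indicator.coeFn_toLp] with ξ hξ
    simp only [hξ, smul_eq_mul]
  · filter_upwards [hg.memLp_two_indicator.coeFn_toLp] with ξ hξ
    simp only [hξ, smul_eq_mul]

theorem exists_hasFourierFunction (hg : IsTemperedFunction g) :
    ∃ f : 𝓢'(Rn n, ℂ), HasFourierFunction f g := by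
  refine ⟨𝓕⁻ hg.toTemperedDistribution, hg.locallyIntegrable, fun ψ _ => ?_⟩
  rw [FourierTransform.fourier_fourierInv_eq, hg.toTemperedDistribution_apply]

end IsTemperedFunction

theorem fourierInv_laplacian_apply (ψ : 𝓢(Rn n, ℂ)) (ξ : Rn n) :
    (𝓕⁻ (Δ ψ)) ξ = -((freq ξ ^ 2 : ℝ) : ℂ) * (𝓕⁻ ψ) ξ := by
  let b := EuclideanSpace.basisFun (Fin n) ℝ
  have hsecond : ∀ i, (𝓕⁻ (∂_{b i} (∂_{b i} ψ))) ξ =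
      -(((2 * Real.pi) ^ 2 * (inner ℝ ξ (b i)) ^ 2 : ℝ) : ℂ) * (𝓕⁻ ψ) ξ := by
    intro i
    have hgrowth : (inner ℝ · (b i)).HasTemperateGrowth := by fun_prop
    rw [SchwartzMap.fourierInv_lineDerivOp_eq, SchwartzMap.fourierInv_lineDerivOp_eq]
    simp only [smul_apply, SchwartzMap.smulLeftCLM_apply_apply hgrowth, smul_eq_mul,
      Complex.real_smul]
    push_cast
    linear_combination
      ((2 * Real.pi) ^ 2 * ((inner ℝ ξ (b i) : ℝ) : ℂ) ^ 2 * (𝓕⁻ ψ) ξ) * Complex.I_sq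
  have hsum : (𝓕⁻ (Δ ψ)) = ∑ i, 𝓕⁻ (∂_{b i} (∂_{b i} ψ)) := by
    rw [SchwartzMap.laplacian_eq_sum b]
    exact map_sum (FourierTransform.fourierInvCLM ℂ 𝓢(Rn n, ℂ)) _ _
  rw [hsum, sum_apply, Finset.sum_congr rfl fun i _ => hsecond i, ← Finset.sum_mul,
    Finset.sum_neg_distrib]
  congr 2
  rw [freq, mul_pow _ ‖ξ‖, ← b.sum_sq_inner_left ξ, Finset.mul_sum, Complex.ofReal_sum]

theorem integrable_mul_of_hasCompactSupport {g : Rn n → ℂ} (hg : LocallyIntegrable g volume)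
    (ψ : 𝓢(Rn n, ℂ)) (hψ : HasCompactSupport (ψ : Rn n → ℂ)) :
    Integrable (fun ξ => ψ ξ * g ξ) volume := by
  simpa using hg.integrable_smul_left_of_hasCompactSupport ψ.continuous hψ

theorem exists_hasFourierFunction_of_fourierNormSq_lt_top {f : 𝓢'(Rn n, ℂ)} {w : Rn n → ℝ}
    (h : fourierNormSq w f < ∞) : ∃ g, HasFourierFunction f g := by
  simp only [fourierNormSq, iInf_lt_iff] at h
  exact ⟨h.choose, h.choose_spec.choose⟩

theorem hasFourierFunction_toTemperedDistribution (h : Lp ℂ 2 (volume : Measure (Rn n))) :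
    HasFourierFunction (h : 𝓢'(Rn n, ℂ)) (𝓕 h : Lp ℂ 2 (volume : Measure (Rn n))) := by
  refine ⟨(Lp.memLp _).locallyIntegrable (by norm_num), fun ψ _ => ?_⟩
  rw [Lp.fourier_toTemperedDistribution_eq, Lp.toTemperedDistribution_apply]
  rfl

theorem Lp_enorm_sq_eq_lintegral_fourier (h : Lp ℂ 2 (volume : Measure (Rn n))) :
    ‖h‖ₑ ^ 2 = ∫⁻ ξ, ‖(𝓕 h : Lp ℂ 2 (volume : Measure (Rn n))) ξ‖ₑ ^ 2 := by
  rw [← Lp_enorm_sq, ← ofReal_norm h, ← Lp.norm_fourier_eq, ofReal_norm]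

namespace HasFourierFunction

variable {f f' : 𝓢'(Rn n, ℂ)} {g g' : Rn n → ℂ}

theorem ae_eq (hg : HasFourierFunction f g) (hg' : HasFourierFunction f g') :
    g =ᵐ[volume] g' := by
  refine ae_eq_of_integral_contDiff_smul_eq hg.1 hg'.1 fun θ hsmooth hsupp => ?_
  have hsupp' : HasCompactSupport (Complex.ofRealCLM ∘ θ) := hsupp.comp_left rfl
  have hsmooth' : ContDiff ℝ (⊤ : ℕ∞) (Complex.ofRealCLM ∘ θ) := by fun_prop
  simpa using (hg.2 (hsupp'.toSchwartzMap hsmooth') hsupp').symm.trans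
    (hg'.2 (hsupp'.toSchwartzMap hsmooth') hsupp')

theorem congr (hg : HasFourierFunction f g) (h : g =ᵐ[volume] g') : HasFourierFunction f g' :=
  ⟨hg.1.congr h, fun ψ hψ => (hg.2 ψ hψ).trans
    (integral_congr_ae (by filter_upwards [h] with ξ hξ; rw [hξ]))⟩

theorem ext (hf : HasFourierFunction f g) (hf' : HasFourierFunction f' g) : f = f' := by
  have h : 𝓕 f = 𝓕 f' := temperedDistribution_ext_of_hasCompactSupport fun ψ hψ => by
    rw [hf.2 ψ hψ, hf'.2 ψ hψ]
  simpa using congrArg 𝓕⁻ h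

theorem sub (hg : HasFourierFunction f g) (hg' : HasFourierFunction f' g') :
    HasFourierFunction (f - f') (fun ξ => g ξ - g' ξ) := by
  refine ⟨hg.1.sub hg'.1, fun ψ hψ => ?_⟩
  have hsub : 𝓕 (f - f') ψ = 𝓕 f ψ - 𝓕 f' ψ := by
    simp [TemperedDistribution.fourier_apply]
  rw [hsub, hg.2 ψ hψ, hg'.2 ψ hψ, ← integral_sub (integrable_mul_of_hasCompactSupport hg.1 ψ hψ)
    (integrable_mul_of_hasCompactSupport hg'.1 ψ hψ)]
  simp_rw [mul_sub]

theorem const_smul (hg : HasFourierFunction f g) (a : ℂ) :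
    HasFourierFunction (a • f) (fun ξ => a * g ξ) := by
  refine ⟨hg.1.smul a, fun ψ hψ => ?_⟩
  have hsmul : 𝓕 (a • f) ψ = a * 𝓕 f ψ := by
    simp [TemperedDistribution.fourier_apply]
  rw [hsmul, hg.2 ψ hψ, ← integral_const_mul]
  simp_rw [mul_left_comm a]

theorem fourierNormSq_eq (hg : HasFourierFunction f g) (w : Rn n → ℝ) :
    fourierNormSq w f = ∫⁻ ξ, ENNReal.ofReal (w ξ) * ‖g ξ‖ₑ ^ 2 := by
  refine le_antisymm (iInf₂_le g hg) (le_iInf₂ fun g' hg' => le_of_eq ?_)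
  exact lintegral_congr_ae (by filter_upwards [hg.ae_eq hg'] with ξ hξ; rw [hξ])

theorem apply_eq (hf : HasFourierFunction f g) (hg : IsTemperedFunction g) (ψ : 𝓢(Rn n, ℂ)) :
    f ψ = ∫ ξ, (𝓕⁻ ψ) ξ * g ξ := by
  have h : 𝓕 f = hg.toTemperedDistribution :=
    temperedDistribution_ext_of_hasCompactSupport fun θ hθ => by
      rw [hf.2 θ hθ, hg.toTemperedDistribution_apply]
  rw [← hg.toTemperedDistribution_apply, ← h, TemperedDistribution.fourier_apply,
    FourierTransform.fourier_fourierInv_eq]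

theorem laplacian_apply (hf : HasFourierFunction f g) (hg : IsTemperedFunction g)
    (ψ : 𝓢(Rn n, ℂ)) :
    (Δ f) ψ = ∫ ξ, -((freq ξ ^ 2 : ℝ) : ℂ) * (𝓕⁻ ψ) ξ * g ξ := by
  rw [TemperedDistribution.laplacian_apply_apply, hf.apply_eq hg]
  simp_rw [fourierInv_laplacian_apply]

theorem l2NormSq_eq (hf : HasFourierFunction f g) : l2NormSq f = ∫⁻ ξ, ‖g ξ‖ₑ ^ 2 := by
  refine le_antisymm ?_ (le_iInf₂ fun h hh => ?_)
  · rcases eq_or_ne (∫⁻ ξ, ‖g ξ‖ₑ ^ 2) ∞ with htop | htop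
    · exact htop ▸ le_top (α := ℝ≥0∞)
    have hg : MemLp g 2 volume :=
      memLp_two_of_lintegral_sq_lt_top hf.1.aestronglyMeasurable htop.lt_top
    have hh := hasFourierFunction_toTemperedDistribution (𝓕⁻ (hg.toLp g))
    rw [FourierTransform.fourier_fourierInv_eq] at hh
    refine iInf₂_le_of_le _ ((hh.congr hg.coeFn_toLp).ext hf) (le_of_eq ?_)
    rw [Lp_enorm_sq_eq_lintegral_fourier, FourierTransform.fourier_fourierInv_eq, ← Lp_enorm_sq,
      enorm_toLp_sq]
  · rw [Lp_enorm_sq_eq_lintegral_fourier]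
    refine (lintegral_congr_ae ?_).le
    filter_upwards [hf.ae_eq (hh ▸ hasFourierFunction_toTemperedDistribution h)] with ξ hξ
    rw [hξ]

theorem lineDeriv (hf : HasFourierFunction f g) (i : Fin n) :
    HasFourierFunction (∂_{EuclideanSpace.single i (1 : ℝ)} f)
      (fun ξ => (2 * Real.pi * Complex.I) * ((ξ i : ℝ) : ℂ) * g ξ) := by
  have hcont : Continuous fun ξ : Rn n => (2 * Real.pi * Complex.I) * ((ξ i : ℝ) : ℂ) := by fun_prop
  have hinner : ∀ ξ : Rn n, inner ℝ ξ (EuclideanSpace.single i (1 : ℝ)) = ξ i := fun ξ => by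
    rw [EuclideanSpace.inner_single_right]; simp
  have hgrowth : (fun ξ : Rn n =>
      ((inner ℝ ξ (EuclideanSpace.single i (1 : ℝ)) : ℝ) : ℂ)).HasTemperateGrowth := by fun_prop
  refine ⟨by simpa using hf.1.continuous_smul hcont, fun ψ hψ => ?_⟩
  rw [TemperedDistribution.fourier_lineDerivOp_eq, smul_apply,
    TemperedDistribution.smulLeftCLM_apply_apply, hf.2, smul_eq_mul, ← integral_const_mul]
  · congr 1
    ext ξ
    rw [SchwartzMap.smulLeftCLM_apply_apply hgrowth, hinner]
    simp only [smul_eq_mul]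
    ring
  · rw [SchwartzMap.smulLeftCLM_apply hgrowth]
    exact hψ.mono fun x hx h0 => hx (by simp [h0])

theorem gradNormSq_eq (hf : HasFourierFunction f g) :
    gradNormSq f = ∫⁻ ξ, ENNReal.ofReal (freq ξ ^ 2) * ‖g ξ‖ₑ ^ 2 := by
  have hterm : ∀ (ξ : Rn n) (i : Fin n), ‖(2 * Real.pi * Complex.I) * ((ξ i : ℝ) : ℂ) * g ξ‖ₑ ^ 2 =
      ENNReal.ofReal ((2 * Real.pi) ^ 2 * (ξ i) ^ 2) * ‖g ξ‖ₑ ^ 2 := fun ξ i => by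
    rw [enorm_mul, mul_pow, ← ofReal_norm (_ * _), ← ENNReal.ofReal_pow (norm_nonneg _)]
    congr 2
    simp [mul_pow, abs_of_pos Real.pi_pos]
  rw [gradNormSq, Finset.sum_congr rfl fun i _ => (hf.lineDeriv i).l2NormSq_eq,
    ← lintegral_finsetSum' _ fun i _ => (hf.lineDeriv i).1.aestronglyMeasurable.enorm.pow_const 2]
  refine lintegral_congr fun ξ => ?_
  simp_rw [hterm]
  rw [← Finset.sum_mul, ← ENNReal.ofReal_sum_of_nonneg fun i _ => by positivity,
    ← Finset.mul_sum, freq, mul_pow _ ‖ξ‖, EuclideanSpace.real_norm_sq_eq]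

end HasFourierFunction

/-! ### Linear differential equations -/

section PeanoBaker

variable {E : Type*} [NormedAddCommGroup E] [NormedSpace ℝ E] {A A' : ℝ → E →L[ℝ] E}

/-- The terms of the Peano–Baker series: the iterated integrals
`∫_{0 < s₁ < ⋯ < s_k < t} A(s_k) ⋯ A(s₁) x`. -/
def peanoBakerTerm (A : ℝ → E →L[ℝ] E) (x : E) : ℕ → ℝ → E
  | 0 => fun _ => x
  | k + 1 => fun t => ∫ s in (0 : ℝ)..t, A s (peanoBakerTerm A x k s)

/-- The Peano–Baker series: the solution of `y' = A(t) y` with `y(0) = x`. It is used instead of an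
abstract existence theorem because its terms depend measurably on parameters in `A` and `x`. -/
def peanoBaker (A : ℝ → E →L[ℝ] E) (x : E) (t : ℝ) : E := ∑' k, peanoBakerTerm A x k t

theorem peanoBaker_zero_right (A : ℝ → E →L[ℝ] E) (x : E) : peanoBaker A x 0 = x := by
  rw [peanoBaker, tsum_eq_single 0]
  · rfl
  · rintro (_ | k) hk
    · exact absurd rfl hk
    · exact intervalIntegral.integral_same

theorem peanoBakerTerm_congr {T : ℝ} (h : EqOn A A' (Icc 0 T)) (x : E) (k : ℕ) :
    EqOn (peanoBakerTerm A x k) (peanoBakerTerm A' x k) (Icc 0 T) := by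
  induction k with
  | zero => exact fun t _ => rfl
  | succ k ih =>
    refine fun t ht => intervalIntegral.integral_congr fun s hs => ?_
    rw [uIcc_of_le ht.1] at hs
    have hsT : s ∈ Icc 0 T := ⟨hs.1, hs.2.trans ht.2⟩
    simp only [h hsT, ih hsT]

theorem peanoBaker_congr {T : ℝ} (h : EqOn A A' (Icc 0 T)) (x : E) :
    EqOn (peanoBaker A x) (peanoBaker A' x) (Icc 0 T) := fun t ht => by
  simp only [peanoBaker, peanoBakerTerm_congr h x _ ht]

theorem continuous_uncurry_peanoBakerTerm {Λ : Type*} [TopologicalSpace Λ]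
    {A : Λ → ℝ → E →L[ℝ] E} {x : Λ → E} (hA : Continuous (Function.uncurry A)) (hx : Continuous x)
    (k : ℕ) : Continuous fun p : Λ × ℝ => peanoBakerTerm (A p.1) (x p.1) k p.2 := by
  induction k with
  | zero => exact hx.comp continuous_fst
  | succ k ih =>
    refine intervalIntegral.continuous_parametric_intervalIntegral_of_continuous
      (f := fun (p : Λ × ℝ) s => A p.1 s (peanoBakerTerm (A p.1) (x p.1) k s)) ?_ continuous_snd
    have hproj : Continuous fun q : (Λ × ℝ) × ℝ => (q.1.1, q.2) := by fun_prop
    exact (hA.comp hproj).clm_apply (ih.comp hproj)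

theorem continuous_peanoBakerTerm (hA : Continuous A) (x : E) (k : ℕ) :
    Continuous (peanoBakerTerm A x k) :=
  (continuous_uncurry_peanoBakerTerm (Λ := Unit) (A := fun _ => A) (x := fun _ => x)
    (hA.comp continuous_snd) continuous_const k).comp (Continuous.prodMk_right ())

theorem norm_peanoBakerTerm_le {M R : ℝ} (hA : ∀ s, |s| ≤ R → ‖A s‖ ≤ M) (x : E) (k : ℕ) {t : ℝ}
    (ht : |t| ≤ R) : ‖peanoBakerTerm A x k t‖ ≤ ‖x‖ * ((M * |t|) ^ k / k.factorial) := by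
  have hM : 0 ≤ M := (norm_nonneg _).trans (hA t ht)
  induction k generalizing t with
  | zero => simp [peanoBakerTerm]
  | succ k ih =>
    have hbound : ∀ s ∈ uIoc 0 t, ‖A s (peanoBakerTerm A x k s)‖ ≤
        ‖x‖ * M ^ (k + 1) / k.factorial * |s - 0| ^ k := fun s hs => by
      have hsR : |s| ≤ R := by
        have := abs_sub_left_of_mem_uIcc (uIoc_subset_uIcc hs)
        simp only [sub_zero] at this
        exact this.trans ht
      calc ‖A s (peanoBakerTerm A x k s)‖ ≤ M * (‖x‖ * ((M * |s|) ^ k / k.factorial)) :=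
            (A s).le_of_opNorm_le_of_le (hA s hsR) (ih hsR)
        _ = _ := by rw [sub_zero]; ring
    refine (intervalIntegral.norm_integral_le_abs_of_norm_le
      ((ae_restrict_iff' measurableSet_uIoc).2 (.of_forall hbound))
      (Continuous.intervalIntegrable (by fun_prop) _ _)).trans (le_of_eq ?_)
    rw [intervalIntegral.integral_const_mul, abs_mul,
      intervalIntegral.abs_integral_eq_abs_integral_uIoc, integral_pow_abs_sub_uIoc, sub_zero,
      abs_of_nonneg (by positivity), abs_of_nonneg (by positivity), Nat.factorial_succ]
    push_cast
    field_simp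
    ring

theorem exists_norm_le_of_continuous (hA : Continuous A) (R : ℝ) :
    ∃ M, ∀ s, |s| ≤ R → ‖A s‖ ≤ M := by
  obtain ⟨M, hM⟩ := (isCompact_Icc (a := -R) (b := R)).exists_bound_of_continuousOn hA.continuousOn
  exact ⟨M, fun s hs => hM s (abs_le.1 hs)⟩

variable [CompleteSpace E]

theorem summable_peanoBakerTerm (hA : Continuous A) (x : E) (t : ℝ) :
    Summable fun k => peanoBakerTerm A x k t := by
  obtain ⟨M, hM⟩ := exists_norm_le_of_continuous hA |t|
  exact ((Real.summable_pow_div_factorial _).mul_left _).of_norm_bounded fun k =>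
    norm_peanoBakerTerm_le hM x k le_rfl

theorem hasDerivAt_peanoBaker (hA : Continuous A) (x : E) (t : ℝ) :
    HasDerivAt (peanoBaker A x) (A t (peanoBaker A x t)) t := by
  set R := |t| + 1
  obtain ⟨M, hM⟩ := exists_norm_le_of_continuous hA R
  have hM₀ : 0 ≤ M := (norm_nonneg _).trans (hM 0 (by rw [abs_zero]; positivity))
  have hball : ∀ s ∈ Metric.ball (0 : ℝ) R, |s| ≤ R := fun s hs => (mem_ball_zero_iff.1 hs).le
  have hsplit : peanoBaker A x = fun s => x + ∑' k, peanoBakerTerm A x (k + 1) s := by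
    ext s
    rw [peanoBaker, (summable_peanoBakerTerm hA x s).tsum_eq_zero_add]
    rfl
  have hderiv : A t (peanoBaker A x t) = ∑' k, A t (peanoBakerTerm A x k t) :=
    (A t).map_tsum (summable_peanoBakerTerm hA x t)
  rw [hderiv, hsplit]
  refine (hasDerivAt_tsum_of_isPreconnected (g := fun k => peanoBakerTerm A x (k + 1))
    (g' := fun k s => A s (peanoBakerTerm A x k s))
    (((Real.summable_pow_div_factorial (M * R)).mul_left ‖x‖).mul_left M) Metric.isOpen_ball
    (convex_ball (0 : ℝ) R).isPreconnected (fun k s _ => ?_) (fun k s hs => ?_)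
    (Metric.mem_ball_self (by positivity)) ?_ ?_).const_add x
  · exact
      ((hA.clm_apply (continuous_peanoBakerTerm hA x k)).integral_hasStrictDerivAt 0 s).hasDerivAt
  · refine (A s).le_of_opNorm_le_of_le (hM s (hball s hs))
      ((norm_peanoBakerTerm_le hM x k (hball s hs)).trans ?_)
    gcongr
    exact hball s hs
  · simp [peanoBakerTerm, summable_zero]
  · simp [R]

theorem hasDerivWithinAt_peanoBaker {T : ℝ} (hA : ContinuousOn A (Icc 0 T)) (x : E) {t : ℝ}
    (ht : t ∈ Icc 0 T) :
    HasDerivWithinAt (peanoBaker A x) (A t (peanoBaker A x t)) (Icc 0 T) t := by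
  have hT : 0 ≤ T := ht.1.trans ht.2
  have heq : EqOn A (fun s => A (projIcc 0 T hT s)) (Icc 0 T) := fun s hs => by
    simp only [projIcc_of_mem hT hs]
  have hext : Continuous fun s => A (projIcc 0 T hT s) :=
    (continuousOn_iff_continuous_domRestrict.1 hA).comp continuous_projIcc
  rw [heq ht, peanoBaker_congr heq x ht]
  exact (hasDerivAt_peanoBaker hext x t).hasDerivWithinAt.congr (peanoBaker_congr heq x)
    (peanoBaker_congr heq x ht)

theorem measurable_peanoBaker {Λ : Type*} [TopologicalSpace Λ] [MeasurableSpace Λ]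
    [OpensMeasurableSpace Λ] [MeasurableSpace E] [BorelSpace E] {A : Λ → ℝ → E →L[ℝ] E}
    {x : Λ → E} (hA : Continuous (Function.uncurry A)) (hx : Continuous x) (t : ℝ) :
    Measurable fun l => peanoBaker (A l) (x l) t := by
  refine measurable_of_tendsto_metrizable
    (f := fun N l => ∑ k ∈ Finset.range N, peanoBakerTerm (A l) (x l) k t) (fun N => ?_) ?_
  · exact (continuous_finsetSum _ fun k _ =>
      (continuous_uncurry_peanoBakerTerm hA hx k).comp (Continuous.prodMk_left t)).measurable
  · exact tendsto_pi_nhds.2 fun l => (summable_peanoBakerTerm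
      (hA.comp (Continuous.prodMk_right l)) (x l) t).hasSum.tendsto_sum_nat

end PeanoBaker

/-! ### Oscillations with a Lipschitz speed -/

/-- The coefficients `c` admitted in the linear wave equation `∂ₜ²u = c(t) Δu` on a time set `s`:
bounded below by `ν > 0` and Lipschitz with constant `L`. -/
structure IsWaveSpeed (ν : ℝ) (L : ℝ≥0) (c : ℝ → ℝ) (s : Set ℝ) : Prop where
  pos : 0 < ν
  le_apply : ∀ t ∈ s, ν ≤ c t
  lipschitz : LipschitzOnWith L c s

theorem IsWaveSpeed.mono {ν : ℝ} {L : ℝ≥0} {c : ℝ → ℝ} {s s' : Set ℝ} (h : IsWaveSpeed ν L c s)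
    (hs : s' ⊆ s) : IsWaveSpeed ν L c s' :=
  ⟨h.pos, fun t ht => h.le_apply t (hs ht), h.lipschitz.mono hs⟩

section Oscillation

variable {H : Type*} [NormedAddCommGroup H] {l ν : ℝ} {L : ℝ≥0}
  {c c₁ c₂ : ℝ → ℝ} {h y z y₁ z₁ y₂ z₂ : ℝ → H} {s : Set ℝ} {a b t : ℝ}

/-- The energy of the state `(y, z)` of an oscillation `y'' = -l c y` at an instant where the
coefficient takes the value `c`. -/
def oscillationEnergy (l c : ℝ) (y z : H) : ℝ := c * (l * ‖y‖ ^ 2) + ‖z‖ ^ 2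

theorem oscillationEnergy_nonneg {c : ℝ} (hl : 0 ≤ l) (hc : 0 ≤ c) (y z : H) :
    0 ≤ oscillationEnergy l c y z := by
  unfold oscillationEnergy; positivity

theorem mul_norm_sq_le_oscillationEnergy {c : ℝ} (hl : 0 ≤ l) (hc : ν ≤ c) (y z : H) :
    ν * (l * ‖y‖ ^ 2) ≤ oscillationEnergy l c y z := by
  unfold oscillationEnergy
  have : ν * (l * ‖y‖ ^ 2) ≤ c * (l * ‖y‖ ^ 2) := by gcongr
  linarith [sq_nonneg ‖z‖]

theorem norm_velocity_sq_le_oscillationEnergy {c : ℝ} (hl : 0 ≤ l) (hc : 0 ≤ c) (y z : H) :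
    ‖z‖ ^ 2 ≤ oscillationEnergy l c y z :=
  le_add_of_nonneg_left (by positivity)

theorem two_mul_norm_mul_norm_velocity_le {m c : ℝ} (hν : 0 ≤ ν) (hc : ν ≤ c) (y z : H) :
    √ν * (2 * (m * ‖y‖ * ‖z‖)) ≤ oscillationEnergy (m ^ 2) c y z := by
  have hpot : (√ν * (m * ‖y‖)) ^ 2 ≤ c * (m ^ 2 * ‖y‖ ^ 2) := by
    rw [mul_pow, Real.sq_sqrt hν, mul_pow]
    gcongr
  unfold oscillationEnergy
  nlinarith [sq_nonneg (√ν * (m * ‖y‖) - ‖z‖)]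

theorem abs_mul_norm_sq_sub_mul_norm_sq_le (hl : 0 ≤ l) (y₁ y₂ : H) :
    |l * ‖y₁‖ ^ 2 - l * ‖y₂‖ ^ 2| ≤ l * ‖y₁ - y₂‖ * (‖y₁‖ + ‖y₂‖) := by
  have h : l * ‖y₁‖ ^ 2 - l * ‖y₂‖ ^ 2 = l * ((‖y₁‖ - ‖y₂‖) * (‖y₁‖ + ‖y₂‖)) := by ring
  rw [h, abs_mul, abs_mul, abs_of_nonneg hl, abs_of_nonneg (by positivity : 0 ≤ ‖y₁‖ + ‖y₂‖),
    mul_assoc]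
  gcongr
  exact abs_norm_sub_norm_le y₁ y₂

variable [InnerProductSpace ℝ H]

/-- `y` solves `y'' = h - l c(t) y` on the time set `s` and `z` is its velocity. -/
structure IsOscillation (l : ℝ) (c : ℝ → ℝ) (h y z : ℝ → H) (s : Set ℝ) : Prop where
  hasDerivWithinAt : ∀ t ∈ s, HasDerivWithinAt y (z t) s t
  hasDerivWithinAt_velocity : ∀ t ∈ s, HasDerivWithinAt z (h t - (l * c t) • y t) s t

namespace IsOscillation

theorem mono {s' : Set ℝ} (hy : IsOscillation l c h y z s) (hs : s' ⊆ s) :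
    IsOscillation l c h y z s' :=
  ⟨fun t ht => (hy.hasDerivWithinAt t (hs ht)).mono hs,
    fun t ht => (hy.hasDerivWithinAt_velocity t (hs ht)).mono hs⟩

theorem sub (h₁ : IsOscillation l c₁ 0 y₁ z₁ s) (h₂ : IsOscillation l c₂ 0 y₂ z₂ s) :
    IsOscillation l c₁ (fun t => (l * (c₂ t - c₁ t)) • y₂ t) (fun t => y₁ t - y₂ t)
      (fun t => z₁ t - z₂ t) s where
  hasDerivWithinAt t ht := (h₁.hasDerivWithinAt t ht).sub (h₂.hasDerivWithinAt t ht)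
  hasDerivWithinAt_velocity t ht := by
    refine ((h₁.hasDerivWithinAt_velocity t ht).sub
      (h₂.hasDerivWithinAt_velocity t ht)).congr_deriv ?_
    simp only [Pi.zero_apply]
    module

/-- Only the value of the coefficient at `t` matters, so the energy may be differentiated with the
coefficient replaced by any differentiable `γ` through `c t`. -/
theorem hasDerivWithinAt_energy (hy : IsOscillation l c h y z s) (ht : t ∈ s) {γ : ℝ → ℝ} {γ' : ℝ}
    (hγ : HasDerivWithinAt γ γ' s t) (hγt : γ t = c t) :
    HasDerivWithinAt (fun u => oscillationEnergy l (γ u) (y u) (z u))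
      (γ' * (l * ‖y t‖ ^ 2) + 2 * inner ℝ (z t) (h t)) s t := by
  refine ((hγ.mul ((hy.hasDerivWithinAt t ht).norm_sq.const_mul l)).add
    (hy.hasDerivWithinAt_velocity t ht).norm_sq).congr_deriv ?_
  rw [hγt, inner_sub_right, inner_smul_right, real_inner_comm (z t) (y t)]
  ring

theorem continuousOn_energy (hy : IsOscillation l c h y z s) (hc : ContinuousOn c s) :
    ContinuousOn (fun t => oscillationEnergy l (c t) (y t) (z t)) s := by
  have hyc : ContinuousOn y s := fun t ht => (hy.hasDerivWithinAt t ht).continuousWithinAt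
  have hzc : ContinuousOn z s := fun t ht => (hy.hasDerivWithinAt_velocity t ht).continuousWithinAt
  unfold oscillationEnergy
  fun_prop

end IsOscillation

theorem energy_growth_le {ν L c D : ℝ} (hl : 0 ≤ l) (hν : 0 < ν) (hL : 0 ≤ L) (hc : ν ≤ c) (y z : H)
    {h : H} (hh : ‖h‖ ^ 2 ≤ D) :
    L * (l * ‖y‖ ^ 2) + 2 * inner ℝ z h ≤ (L / ν + 1) * oscillationEnergy l c y z + D := by
  have hpot : L * (l * ‖y‖ ^ 2) ≤ L / ν * (c * (l * ‖y‖ ^ 2)) := by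
    rw [div_mul_eq_mul_div, le_div_iff₀ hν, mul_assoc, mul_comm _ ν]
    gcongr
  have hpow : 2 * inner ℝ z h ≤ ‖z‖ ^ 2 + ‖h‖ ^ 2 := by
    nlinarith [real_inner_le_norm z h, sq_nonneg (‖z‖ - ‖h‖)]
  have hpos : 0 ≤ c * (l * ‖y‖ ^ 2) := mul_nonneg (hν.le.trans hc) (by positivity)
  have hkin : 0 ≤ L / ν * ‖z‖ ^ 2 := by positivity
  unfold oscillationEnergy
  linarith

/-- The upper right derivative of the energy is estimated by replacing the merely Lipschitz `c` by
the affine function of slope `L` which touches it from above. -/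
theorem IsOscillation.energy_le_gronwallBound {D : ℝ}
    (hy : IsOscillation l c h y z (Icc a b)) (hl : 0 ≤ l) (hc : IsWaveSpeed ν L c (Icc a b))
    (hh : ∀ t ∈ Icc a b, ‖h t‖ ^ 2 ≤ D) (ht : t ∈ Icc a b) :
    oscillationEnergy l (c t) (y t) (z t) ≤
      gronwallBound (oscillationEnergy l (c a) (y a) (z a)) (L / ν + 1) D (t - a) := by
  refine le_gronwallBound_of_liminf_deriv_right_le
    (f' := fun t => (L / ν + 1) * oscillationEnergy l (c t) (y t) (z t) + D)
    (hy.continuousOn_energy hc.lipschitz.continuousOn) (fun x hx r hr => ?_) le_rfl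
    (fun x _ => le_rfl) t ht
  have hxI : x ∈ Icc a b := Ico_subset_Icc_self hx
  set γ : ℝ → ℝ := fun u => c x + L * (u - x) with hγ_def
  have hγ : HasDerivWithinAt γ L (Icc a b) x := by
    simpa only [mul_one, id, hγ_def] using
      (((hasDerivWithinAt_id x (Icc a b)).sub_const x).const_mul (L : ℝ)).const_add (c x)
  have hγx : γ x = c x := by simp [hγ_def]
  have hslope := ((hasDerivWithinAt_iff_tendsto_slope' (by simp)).1
    ((hy.hasDerivWithinAt_energy hxI hγ hγx).mono_of_mem_nhdsWithin
      (Icc_mem_nhdsGT_of_mem hx))).eventually (gt_mem_nhds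
    ((energy_growth_le hl hc.pos L.2 (hc.le_apply x hxI) _ _ (hh x hxI)).trans_lt hr))
  refine Eventually.frequently ?_
  filter_upwards [hslope, Ioc_mem_nhdsGT hx.2] with u hu hxu
  have huI : u ∈ Icc a b := ⟨hx.1.trans hxu.1.le, hxu.2⟩
  have hcγ : c u ≤ γ u := by
    have := hc.lipschitz.dist_le_mul u huI x hxI
    rw [Real.dist_eq, Real.dist_eq, abs_of_pos (sub_pos.2 hxu.1)] at this
    linarith [le_abs_self (c u - c x)]
  refine lt_of_le_of_lt ?_ hu
  rw [slope_def_field, inv_mul_eq_div, hγx]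
  refine div_le_div_of_nonneg_right (sub_le_sub_right ?_ _) (sub_pos.2 hxu.1).le
  unfold oscillationEnergy
  gcongr

theorem IsOscillation.energy_le_mul_exp (hy : IsOscillation l c 0 y z (Icc a b)) (hl : 0 ≤ l)
    (hc : IsWaveSpeed ν L c (Icc a b)) (ht : t ∈ Icc a b) :
    oscillationEnergy l (c t) (y t) (z t) ≤
      oscillationEnergy l (c a) (y a) (z a) * Real.exp ((L / ν + 1) * (t - a)) := by
  simpa only [gronwallBound_ε0] using
    hy.energy_le_gronwallBound (D := 0) hl hc (by simp) ht

theorem IsOscillation.abs_mul_norm_sq_sub_le {m u : ℝ} (hm : 0 ≤ m)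
    (hy : IsOscillation (m ^ 2) c 0 y z (Icc a b)) (hc : IsWaveSpeed ν L c (Icc a b))
    (hu : u ∈ Icc a b) (ht : t ∈ Icc a b) :
    |m ^ 2 * ‖y t‖ ^ 2 - m ^ 2 * ‖y u‖ ^ 2| ≤ Real.exp ((L / ν + 1) * (b - a)) / √ν *
      (m * oscillationEnergy (m ^ 2) (c a) (y a) (z a)) * |t - u| := by
  have hν := hc.pos
  have haI : a ∈ Icc a b := ⟨le_rfl, ht.1.trans ht.2⟩
  refine Convex.norm_image_sub_le_of_norm_hasDerivWithin_le
    (fun x hx => (hy.hasDerivWithinAt x hx).norm_sq.const_mul (m ^ 2)) (fun x hx => ?_)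
    (convex_Icc a b) hu ht
  have henergy : √ν * (2 * (m * ‖y x‖ * ‖z x‖)) ≤
      oscillationEnergy (m ^ 2) (c a) (y a) (z a) * Real.exp ((L / ν + 1) * (b - a)) := by
    refine (two_mul_norm_mul_norm_velocity_le hν.le (hc.le_apply x hx) _ _).trans
      ((hy.energy_le_mul_exp (sq_nonneg m) hc hx).trans ?_)
    gcongr
    · exact oscillationEnergy_nonneg (sq_nonneg m) (hν.le.trans (hc.le_apply a haI)) _ _
    · exact hx.2
  rw [Real.norm_eq_abs, abs_mul, abs_mul, abs_of_nonneg (sq_nonneg m), abs_two]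
  calc m ^ 2 * (2 * |inner ℝ (y x) (z x)|) ≤ m ^ 2 * (2 * (‖y x‖ * ‖z x‖)) := by
        gcongr; exact abs_real_inner_le_norm _ _
    _ = m * (√ν * (2 * (m * ‖y x‖ * ‖z x‖)) / √ν) := by
        field_simp [(Real.sqrt_pos.2 hν).ne']
    _ ≤ m * (oscillationEnergy (m ^ 2) (c a) (y a) (z a) *
          Real.exp ((L / ν + 1) * (b - a)) / √ν) := by gcongr
    _ = _ := by ring

theorem gronwallBound_zero_le {K D x : ℝ} (hK : 0 < K) (hD : 0 ≤ D) (hx : 0 ≤ x)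
    (hKx : K * x ≤ 1) : gronwallBound 0 K D x ≤ 2 * D * x := by
  have hKx0 : 0 ≤ K * x := by positivity
  have hexp : Real.exp (K * x) - 1 ≤ 2 * (K * x) := by
    have := Real.abs_exp_sub_one_le (x := K * x) (by rwa [abs_of_nonneg hKx0])
    rw [abs_of_nonneg hKx0] at this
    exact (le_abs_self _).trans this
  rw [gronwallBound, if_neg hK.ne', zero_mul, zero_add, div_mul_eq_mul_div, div_le_iff₀ hK]
  calc D * (Real.exp (K * x) - 1) ≤ D * (2 * (K * x)) := by gcongr
    _ = 2 * D * x * K := by ring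

/-- Comparison of oscillations with the same data, on a time interval too short for the energy to
grow by more than a factor `exp 1 < 3`. -/
theorem IsOscillation.mul_norm_sq_le (hy : IsOscillation l c 0 y z (Icc a b)) (hl : 0 ≤ l)
    (hc : IsWaveSpeed ν L c (Icc a b)) (hab : (L / ν + 1) * (b - a) ≤ 1) (ht : t ∈ Icc a b) :
    ν * (l * ‖y t‖ ^ 2) ≤ 3 * oscillationEnergy l (c a) (y a) (z a) := by
  have hν := hc.pos
  have haI : a ∈ Icc a b := ⟨le_rfl, ht.1.trans ht.2⟩
  have hexp : Real.exp ((L / ν + 1) * (t - a)) ≤ 3 := by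
    refine (Real.exp_le_exp.2 (le_trans ?_ hab)).trans Real.exp_one_lt_three.le
    gcongr
    exact ht.2
  calc ν * (l * ‖y t‖ ^ 2) ≤ oscillationEnergy l (c t) (y t) (z t) :=
        mul_norm_sq_le_oscillationEnergy hl (hc.le_apply t ht) _ _
    _ ≤ oscillationEnergy l (c a) (y a) (z a) * Real.exp ((L / ν + 1) * (t - a)) :=
        hy.energy_le_mul_exp hl hc ht
    _ ≤ oscillationEnergy l (c a) (y a) (z a) * 3 := by
        gcongr
        exact oscillationEnergy_nonneg hl (hν.le.trans (hc.le_apply a haI)) _ _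
    _ = _ := mul_comm _ _

theorem IsOscillation.mul_norm_sub_sq_le (h₁ : IsOscillation l c₁ 0 y₁ z₁ (Icc a b))
    (h₂ : IsOscillation l c₂ 0 y₂ z₂ (Icc a b)) (hl : 0 ≤ l) (hc : IsWaveSpeed ν L c₁ (Icc a b))
    (hya : y₁ a = y₂ a) (hza : z₁ a = z₂ a) {δ Y : ℝ} (hδ : ∀ t ∈ Icc a b, |c₁ t - c₂ t| ≤ δ)
    (hY : ∀ t ∈ Icc a b, l * ‖y₂ t‖ ^ 2 ≤ Y) (hab : (L / ν + 1) * (b - a) ≤ 1) (ht : t ∈ Icc a b) :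
    ν * (l * ‖y₁ t - y₂ t‖ ^ 2) ≤ 2 * (l * δ ^ 2 * Y) * (b - a) := by
  have hν := hc.pos
  have hY0 : 0 ≤ Y := le_trans (by positivity) (hY t ht)
  have hforce : ∀ s ∈ Icc a b, ‖(l * (c₂ s - c₁ s)) • y₂ s‖ ^ 2 ≤ l * δ ^ 2 * Y := fun s hs => by
    have hcs : (c₂ s - c₁ s) ^ 2 ≤ δ ^ 2 := by
      rw [← sq_abs, abs_sub_comm]; have := hδ s hs; gcongr
    calc ‖(l * (c₂ s - c₁ s)) • y₂ s‖ ^ 2 = l * (c₂ s - c₁ s) ^ 2 * (l * ‖y₂ s‖ ^ 2) := by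
          rw [norm_smul, mul_pow, Real.norm_eq_abs, sq_abs]; ring
      _ ≤ l * δ ^ 2 * Y := by have := hY s hs; gcongr
  have hE0 : oscillationEnergy l (c₁ a) (y₁ a - y₂ a) (z₁ a - z₂ a) = 0 := by
    simp [oscillationEnergy, hya, hza]
  have hta : 0 ≤ t - a := sub_nonneg.2 ht.1
  have htb : t - a ≤ b - a := sub_le_sub_right ht.2 a
  calc ν * (l * ‖y₁ t - y₂ t‖ ^ 2) ≤ oscillationEnergy l (c₁ t) (y₁ t - y₂ t) (z₁ t - z₂ t) :=
        mul_norm_sq_le_oscillationEnergy hl (hc.le_apply t ht) _ _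
    _ ≤ gronwallBound 0 (L / ν + 1) (l * δ ^ 2 * Y) (t - a) := by
        simpa only [hE0] using (h₁.sub h₂).energy_le_gronwallBound hl hc hforce ht
    _ ≤ 2 * (l * δ ^ 2 * Y) * (t - a) :=
        gronwallBound_zero_le (by positivity) (by positivity) hta
          ((mul_le_mul_of_nonneg_left htb (by positivity)).trans hab)
    _ ≤ 2 * (l * δ ^ 2 * Y) * (b - a) := by gcongr

/-- The frequency `m` on the right is the derivative that is lost when two speeds are compared; it
is why the energy of order `3/2`, and not only the Hamiltonian, controls the nonlinearity. -/
theorem IsOscillation.abs_sub_le {m e : ℝ} (hm : 0 ≤ m)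
    (h₁ : IsOscillation (m ^ 2) c₁ 0 y₁ z₁ (Icc a b))
    (h₂ : IsOscillation (m ^ 2) c₂ 0 y₂ z₂ (Icc a b)) (hc₁ : IsWaveSpeed ν L c₁ (Icc a b))
    (hc₂ : IsWaveSpeed ν L c₂ (Icc a b)) (hca : c₁ a = c₂ a) (hya : y₁ a = y₂ a) (hza : z₁ a = z₂ a)
    (he : oscillationEnergy (m ^ 2) (c₁ a) (y₁ a) (z₁ a) = e) {δ κ : ℝ} (hδ0 : 0 ≤ δ)
    (hδ : ∀ t ∈ Icc a b, |c₁ t - c₂ t| ≤ δ) (hab : (L / ν + 1) * (b - a) ≤ 1) (hκ0 : 0 ≤ κ)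
    (hκ : 72 * (b - a) ≤ κ ^ 2 * ν ^ 3) (ht : t ∈ Icc a b) :
    |m ^ 2 * ‖y₁ t‖ ^ 2 - m ^ 2 * ‖y₂ t‖ ^ 2| ≤ δ * κ * (m * e) := by
  have hν := hc₁.pos
  have hl : 0 ≤ m ^ 2 := sq_nonneg m
  have haI : a ∈ Icc a b := ⟨le_rfl, ht.1.trans ht.2⟩
  have hba : 0 ≤ b - a := sub_nonneg.2 haI.2
  have he0 : 0 ≤ e := he ▸ oscillationEnergy_nonneg hl (hν.le.trans (hc₁.le_apply a haI)) _ _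
  have hY₁ : m ^ 2 * ‖y₁ t‖ ^ 2 ≤ 3 * e / ν := by
    rw [le_div_iff₀' hν, ← he]; exact h₁.mul_norm_sq_le hl hc₁ hab ht
  have hY₂ : ∀ t ∈ Icc a b, m ^ 2 * ‖y₂ t‖ ^ 2 ≤ 3 * e / ν := fun t ht => by
    rw [le_div_iff₀' hν, ← he, hca, hya, hza]; exact h₂.mul_norm_sq_le hl hc₂ hab ht
  have hsub : m ^ 2 * ‖y₁ t - y₂ t‖ ^ 2 ≤ 6 * (m ^ 2 * δ ^ 2 * e) * (b - a) / ν ^ 2 := by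
    have := h₁.mul_norm_sub_sq_le h₂ hl hc₁ hya hza hδ hY₂ hab ht
    rw [← le_div_iff₀' hν] at this
    exact this.trans_eq (by field_simp; ring)
  have hadd : m ^ 2 * (‖y₁ t‖ + ‖y₂ t‖) ^ 2 ≤ 12 * e / ν := by
    calc m ^ 2 * (‖y₁ t‖ + ‖y₂ t‖) ^ 2 ≤ m ^ 2 * (2 * (‖y₁ t‖ ^ 2 + ‖y₂ t‖ ^ 2)) := by
          gcongr; exact add_sq_le
      _ = 2 * (m ^ 2 * ‖y₁ t‖ ^ 2) + 2 * (m ^ 2 * ‖y₂ t‖ ^ 2) := by ring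
      _ ≤ 2 * (3 * e / ν) + 2 * (3 * e / ν) := by have := hY₂ t ht; gcongr
      _ = 12 * e / ν := by ring
  have hsq : (m ^ 2 * ‖y₁ t - y₂ t‖ * (‖y₁ t‖ + ‖y₂ t‖)) ^ 2 ≤ (δ * κ * (m * e)) ^ 2 := by
    calc (m ^ 2 * ‖y₁ t - y₂ t‖ * (‖y₁ t‖ + ‖y₂ t‖)) ^ 2
        = (m ^ 2 * ‖y₁ t - y₂ t‖ ^ 2) * (m ^ 2 * (‖y₁ t‖ + ‖y₂ t‖) ^ 2) := by ring
      _ ≤ (6 * (m ^ 2 * δ ^ 2 * e) * (b - a) / ν ^ 2) * (12 * e / ν) := by gcongr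
      _ = (m * δ * e) ^ 2 * (72 * (b - a)) / ν ^ 3 := by field_simp; ring
      _ ≤ (m * δ * e) ^ 2 * (κ ^ 2 * ν ^ 3) / ν ^ 3 := by gcongr
      _ = (δ * κ * (m * e)) ^ 2 := by field_simp
  exact (abs_mul_norm_sq_sub_mul_norm_sq_le hl _ _).trans
    ((le_abs_self _).trans (abs_le_of_sq_le_sq hsq (by positivity)))

end Oscillation

/-! ### Waves on the frequency side -/

section Wave

variable {Ω : Type*} {m : Ω → ℝ} {g₀ g₁ : Ω → ℂ} {c c' : ℝ → ℝ} {a T ν t : ℝ} {L L' : ℝ≥0}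

/-- The right-hand side `(y, z) ↦ (z, -q y)` of `y'' = -q y` as a first order system. -/
def waveOperator (q : ℝ) : ℂ × ℂ →L[ℝ] ℂ × ℂ :=
  (ContinuousLinearMap.inl ℝ ℂ ℂ).comp (ContinuousLinearMap.snd ℝ ℂ ℂ) -
    q • (ContinuousLinearMap.inr ℝ ℂ ℂ).comp (ContinuousLinearMap.fst ℝ ℂ ℂ)

theorem continuous_waveOperator : Continuous waveOperator := by unfold waveOperator; fun_prop

/-- The solution at time `t` of the linear wave equation with speed `c` and data `(g₀, g₁)`,
together with its velocity. The frequency variable runs over an abstract space, on which `m` is the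
symbol of `(-Δ)^(1/2)`. -/
def waveState (m : Ω → ℝ) (g₀ g₁ : Ω → ℂ) (c : ℝ → ℝ) (t : ℝ) (ξ : Ω) : ℂ × ℂ :=
  peanoBaker (fun s => waveOperator (m ξ ^ 2 * c s)) (g₀ ξ, g₁ ξ) t

/-- The solution of the linear wave equation `y'' = -c(t) m² y` with data `(g₀, g₁)`. -/
def wave (m : Ω → ℝ) (g₀ g₁ : Ω → ℂ) (c : ℝ → ℝ) (t : ℝ) (ξ : Ω) : ℂ :=
  (waveState m g₀ g₁ c t ξ).1

/-- The time derivative of `wave`. -/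
def waveVelocity (m : Ω → ℝ) (g₀ g₁ : Ω → ℂ) (c : ℝ → ℝ) (t : ℝ) (ξ : Ω) : ℂ :=
  (waveState m g₀ g₁ c t ξ).2

/-- The energy density `c m² |y|² + |y'|²` of the wave `y`. -/
def waveDensity (m : Ω → ℝ) (g₀ g₁ : Ω → ℂ) (c : ℝ → ℝ) (t : ℝ) (ξ : Ω) : ℝ :=
  oscillationEnergy (m ξ ^ 2) (c t) (wave m g₀ g₁ c t ξ) (waveVelocity m g₀ g₁ c t ξ)

/-- The energy density of the data `(g₀, g₁)` for the speed `1`. -/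
def dataDensity (m : Ω → ℝ) (g₀ g₁ : Ω → ℂ) (ξ : Ω) : ℝ :=
  oscillationEnergy (m ξ ^ 2) 1 (g₀ ξ) (g₁ ξ)

theorem dataDensity_nonneg (m : Ω → ℝ) (g₀ g₁ : Ω → ℂ) (ξ : Ω) : 0 ≤ dataDensity m g₀ g₁ ξ :=
  oscillationEnergy_nonneg (sq_nonneg _) zero_le_one _ _

theorem wave_zero (m : Ω → ℝ) (g₀ g₁ : Ω → ℂ) (c : ℝ → ℝ) (ξ : Ω) :
    wave m g₀ g₁ c 0 ξ = g₀ ξ := by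
  rw [wave, waveState, peanoBaker_zero_right]

theorem waveVelocity_zero (m : Ω → ℝ) (g₀ g₁ : Ω → ℂ) (c : ℝ → ℝ) (ξ : Ω) :
    waveVelocity m g₀ g₁ c 0 ξ = g₁ ξ := by
  rw [waveVelocity, waveState, peanoBaker_zero_right]

theorem waveState_congr (h : EqOn c c' (Icc 0 T)) (ht : t ∈ Icc 0 T) :
    waveState m g₀ g₁ c t = waveState m g₀ g₁ c' t :=
  funext fun ξ => peanoBaker_congr (fun s hs => by simp only [h hs]) _ ht

theorem wave_congr (h : EqOn c c' (Icc 0 T)) (ht : t ∈ Icc 0 T) :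
    wave m g₀ g₁ c t = wave m g₀ g₁ c' t :=
  funext fun ξ => by rw [wave, wave, waveState_congr h ht]

theorem waveVelocity_congr (h : EqOn c c' (Icc 0 T)) (ht : t ∈ Icc 0 T) :
    waveVelocity m g₀ g₁ c t = waveVelocity m g₀ g₁ c' t :=
  funext fun ξ => by rw [waveVelocity, waveVelocity, waveState_congr h ht]

theorem isOscillation_wave (hc : ContinuousOn c (Icc 0 T)) (ξ : Ω) :
    IsOscillation (m ξ ^ 2) c 0 (fun t => wave m g₀ g₁ c t ξ)
      (fun t => waveVelocity m g₀ g₁ c t ξ) (Icc 0 T) := by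
  have h : ∀ t ∈ Icc 0 T, HasDerivWithinAt (fun t => waveState m g₀ g₁ c t ξ)
      (waveOperator (m ξ ^ 2 * c t) (waveState m g₀ g₁ c t ξ)) (Icc 0 T) t := fun t ht =>
    hasDerivWithinAt_peanoBaker
      (continuous_waveOperator.comp_continuousOn (continuousOn_const.mul hc)) _ ht
  refine ⟨fun t ht => ?_, fun t ht => ?_⟩
  · refine ((ContinuousLinearMap.fst ℝ ℂ ℂ).hasFDerivAt.comp_hasDerivWithinAt t
      (h t ht)).congr_deriv ?_
    simp [waveOperator, waveVelocity]
  · refine ((ContinuousLinearMap.snd ℝ ℂ ℂ).hasFDerivAt.comp_hasDerivWithinAt t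
      (h t ht)).congr_deriv ?_
    simp [waveOperator, wave]

theorem waveDensity_nonneg (hc : IsWaveSpeed ν L c (Icc 0 T)) (ht : t ∈ Icc 0 T) (ξ : Ω) :
    0 ≤ waveDensity m g₀ g₁ c t ξ :=
  oscillationEnergy_nonneg (sq_nonneg _) (hc.pos.le.trans (hc.le_apply t ht)) _ _

theorem exists_waveDensity_le (hc : IsWaveSpeed ν L c (Icc 0 T)) (m : Ω → ℝ) (g₀ g₁ : Ω → ℂ) :
    ∃ C, 0 ≤ C ∧ ∀ t ∈ Icc 0 T, ∀ ξ, waveDensity m g₀ g₁ c t ξ ≤ C * dataDensity m g₀ g₁ ξ := by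
  refine ⟨max (c 0) 1 * Real.exp ((L / ν + 1) * T), by positivity, fun t ht ξ => ?_⟩
  have hν := hc.pos
  have h0 : waveDensity m g₀ g₁ c 0 ξ ≤ max (c 0) 1 * dataDensity m g₀ g₁ ξ := by
    rw [waveDensity, wave_zero, waveVelocity_zero, dataDensity, oscillationEnergy,
      oscillationEnergy, one_mul, mul_add]
    exact add_le_add (mul_le_mul_of_nonneg_right (le_max_left _ _) (by positivity))
      (le_mul_of_one_le_left (by positivity) (le_max_right _ _))
  calc waveDensity m g₀ g₁ c t ξ
      ≤ waveDensity m g₀ g₁ c 0 ξ * Real.exp ((L / ν + 1) * (t - 0)) :=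
        (isOscillation_wave hc.lipschitz.continuousOn ξ).energy_le_mul_exp (sq_nonneg _) hc ht
    _ ≤ max (c 0) 1 * dataDensity m g₀ g₁ ξ * Real.exp ((L / ν + 1) * T) := by
        rw [sub_zero]
        have := dataDensity_nonneg m g₀ g₁ ξ
        gcongr
        exact ht.2
    _ = _ := by ring

theorem exists_norm_sq_le (hc : IsWaveSpeed ν L c (Icc 0 T)) (m : Ω → ℝ) (g₀ g₁ : Ω → ℂ) :
    ∃ C, 0 ≤ C ∧ ∀ t ∈ Icc 0 T, ∀ ξ,
      m ξ ^ 2 * ‖wave m g₀ g₁ c t ξ‖ ^ 2 ≤ C * dataDensity m g₀ g₁ ξ ∧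
      ‖waveVelocity m g₀ g₁ c t ξ‖ ^ 2 ≤ C * dataDensity m g₀ g₁ ξ := by
  obtain ⟨C, hC0, hC⟩ := exists_waveDensity_le hc m g₀ g₁
  refine ⟨max (C / ν) C, le_max_of_le_right hC0, fun t ht ξ => ⟨?_, ?_⟩⟩
  · refine le_trans ?_
      (mul_le_mul_of_nonneg_right (le_max_left _ _) (dataDensity_nonneg m g₀ g₁ ξ))
    rw [div_mul_eq_mul_div, le_div_iff₀' hc.pos]
    exact (mul_norm_sq_le_oscillationEnergy (sq_nonneg _) (hc.le_apply t ht) _ _).trans (hC t ht ξ)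
  · refine le_trans ?_
      (mul_le_mul_of_nonneg_right (le_max_right _ _) (dataDensity_nonneg m g₀ g₁ ξ))
    exact (norm_velocity_sq_le_oscillationEnergy (sq_nonneg _)
      (hc.pos.le.trans (hc.le_apply t ht)) _ _).trans (hC t ht ξ)

variable [MeasurableSpace Ω] {μ : Measure Ω}

/-- A weight in which the data `(g₀, g₁)`, hence also the wave which they generate, have finite
energy. -/
structure IsEnergyWeight (μ : Measure Ω) (m : Ω → ℝ) (g₀ g₁ : Ω → ℂ) (w : Ω → ℝ) : Prop where
  measurable : Measurable w
  nonneg : ∀ ξ, 0 ≤ w ξ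
  integrable : Integrable (fun ξ => w ξ * dataDensity m g₀ g₁ ξ) μ

/-- Data of finite Hamiltonian and finite energy of order `3/2`, on the frequency side. -/
structure IsWaveData (μ : Measure Ω) (m : Ω → ℝ) (g₀ g₁ : Ω → ℂ) : Prop where
  aestronglyMeasurable : AEStronglyMeasurable g₀ μ
  aestronglyMeasurable_velocity : AEStronglyMeasurable g₁ μ
  isEnergyWeight_one : IsEnergyWeight μ m g₀ g₁ 1
  isEnergyWeight_self : IsEnergyWeight μ m g₀ g₁ m

theorem IsWaveData.measurable (hd : IsWaveData μ m g₀ g₁) : Measurable m :=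
  hd.isEnergyWeight_self.measurable

theorem IsWaveData.nonneg (hd : IsWaveData μ m g₀ g₁) (ξ : Ω) : 0 ≤ m ξ :=
  hd.isEnergyWeight_self.nonneg ξ

/-- The squared `L²` norm of the gradient of the wave. -/
def waveGradSq (μ : Measure Ω) (m : Ω → ℝ) (g₀ g₁ : Ω → ℂ) (c : ℝ → ℝ) (t : ℝ) : ℝ :=
  ∫ ξ, m ξ ^ 2 * ‖wave m g₀ g₁ c t ξ‖ ^ 2 ∂μ

/-- The energy of order `3/2` of the wave. -/
def waveEnergy (μ : Measure Ω) (m : Ω → ℝ) (g₀ g₁ : Ω → ℂ) (c : ℝ → ℝ) (t : ℝ) : ℝ :=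
  ∫ ξ, m ξ * waveDensity m g₀ g₁ c t ξ ∂μ

theorem waveGradSq_congr (h : EqOn c c' (Icc 0 T)) (ht : t ∈ Icc 0 T) :
    waveGradSq μ m g₀ g₁ c t = waveGradSq μ m g₀ g₁ c' t := by
  rw [waveGradSq, waveGradSq, wave_congr h ht]

theorem waveEnergy_congr (h : EqOn c c' (Icc 0 T)) (ht : t ∈ Icc 0 T) :
    waveEnergy μ m g₀ g₁ c t = waveEnergy μ m g₀ g₁ c' t := by
  simp only [waveEnergy, waveDensity, wave_congr h ht, waveVelocity_congr h ht, h ht]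

theorem exists_continuous_eqOn (hT : 0 ≤ T) (hc : ContinuousOn c (Icc 0 T)) :
    ∃ c', Continuous c' ∧ EqOn c c' (Icc 0 T) :=
  ⟨IccExtend hT ((Icc 0 T).domRestrict c), hc.domRestrict.Icc_extend',
    fun _ hs => (IccExtend_of_mem hT ((Icc 0 T).domRestrict c) hs).symm⟩

theorem measurable_peanoBaker_waveOperator (hc : Continuous c) (t : ℝ) :
    Measurable fun l : ℝ × ℂ × ℂ => peanoBaker (fun s => waveOperator (l.1 ^ 2 * c s)) l.2 t := by
  have hA : Continuous fun p : (ℝ × ℂ × ℂ) × ℝ => waveOperator (p.1.1 ^ 2 * c p.2) :=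
    continuous_waveOperator.comp (by fun_prop)
  exact measurable_peanoBaker hA continuous_snd t

theorem IsWaveData.aemeasurable_waveState (hd : IsWaveData μ m g₀ g₁)
    (hc : ContinuousOn c (Icc 0 T)) (ht : t ∈ Icc 0 T) :
    AEMeasurable (waveState m g₀ g₁ c t) μ := by
  obtain ⟨c', hc', hcc'⟩ := exists_continuous_eqOn (ht.1.trans ht.2) hc
  rw [waveState_congr hcc' ht]
  have hdata : AEMeasurable (fun ξ => (m ξ, g₀ ξ, g₁ ξ)) μ := hd.measurable.aemeasurable.prodMk
    (hd.aestronglyMeasurable.aemeasurable.prodMk hd.aestronglyMeasurable_velocity.aemeasurable)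
  have hstate := (measurable_peanoBaker_waveOperator hc' t).comp_aemeasurable hdata
  unfold waveState
  exact hstate

theorem aestronglyMeasurable_wave (hd : IsWaveData μ m g₀ g₁) (hc : ContinuousOn c (Icc 0 T))
    (ht : t ∈ Icc 0 T) : AEStronglyMeasurable (wave m g₀ g₁ c t) μ :=
  (measurable_fst.comp_aemeasurable (hd.aemeasurable_waveState hc ht)).aestronglyMeasurable

theorem aestronglyMeasurable_waveVelocity (hd : IsWaveData μ m g₀ g₁)
    (hc : ContinuousOn c (Icc 0 T)) (ht : t ∈ Icc 0 T) :
    AEStronglyMeasurable (waveVelocity m g₀ g₁ c t) μ :=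
  (measurable_snd.comp_aemeasurable (hd.aemeasurable_waveState hc ht)).aestronglyMeasurable

theorem IsEnergyWeight.integrable_mul_of_le {w F : Ω → ℝ} (hw : IsEnergyWeight μ m g₀ g₁ w)
    (hF : AEStronglyMeasurable F μ) (hF0 : ∀ ξ, 0 ≤ F ξ) {C : ℝ}
    (hFC : ∀ ξ, F ξ ≤ C * dataDensity m g₀ g₁ ξ) : Integrable (fun ξ => w ξ * F ξ) μ := by
  refine (hw.integrable.const_mul C).mono' (hw.measurable.aestronglyMeasurable.mul hF)
    (Eventually.of_forall fun ξ => ?_)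
  rw [Real.norm_of_nonneg (mul_nonneg (hw.nonneg ξ) (hF0 ξ)), mul_left_comm]
  exact mul_le_mul_of_nonneg_left (hFC ξ) (hw.nonneg ξ)

theorem IsEnergyWeight.integrable_mul_wave_sq {w : Ω → ℝ} (hw : IsEnergyWeight μ m g₀ g₁ w)
    (hd : IsWaveData μ m g₀ g₁) (hc : IsWaveSpeed ν L c (Icc 0 T)) (ht : t ∈ Icc 0 T) :
    Integrable (fun ξ => w ξ * (m ξ ^ 2 * ‖wave m g₀ g₁ c t ξ‖ ^ 2)) μ := by
  obtain ⟨C, -, hC⟩ := exists_norm_sq_le hc m g₀ g₁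
  exact hw.integrable_mul_of_le ((hd.measurable.pow_const 2).aestronglyMeasurable.mul
    ((aestronglyMeasurable_wave hd hc.lipschitz.continuousOn ht).norm.pow 2))
    (fun ξ => by positivity) (fun ξ => (hC t ht ξ).1)

theorem IsEnergyWeight.integrable_mul_waveVelocity_sq {w : Ω → ℝ}
    (hw : IsEnergyWeight μ m g₀ g₁ w) (hd : IsWaveData μ m g₀ g₁)
    (hc : IsWaveSpeed ν L c (Icc 0 T)) (ht : t ∈ Icc 0 T) :
    Integrable (fun ξ => w ξ * ‖waveVelocity m g₀ g₁ c t ξ‖ ^ 2) μ := by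
  obtain ⟨C, -, hC⟩ := exists_norm_sq_le hc m g₀ g₁
  exact hw.integrable_mul_of_le
    ((aestronglyMeasurable_waveVelocity hd hc.lipschitz.continuousOn ht).norm.pow 2)
    (fun ξ => by positivity) (fun ξ => (hC t ht ξ).2)

theorem integrable_sq_mul_wave_sq (hd : IsWaveData μ m g₀ g₁) (hc : IsWaveSpeed ν L c (Icc 0 T))
    (ht : t ∈ Icc 0 T) : Integrable (fun ξ => m ξ ^ 2 * ‖wave m g₀ g₁ c t ξ‖ ^ 2) μ := by
  simpa only [Pi.one_apply, one_mul] using hd.isEnergyWeight_one.integrable_mul_wave_sq hd hc ht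

theorem integrable_mul_waveDensity (hd : IsWaveData μ m g₀ g₁) (hc : IsWaveSpeed ν L c (Icc 0 T))
    (ht : t ∈ Icc 0 T) : Integrable (fun ξ => m ξ * waveDensity m g₀ g₁ c t ξ) μ := by
  have hm := hd.isEnergyWeight_self
  refine (((hm.integrable_mul_wave_sq hd hc ht).const_mul (c t)).add
    (hm.integrable_mul_waveVelocity_sq hd hc ht)).congr (Eventually.of_forall fun ξ => ?_)
  simp only [waveDensity, oscillationEnergy, Pi.add_apply]; ring

theorem waveGradSq_nonneg (μ : Measure Ω) (m : Ω → ℝ) (g₀ g₁ : Ω → ℂ) (c : ℝ → ℝ) (t : ℝ) :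
    0 ≤ waveGradSq μ m g₀ g₁ c t :=
  integral_nonneg fun ξ => by positivity

theorem waveEnergy_nonneg (hd : IsWaveData μ m g₀ g₁) (hc : IsWaveSpeed ν L c (Icc 0 T))
    (ht : t ∈ Icc 0 T) : 0 ≤ waveEnergy μ m g₀ g₁ c t :=
  integral_nonneg fun ξ => mul_nonneg (hd.nonneg ξ) (waveDensity_nonneg hc ht ξ)

theorem abs_waveGradSq_sub_le (hd : IsWaveData μ m g₀ g₁) (hc : IsWaveSpeed ν L' c (Icc 0 T))
    (ha : 0 ≤ a) (hca : IsWaveSpeed ν L c (Icc a T)) {s : ℝ} (hs : s ∈ Icc a T)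
    (ht : t ∈ Icc a T) :
    |waveGradSq μ m g₀ g₁ c t - waveGradSq μ m g₀ g₁ c s| ≤
      Real.exp ((L / ν + 1) * (T - a)) / √ν * waveEnergy μ m g₀ g₁ c a * |t - s| := by
  have hsub : Icc a T ⊆ Icc 0 T := Icc_subset_Icc_left ha
  have haI : a ∈ Icc 0 T := ⟨ha, ht.1.trans ht.2⟩
  rw [waveGradSq, waveGradSq, ← integral_sub (integrable_sq_mul_wave_sq hd hc (hsub ht))
    (integrable_sq_mul_wave_sq hd hc (hsub hs)), waveEnergy, ← integral_const_mul,
    ← integral_mul_const, ← Real.norm_eq_abs]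
  refine norm_integral_le_of_norm_le
    (((integrable_mul_waveDensity hd hc haI).const_mul _).mul_const _)
    (Eventually.of_forall fun ξ => ?_)
  exact ((isOscillation_wave hc.lipschitz.continuousOn ξ).mono hsub).abs_mul_norm_sq_sub_le
    (hd.nonneg ξ) hca hs ht

theorem lipschitzOnWith_waveGradSq (hd : IsWaveData μ m g₀ g₁)
    (hc : IsWaveSpeed ν L' c (Icc 0 T)) (ha : 0 ≤ a) (hca : IsWaveSpeed ν L c (Icc a T)) {K : ℝ≥0}
    (hK : Real.exp ((L / ν + 1) * (T - a)) / √ν * waveEnergy μ m g₀ g₁ c a ≤ K) :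
    LipschitzOnWith K (waveGradSq μ m g₀ g₁ c) (Icc a T) :=
  .of_dist_le_mul fun _ ht _ hs => (abs_waveGradSq_sub_le hd hc ha hca hs ht).trans
    (mul_le_mul_of_nonneg_right hK (abs_nonneg _))

theorem continuousOn_waveGradSq (hd : IsWaveData μ m g₀ g₁) (hc : IsWaveSpeed ν L c (Icc 0 T)) :
    ContinuousOn (waveGradSq μ m g₀ g₁ c) (Icc 0 T) :=
  (lipschitzOnWith_waveGradSq hd hc le_rfl hc (Real.le_coe_toNNReal _)).continuousOn

theorem waveGradSq_le_of_waveEnergy_le (hd : IsWaveData μ m g₀ g₁)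
    (hc : IsWaveSpeed ν L c (Icc 0 T)) {e : ℝ} (ha : 0 ≤ a) (haT : a ≤ T)
    (he : ∀ t ∈ Ico a T, waveEnergy μ m g₀ g₁ c t ≤ e) :
    waveGradSq μ m g₀ g₁ c T ≤ waveGradSq μ m g₀ g₁ c a + e / √ν * (T - a) := by
  refine image_le_of_liminf_slope_right_le_deriv_boundary (a := a) (b := T)
    (B := fun t => waveGradSq μ m g₀ g₁ c a + e / √ν * (t - a)) (B' := fun _ => e / √ν)
    ((continuousOn_waveGradSq hd hc).mono (Icc_subset_Icc_left ha)) (by simp) (by fun_prop)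
    (fun x _ => by simpa using ((((hasDerivAt_id x).sub_const a).const_mul (e / √ν)).const_add
      (waveGradSq μ m g₀ g₁ c a)).hasDerivWithinAt)
    (fun x hx r hr => ?_) ⟨haT, le_rfl⟩
  have hx0 : 0 ≤ x := ha.trans hx.1
  have hlim : Tendsto (fun u => Real.exp ((L / ν + 1) * (u - x)) / √ν * e) (𝓝[>] x)
      (𝓝 (e / √ν)) := by
    have hcont : Continuous fun u => Real.exp ((L / ν + 1) * (u - x)) / √ν * e := by fun_prop
    convert (hcont.tendsto x).mono_left (nhdsWithin_le_nhds (s := Ioi x)) using 2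
    rw [sub_self, mul_zero, Real.exp_zero]
    ring
  refine Eventually.frequently ?_
  filter_upwards [hlim.eventually (gt_mem_nhds hr), Ioc_mem_nhdsGT hx.2] with u hu hxu
  refine lt_of_le_of_lt ?_ hu
  have hux : 0 < u - x := sub_pos.2 hxu.1
  have hcu := hc.mono (Icc_subset_Icc_right hxu.2)
  have hgrad := abs_waveGradSq_sub_le hd hcu hx0 (hcu.mono (Icc_subset_Icc_left hx0))
    (left_mem_Icc.2 hxu.1.le) (right_mem_Icc.2 hxu.1.le)
  rw [abs_of_pos hux] at hgrad
  rw [slope_def_field, div_le_iff₀ hux]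
  refine (le_abs_self _).trans (hgrad.trans ?_)
  gcongr
  exact he x hx

theorem abs_waveGradSq_sub_waveGradSq_le (hd : IsWaveData μ m g₀ g₁) {L₁ L₂ : ℝ≥0}
    {c₁ c₂ : ℝ → ℝ} (hc₁ : IsWaveSpeed ν L₁ c₁ (Icc 0 T)) (hc₂ : IsWaveSpeed ν L₂ c₂ (Icc 0 T))
    (ha : 0 ≤ a) (ha₁ : IsWaveSpeed ν L c₁ (Icc a T)) (ha₂ : IsWaveSpeed ν L c₂ (Icc a T))
    (heq : EqOn c₁ c₂ (Icc 0 a)) {δ κ : ℝ} (hδ0 : 0 ≤ δ) (hδ : ∀ t ∈ Icc a T, |c₁ t - c₂ t| ≤ δ)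
    (hLT : (L / ν + 1) * (T - a) ≤ 1) (hκ0 : 0 ≤ κ) (hκ : 72 * (T - a) ≤ κ ^ 2 * ν ^ 3)
    (ht : t ∈ Icc a T) :
    |waveGradSq μ m g₀ g₁ c₁ t - waveGradSq μ m g₀ g₁ c₂ t| ≤
      δ * κ * waveEnergy μ m g₀ g₁ c₁ a := by
  have hsub : Icc a T ⊆ Icc 0 T := Icc_subset_Icc_left ha
  have haa : a ∈ Icc 0 a := right_mem_Icc.2 ha
  rw [waveGradSq, waveGradSq, ← integral_sub (integrable_sq_mul_wave_sq hd hc₁ (hsub ht))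
    (integrable_sq_mul_wave_sq hd hc₂ (hsub ht)), waveEnergy, ← integral_const_mul,
    ← Real.norm_eq_abs]
  refine norm_integral_le_of_norm_le
    ((integrable_mul_waveDensity hd hc₁ ⟨ha, ht.1.trans ht.2⟩).const_mul _)
    (Eventually.of_forall fun ξ => ?_)
  exact IsOscillation.abs_sub_le (hd.nonneg ξ)
    ((isOscillation_wave hc₁.lipschitz.continuousOn ξ).mono hsub)
    ((isOscillation_wave hc₂.lipschitz.continuousOn ξ).mono hsub) ha₁ ha₂ (heq haa)
    (congrFun (wave_congr heq haa) ξ) (congrFun (waveVelocity_congr heq haa) ξ) rfl hδ0 hδ hLT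
    hκ0 hκ ht

end Wave

/-! ### The Kirchhoff equation as a fixed point problem -/

theorem lipschitzOnWith_of_eqOn {X Y : Type*} [PseudoEMetricSpace X] [PseudoEMetricSpace Y]
    {K : ℝ≥0} {f g : X → Y} {s : Set X} (hf : LipschitzOnWith K f s) (hfg : EqOn f g s) :
    LipschitzOnWith K g s := fun x hx y hy => by
  rw [← hfg hx, ← hfg hy]
  exact hf hx hy

theorem lipschitzOnWith_Icc_of_Icc_of_Icc {X : Type*} [PseudoMetricSpace X] {K : ℝ≥0} {f : ℝ → X}
    {a b d : ℝ} (h₁ : LipschitzOnWith K f (Icc a b)) (h₂ : LipschitzOnWith K f (Icc b d)) :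
    LipschitzOnWith K f (Icc a d) := by
  refine .of_dist_le_mul fun s hs t ht => ?_
  wlog hst : s ≤ t generalizing s t
  · rw [dist_comm, dist_comm s]
    exact this t ht s hs (le_of_not_ge hst)
  rcases le_total t b with htb | hbt
  · exact h₁.dist_le_mul s ⟨hs.1, hst.trans htb⟩ t ⟨ht.1, htb⟩
  rcases le_total b s with hbs | hsb
  · exact h₂.dist_le_mul s ⟨hbs, hs.2⟩ t ⟨hbt, ht.2⟩
  · have h₁' := h₁.dist_le_mul s ⟨hs.1, hsb⟩ b ⟨hs.1.trans hsb, le_rfl⟩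
    have h₂' := h₂.dist_le_mul b ⟨le_rfl, hbt.trans ht.2⟩ t ⟨hbt, ht.2⟩
    calc dist (f s) (f t) ≤ dist (f s) (f b) + dist (f b) (f t) := dist_triangle _ _ _
      _ ≤ K * dist s b + K * dist b t := add_le_add h₁' h₂'
      _ = K * dist s t := by
        rw [← mul_add, dist_comm s b, dist_comm b t, dist_comm s t, Real.dist_eq, Real.dist_eq,
          Real.dist_eq, abs_of_nonneg (sub_nonneg.2 hsb), abs_of_nonneg (sub_nonneg.2 hbt),
          abs_of_nonneg (sub_nonneg.2 hst)]
        ring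

/-- The nonlinearities `φ` admitted in the Kirchhoff equation. -/
structure IsKirchhoffCoefficient (ν : ℝ) (φ : ℝ → ℝ) : Prop where
  pos : 0 < ν
  le_apply : ∀ ρ, 0 ≤ ρ → ν ≤ φ ρ
  locallyLipschitzOn : LocallyLipschitzOn (Ici 0) φ

namespace IsKirchhoffCoefficient

variable {ν : ℝ} {φ : ℝ → ℝ} (hφ : IsKirchhoffCoefficient ν φ)
include hφ

theorem exists_lipschitzOnWith (R : ℝ) : ∃ P, LipschitzOnWith P φ (Icc 0 R) :=
  (hφ.locallyLipschitzOn.mono Icc_subset_Ici_self).exists_lipschitzOnWith_of_compact isCompact_Icc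

theorem isWaveSpeed_comp {P K : ℝ≥0} {R : ℝ} {r : ℝ → ℝ} {s : Set ℝ}
    (hP : LipschitzOnWith P φ (Icc 0 R)) (hr : LipschitzOnWith K r s)
    (hrR : MapsTo r s (Icc 0 R)) : IsWaveSpeed ν (P * K) (φ ∘ r) s :=
  ⟨hφ.pos, fun _ ht => hφ.le_apply _ (hrR ht).1, hP.comp hr hrR⟩

theorem exists_isWaveSpeed_comp {K : ℝ≥0} {r : ℝ → ℝ} {s : Set ℝ} (hs : IsCompact s)
    (hr : LipschitzOnWith K r s) (hr0 : ∀ t ∈ s, 0 ≤ r t) : ∃ L, IsWaveSpeed ν L (φ ∘ r) s := by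
  obtain ⟨R, hR⟩ := hs.exists_bound_of_continuousOn hr.continuousOn
  obtain ⟨P, hP⟩ := hφ.exists_lipschitzOnWith R
  exact ⟨P * K, hφ.isWaveSpeed_comp hP hr
    fun t ht => ⟨hr0 t ht, (le_abs_self _).trans (hR t ht)⟩⟩

end IsKirchhoffCoefficient

/-- A time step `τ` so short that, for a solution of energy `e` and a `P`-Lipschitz nonlinearity,
the fixed point map is a contraction on profiles with Lipschitz constant `K`. -/
structure IsShortTime (ν : ℝ) (P K : ℝ≥0) (e τ : ℝ) : Prop where
  nonneg : 0 ≤ τ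
  lipschitz_mul_le : K * τ ≤ 1
  rate_mul_le : (↑(P * K) / ν + 1) * τ ≤ 1
  mul_le : 72 * τ ≤ (1 / (2 * (P * e + 1))) ^ 2 * ν ^ 3

theorem IsShortTime.mono {ν e τ τ' : ℝ} {P K : ℝ≥0} (h : IsShortTime ν P K e τ) (hν : 0 < ν)
    (h0 : 0 ≤ τ') (hτ : τ' ≤ τ) : IsShortTime ν P K e τ' where
  nonneg := h0
  lipschitz_mul_le := le_trans (by gcongr) h.lipschitz_mul_le
  rate_mul_le := le_trans (by gcongr) h.rate_mul_le
  mul_le := le_trans (by gcongr) h.mul_le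

theorem exists_isShortTime {ν e : ℝ} (hν : 0 < ν) (he : 0 ≤ e) (P K : ℝ≥0) :
    ∃ τ, 0 < τ ∧ IsShortTime ν P K e τ := by
  have small (C : ℝ) {D : ℝ} (hD : 0 < D) : ∀ᶠ τ in 𝓝[>] (0 : ℝ), C * τ ≤ D :=
    nhdsWithin_le_nhds (((continuous_const_mul C).tendsto' 0 0 (mul_zero C)).eventually_le_const hD)
  obtain ⟨τ, ⟨⟨h₁, h₂⟩, h₃⟩, h0⟩ := (((small K one_pos).and (small (↑(P * K) / ν + 1) one_pos)).and
    (small 72 (D := (1 / (2 * (P * e + 1))) ^ 2 * ν ^ 3) (by positivity))).and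
    self_mem_nhdsWithin |>.exists
  exact ⟨τ, h0, h0.le, h₁, h₂, h₃⟩

section Profile

variable {Ω : Type*} [MeasurableSpace Ω] {μ : Measure Ω} {m : Ω → ℝ} {g₀ g₁ : Ω → ℂ} {φ : ℝ → ℝ}
  {ν ρ e T b : ℝ} {P K : ℝ≥0} {r r₁ r₂ r' : ℝ → ℝ}

/-- The function `r` is the profile `r(t) = ‖∇u(t)‖²` on `[0, T]` of a solution `u` of the Kirchhoff
equation. Here `u` does not occur: it is the wave with speed `φ ∘ r`, so that the equation becomes a
fixed point problem for `r`. -/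
structure IsProfile (μ : Measure Ω) (m : Ω → ℝ) (g₀ g₁ : Ω → ℂ) (φ : ℝ → ℝ) (T : ℝ) (r : ℝ → ℝ) :
    Prop where
  lipschitz : ∃ K, LipschitzOnWith K r (Icc 0 T)
  eq : ∀ t ∈ Icc 0 T, r t = waveGradSq μ m g₀ g₁ (φ ∘ r) t

namespace IsProfile

theorem mono (h : IsProfile μ m g₀ g₁ φ T r) {T' : ℝ} (hT : T' ≤ T) :
    IsProfile μ m g₀ g₁ φ T' r :=
  ⟨h.lipschitz.imp fun _ hK => hK.mono (Icc_subset_Icc_right hT),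
    fun t ht => h.eq t ⟨ht.1, ht.2.trans hT⟩⟩

theorem congr (h : IsProfile μ m g₀ g₁ φ T r) (hr : EqOn r r' (Icc 0 T)) :
    IsProfile μ m g₀ g₁ φ T r' :=
  ⟨h.lipschitz.imp fun _ hK => lipschitzOnWith_of_eqOn hK hr, fun t ht => by
    rw [← hr ht, h.eq t ht, waveGradSq_congr (hr.comp_left (g := φ)) ht]⟩

theorem nonneg (h : IsProfile μ m g₀ g₁ φ T r) : ∀ t ∈ Icc 0 T, 0 ≤ r t := fun t ht => by
  rw [h.eq t ht]
  exact waveGradSq_nonneg _ _ _ _ _ _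

theorem exists_isWaveSpeed (h : IsProfile μ m g₀ g₁ φ T r) (hφ : IsKirchhoffCoefficient ν φ) :
    ∃ L, IsWaveSpeed ν L (φ ∘ r) (Icc 0 T) :=
  let ⟨_, hK⟩ := h.lipschitz
  hφ.exists_isWaveSpeed_comp isCompact_Icc hK h.nonneg

theorem apply_zero (h : IsProfile μ m g₀ g₁ φ T r) (hT : 0 ≤ T) :
    r 0 = ∫ ξ, m ξ ^ 2 * ‖g₀ ξ‖ ^ 2 ∂μ := by
  simp only [h.eq 0 ⟨le_rfl, hT⟩, waveGradSq, wave_zero]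

end IsProfile

theorem isProfile_zero (μ : Measure Ω) (m : Ω → ℝ) (g₀ g₁ : Ω → ℂ) (φ : ℝ → ℝ) :
    IsProfile μ m g₀ g₁ φ 0 (fun _ => ∫ ξ, m ξ ^ 2 * ‖g₀ ξ‖ ^ 2 ∂μ) := by
  refine ⟨⟨0, .of_dist_le_mul fun _ _ _ _ => by simp⟩, fun t ht => ?_⟩
  simp only [le_antisymm ht.2 ht.1, waveGradSq, wave_zero]

theorem exists_waveEnergy_le {c : ℝ → ℝ} {L : ℝ≥0} (hd : IsWaveData μ m g₀ g₁)
    (hc : IsWaveSpeed ν L c (Icc 0 T)) : ∃ M, ∀ t ∈ Icc 0 T, waveEnergy μ m g₀ g₁ c t ≤ M := by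
  obtain ⟨C, -, hC⟩ := exists_waveDensity_le hc m g₀ g₁
  refine ⟨∫ ξ, C * (m ξ * dataDensity m g₀ g₁ ξ) ∂μ, fun t ht =>
    integral_mono (integrable_mul_waveDensity hd hc ht)
      (hd.isEnergyWeight_self.integrable.const_mul C) fun ξ => ?_⟩
  rw [mul_left_comm]
  exact mul_le_mul_of_nonneg_left (hC t ht ξ) (hd.nonneg ξ)

/-- A profile whose final state satisfies the bounds `‖∇u(T)‖² ≤ ρ` and `𝓔_{3/2}(u; T) ≤ e`. -/
structure IsBoundedProfile (μ : Measure Ω) (m : Ω → ℝ) (g₀ g₁ : Ω → ℂ) (φ : ℝ → ℝ) (ρ e T : ℝ)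
    (r : ℝ → ℝ) : Prop extends IsProfile μ m g₀ g₁ φ T r where
  time_nonneg : 0 ≤ T
  apply_le : r T ≤ ρ
  waveEnergy_le : waveEnergy μ m g₀ g₁ (φ ∘ r) T ≤ e

/-- The function `r'` extends `r` from `[0, T]` to `[0, b]`, with Lipschitz constant `K` on the
added interval. -/
structure IsExtension (r : ℝ → ℝ) (T : ℝ) (K : ℝ≥0) (b : ℝ) (r' : ℝ → ℝ) : Prop where
  eqOn : EqOn r' r (Icc 0 T)
  nonneg : ∀ t ∈ Icc T b, 0 ≤ r' t
  lipschitz : LipschitzOnWith K r' (Icc T b)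

namespace IsExtension

theorem congr (h : IsExtension r T K b r₁) (hT : 0 ≤ T) (hb : T ≤ b)
    (heq : EqOn r₁ r₂ (Icc 0 b)) : IsExtension r T K b r₂ where
  eqOn _ ht := (heq ⟨ht.1, ht.2.trans hb⟩).symm.trans (h.eqOn ht)
  nonneg t ht := (h.nonneg t ht).trans_eq (heq ⟨hT.trans ht.1, ht.2⟩)
  lipschitz := lipschitzOnWith_of_eqOn h.lipschitz (heq.mono (Icc_subset_Icc_left hT))

variable (h' : IsExtension r T K b r') (h : IsBoundedProfile μ m g₀ g₁ φ ρ e T r)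
include h' h

theorem mapsTo (hK : K * (b - T) ≤ 1) : MapsTo r' (Icc T b) (Icc 0 (ρ + 1)) := by
  refine fun t ht => ⟨h'.nonneg t ht, ?_⟩
  have hlip := h'.lipschitz.dist_le_mul t ht T (left_mem_Icc.2 (ht.1.trans ht.2))
  rw [Real.dist_eq, Real.dist_eq, abs_of_nonneg (sub_nonneg.2 ht.1),
    h'.eqOn (right_mem_Icc.2 h.time_nonneg)] at hlip
  have hKt : K * (t - T) ≤ K * (b - T) := by gcongr; exact ht.2
  linarith [le_abs_self (r' t - r T), h.apply_le]

theorem isWaveSpeed (hφ : IsKirchhoffCoefficient ν φ) (hP : LipschitzOnWith P φ (Icc 0 (ρ + 1)))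
    (hK : K * (b - T) ≤ 1) : IsWaveSpeed ν (P * K) (φ ∘ r') (Icc T b) :=
  hφ.isWaveSpeed_comp hP h'.lipschitz (h'.mapsTo h hK)

theorem exists_lipschitzOnWith : ∃ K', LipschitzOnWith K' r' (Icc 0 b) := by
  obtain ⟨K₀, hK₀⟩ := h.lipschitz
  exact ⟨max K₀ K, lipschitzOnWith_Icc_of_Icc_of_Icc
    ((lipschitzOnWith_of_eqOn hK₀ h'.eqOn.symm).weaken (le_max_left _ _))
    (h'.lipschitz.weaken (le_max_right _ _))⟩

theorem exists_isWaveSpeed (hφ : IsKirchhoffCoefficient ν φ) :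
    ∃ L, IsWaveSpeed ν L (φ ∘ r') (Icc 0 b) := by
  obtain ⟨K', hK'⟩ := h'.exists_lipschitzOnWith h
  refine hφ.exists_isWaveSpeed_comp isCompact_Icc hK' fun t ht => ?_
  rcases le_total t T with htT | hTt
  · rw [h'.eqOn ⟨ht.1, htT⟩]
    exact h.nonneg t ⟨ht.1, htT⟩
  · exact h'.nonneg t ⟨hTt, ht.2⟩

theorem waveEnergy_le : waveEnergy μ m g₀ g₁ (φ ∘ r') T ≤ e :=
  (waveEnergy_congr (h'.eqOn.comp_left (g := φ)) (right_mem_Icc.2 h.time_nonneg)).trans_le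
    h.waveEnergy_le

theorem eqOn_waveGradSq : EqOn (waveGradSq μ m g₀ g₁ (φ ∘ r')) r (Icc 0 T) := fun t ht => by
  rw [waveGradSq_congr (h'.eqOn.comp_left (g := φ)) ht, ← h.eq t ht]

variable (hd : IsWaveData μ m g₀ g₁) (hφ : IsKirchhoffCoefficient ν φ)
  (hP : LipschitzOnWith P φ (Icc 0 (ρ + 1))) (hτ : IsShortTime ν P K e (b - T))
include hd hφ hP hτ

theorem isExtension_waveGradSq (hK : 3 * e / √ν ≤ K) :
    IsExtension r T K b (waveGradSq μ m g₀ g₁ (φ ∘ r')) := by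
  obtain ⟨L, hL⟩ := h'.exists_isWaveSpeed h hφ
  refine ⟨h'.eqOn_waveGradSq h, fun _ _ => waveGradSq_nonneg _ _ _ _ _ _,
    lipschitzOnWith_waveGradSq hd hL h.time_nonneg
      (h'.isWaveSpeed h hφ hP hτ.lipschitz_mul_le) (le_trans ?_ hK)⟩
  have hexp : Real.exp ((↑(P * K) / ν + 1) * (b - T)) ≤ 3 :=
    (Real.exp_le_exp.2 hτ.rate_mul_le).trans Real.exp_one_lt_three.le
  rw [mul_div_right_comm]
  gcongr
  · exact waveEnergy_nonneg hd hL ⟨h.time_nonneg, sub_nonneg.1 hτ.nonneg⟩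
  · exact h'.waveEnergy_le h

theorem abs_waveGradSq_sub_le (h'' : IsExtension r T K b r₁) {d : ℝ}
    (hdist : ∀ t ∈ Icc T b, |r' t - r₁ t| ≤ d) {t : ℝ} (ht : t ∈ Icc 0 b) :
    |waveGradSq μ m g₀ g₁ (φ ∘ r') t - waveGradSq μ m g₀ g₁ (φ ∘ r₁) t| ≤ d / 2 := by
  have hTb : T ≤ b := sub_nonneg.1 hτ.nonneg
  have hd0 : 0 ≤ d := (abs_nonneg _).trans (hdist T ⟨le_rfl, hTb⟩)
  rcases le_total t T with htT | hTt
  · rw [h'.eqOn_waveGradSq h ⟨ht.1, htT⟩, h''.eqOn_waveGradSq h ⟨ht.1, htT⟩, sub_self, abs_zero]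
    positivity
  obtain ⟨L, hL⟩ := h'.exists_isWaveSpeed h hφ
  obtain ⟨L₁, hL₁⟩ := h''.exists_isWaveSpeed h hφ
  have he0 : 0 ≤ e := (waveEnergy_nonneg hd hL ⟨h.time_nonneg, hTb⟩).trans (h'.waveEnergy_le h)
  have hspeed : ∀ t ∈ Icc T b, |(φ ∘ r') t - (φ ∘ r₁) t| ≤ P * d := fun t ht =>
    (hP.dist_le_mul _ (h'.mapsTo h hτ.lipschitz_mul_le ht) _
      (h''.mapsTo h hτ.lipschitz_mul_le ht)).trans (mul_le_mul_of_nonneg_left (hdist t ht) P.2)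
  calc |waveGradSq μ m g₀ g₁ (φ ∘ r') t - waveGradSq μ m g₀ g₁ (φ ∘ r₁) t|
      ≤ P * d * (1 / (2 * (P * e + 1))) * waveEnergy μ m g₀ g₁ (φ ∘ r') T :=
        abs_waveGradSq_sub_waveGradSq_le hd hL hL₁ h.time_nonneg
          (h'.isWaveSpeed h hφ hP hτ.lipschitz_mul_le) (h''.isWaveSpeed h hφ hP hτ.lipschitz_mul_le)
          ((h'.eqOn.trans h''.eqOn.symm).comp_left (g := φ)) (by positivity) hspeed hτ.rate_mul_le
          (by positivity) hτ.mul_le ⟨hTt, ht.2⟩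
    _ ≤ P * d * (1 / (2 * (P * e + 1))) * e := by gcongr; exact h'.waveEnergy_le h
    _ = d / 2 * (P * e / (P * e + 1)) := by field_simp
    _ ≤ d / 2 := mul_le_of_le_one_right (by positivity)
        ((div_le_one (by positivity)).2 (le_add_of_nonneg_right zero_le_one))

end IsExtension

theorem IsProfile.exists_eqOn_step (hd : IsWaveData μ m g₀ g₁) (hφ : IsKirchhoffCoefficient ν φ)
    (hT : 0 ≤ T) (h₁ : IsProfile μ m g₀ g₁ φ T r₁) (h₂ : IsProfile μ m g₀ g₁ φ T r₂) :
    ∃ τ, 0 < τ ∧ ∀ a b, 0 ≤ a → a ≤ b → b ≤ T → b - a ≤ τ → EqOn r₁ r₂ (Icc 0 a) →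
      EqOn r₁ r₂ (Icc 0 b) := by
  obtain ⟨K₁, hK₁⟩ := h₁.lipschitz
  obtain ⟨K₂, hK₂⟩ := h₂.lipschitz
  obtain ⟨L, hL⟩ := h₁.exists_isWaveSpeed hφ
  obtain ⟨e, he⟩ := exists_waveEnergy_le hd hL
  obtain ⟨ρ, hρ⟩ := isCompact_Icc.exists_bound_of_continuousOn hK₁.continuousOn
  obtain ⟨P, hP⟩ := hφ.exists_lipschitzOnWith (ρ + 1)
  have he0 : 0 ≤ e := (waveEnergy_nonneg hd hL ⟨le_rfl, hT⟩).trans (he 0 ⟨le_rfl, hT⟩)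
  obtain ⟨τ, hτ0, hτ⟩ := exists_isShortTime hφ.pos he0 P (max K₁ K₂)
  refine ⟨τ, hτ0, fun a b ha hab hbT hbτ heq => ?_⟩
  have hsub : Icc a b ⊆ Icc 0 T := Icc_subset_Icc ha hbT
  have haT : a ∈ Icc 0 T := ⟨ha, hab.trans hbT⟩
  have hbdd : IsBoundedProfile μ m g₀ g₁ φ ρ e a r₁ :=
    ⟨h₁.mono haT.2, ha, (le_abs_self _).trans (hρ a haT), he a haT⟩
  have ext₁ : IsExtension r₁ a (max K₁ K₂) b r₁ :=
    ⟨eqOn_refl _ _, fun t ht => h₁.nonneg t (hsub ht), (hK₁.mono hsub).weaken (le_max_left _ _)⟩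
  have ext₂ : IsExtension r₁ a (max K₁ K₂) b r₂ :=
    ⟨heq.symm, fun t ht => h₂.nonneg t (hsub ht), (hK₂.mono hsub).weaken (le_max_right _ _)⟩
  obtain ⟨t', ht', hmax⟩ := isCompact_Icc.exists_isMaxOn (nonempty_Icc.2 hab)
    ((hK₁.continuousOn.sub hK₂.continuousOn).norm.mono hsub)
  have hcontr := ext₁.abs_waveGradSq_sub_le hbdd hd hφ hP
    (hτ.mono hφ.pos (sub_nonneg.2 hab) hbτ) ext₂ (fun s hs => hmax hs) ⟨ha.trans ht'.1, ht'.2⟩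
  rw [← h₁.eq t' (hsub ht'), ← h₂.eq t' (hsub ht')] at hcontr
  have hzero : |r₁ t' - r₂ t'| ≤ 0 := by
    simp only [Real.norm_eq_abs, Pi.sub_apply] at hcontr
    linarith
  intro t ht
  rcases le_total t a with hta | hat
  · exact heq ⟨ht.1, hta⟩
  · exact sub_eq_zero.1 (abs_nonpos_iff.1 ((hmax ⟨hat, ht.2⟩).trans hzero))

theorem IsProfile.unique (hd : IsWaveData μ m g₀ g₁) (hφ : IsKirchhoffCoefficient ν φ)
    (h₁ : IsProfile μ m g₀ g₁ φ T r₁) (h₂ : IsProfile μ m g₀ g₁ φ T r₂) :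
    EqOn r₁ r₂ (Icc 0 T) := by
  rcases lt_or_ge T 0 with hT | hT
  · simp [Icc_eq_empty_of_lt hT]
  obtain ⟨τ, hτ, step⟩ := h₁.exists_eqOn_step hd hφ hT h₂
  have heq : ∀ k : ℕ, EqOn r₁ r₂ (Icc 0 (min (k * τ) T)) := fun k => by
    induction k with
    | zero =>
      rw [Nat.cast_zero, zero_mul, min_eq_left hT, Icc_self, eqOn_singleton, h₁.apply_zero hT,
        h₂.apply_zero hT]
    | succ k ih =>
      refine step _ _ (by positivity) ?_ (min_le_right _ _) ?_ ih
      · gcongr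
        exact k.le_succ
      · push_cast
        rcases le_total (k * τ) T with hk | hk
        · rw [min_eq_left hk]
          linarith [min_le_left ((k + 1) * τ) T]
        · rw [min_eq_right hk]
          linarith [min_le_right ((k + 1) * τ) T]
  obtain ⟨k, hk⟩ := exists_nat_ge (T / τ)
  have hTk := heq k
  rwa [min_eq_right ((div_le_iff₀ hτ).1 hk)] at hTk

/-- The continuous functions on `[0, b]` which extend `r` in the sense of `IsExtension`. -/
def extensionSet (r : ℝ → ℝ) (T : ℝ) (K : ℝ≥0) {b : ℝ} (hb : 0 ≤ b) : Set C(Icc 0 b, ℝ) :=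
  {f | IsExtension r T K b (IccExtend hb f)}

theorem isClosed_extensionSet (r : ℝ → ℝ) (T : ℝ) (K : ℝ≥0) (hb : 0 ≤ b) :
    IsClosed (extensionSet r T K hb) := by
  have hev : Continuous fun (f : C(Icc 0 b, ℝ)) (t : ℝ) => IccExtend hb f t :=
    continuous_pi fun t => continuous_eval_const _
  have hset : extensionSet r T K hb = (fun (f : C(Icc 0 b, ℝ)) (t : ℝ) => IccExtend hb f t) ⁻¹'
      ({f | EqOn f r (Icc 0 T)} ∩ ({f | ∀ t ∈ Icc T b, 0 ≤ f t} ∩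
        {f | LipschitzOnWith K f (Icc T b)})) :=
    Set.ext fun f => ⟨fun h => ⟨h.1, h.2, h.3⟩, fun h => ⟨h.1, h.2.1, h.2.2⟩⟩
  rw [hset]
  refine IsClosed.preimage hev (.inter ?_ (.inter ?_ (isClosed_setOfPred_lipschitzOnWith _ _)))
  · simp only [EqOn, ofPred_forall]
    exact isClosed_biInter fun t _ => isClosed_eq (continuous_apply t) continuous_const
  · simp only [ofPred_forall]
    exact isClosed_biInter fun t _ => isClosed_le continuous_const (continuous_apply t)

theorem IsProfile.nonempty_extensionSet (h : IsProfile μ m g₀ g₁ φ T r) (hT : 0 ≤ T) (hTb : T ≤ b)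
    (K : ℝ≥0) : (extensionSet r T K (hT.trans hTb)).Nonempty := by
  have hb := hT.trans hTb
  obtain ⟨K₀, hK₀⟩ := h.lipschitz
  have hmem : ∀ t ∈ Icc 0 b, min t T ∈ Icc 0 T := fun t ht => ⟨le_min ht.1 hT, min_le_right _ _⟩
  have hcont : ContinuousOn (fun t => r (min t T)) (Icc 0 b) :=
    hK₀.continuousOn.comp (by fun_prop) hmem
  have hext : IsExtension r T K b fun t => r (min t T) := by
    refine ⟨fun t ht => ?_, fun t ht => h.nonneg _ (hmem t ⟨hT.trans ht.1, ht.2⟩),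
      .of_dist_le_mul fun s hs t ht => ?_⟩
    · simp only [min_eq_left ht.2]
    · rw [min_eq_right hs.1, min_eq_right ht.1, dist_self]
      positivity
  exact ⟨⟨_, hcont.domRestrict⟩, hext.congr hT hTb fun t ht =>
    (IccExtend_of_mem hb ((Icc 0 b).domRestrict fun t => r (min t T)) ht).symm⟩

theorem IsBoundedProfile.exists_extend (h : IsBoundedProfile μ m g₀ g₁ φ ρ e T r)
    (hd : IsWaveData μ m g₀ g₁) (hφ : IsKirchhoffCoefficient ν φ)
    (hP : LipschitzOnWith P φ (Icc 0 (ρ + 1))) (hK : 3 * e / √ν ≤ K)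
    (hτ : IsShortTime ν P K e (b - T)) : ∃ r', IsProfile μ m g₀ g₁ φ b r' := by
  have hTb : T ≤ b := sub_nonneg.1 hτ.nonneg
  have hb := h.time_nonneg.trans hTb
  let S := extensionSet r T K hb
  have cont (f : S) : ContinuousOn (waveGradSq μ m g₀ g₁ (φ ∘ IccExtend hb f.1)) (Icc 0 b) :=
    let ⟨_, hL⟩ := f.2.exists_isWaveSpeed h hφ
    continuousOn_waveGradSq hd hL
  let F (f : S) : S := ⟨⟨_, (cont f).domRestrict⟩,
    (f.2.isExtension_waveGradSq h hd hφ hP hτ hK).congr h.time_nonneg hTb fun t ht =>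
      (IccExtend_of_mem hb ((Icc 0 b).domRestrict (waveGradSq μ m g₀ g₁ _)) ht).symm⟩
  have hF : ContractingWith (1 / 2) F := by
    refine ⟨by norm_num, LipschitzWith.of_dist_le_mul fun f g => ?_⟩
    refine (ContinuousMap.dist_le (by positivity)).2 fun x => ?_
    have hdist := f.2.abs_waveGradSq_sub_le h hd hφ hP hτ g.2 (d := dist f.1 g.1)
      (fun t _ => ContinuousMap.dist_apply_le_dist (f := f.1) (g := g.1) (projIcc 0 b hb t)) x.2
    refine hdist.trans_eq ?_
    rw [Subtype.dist_eq]
    push_cast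
    ring
  have : CompleteSpace S := (isClosed_extensionSet r T K hb).completeSpace_coe
  have : Nonempty S := (h.nonempty_extensionSet h.time_nonneg hTb K).to_subtype
  let f := hF.fixedPoint
  refine ⟨IccExtend hb f.1, f.2.exists_lipschitzOnWith h, fun t ht => ?_⟩
  rw [IccExtend_of_mem hb _ ht]
  exact (DFunLike.congr_fun (congrArg Subtype.val hF.fixedPoint_isFixedPt) ⟨t, ht⟩).symm

end Profile

theorem exists_extension_time {ν : ℝ} {φ : ℝ → ℝ} (hφ : IsKirchhoffCoefficient ν φ) (ρ : ℝ) {e : ℝ}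
    (he : 0 ≤ e) : ∃ τ : ℝ, 0 < τ ∧ ∀ (Ω : Type) [MeasurableSpace Ω] (μ : Measure Ω) (m : Ω → ℝ)
      (g₀ g₁ : Ω → ℂ), IsWaveData μ m g₀ g₁ → ∀ T r, IsBoundedProfile μ m g₀ g₁ φ ρ e T r →
        ∃ r', IsProfile μ m g₀ g₁ φ (T + τ) r' := by
  obtain ⟨P, hP⟩ := hφ.exists_lipschitzOnWith (ρ + 1)
  obtain ⟨τ, hτ0, hτ⟩ := exists_isShortTime hφ.pos he P (3 * e / √ν).toNNReal
  refine ⟨τ, hτ0, fun Ω _ μ m g₀ g₁ hd T r h =>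
    h.exists_extend hd hφ hP (Real.le_coe_toNNReal _) ?_⟩
  rwa [add_sub_cancel_left]

theorem ofReal_mul_enorm_sq {E : Type*} [SeminormedAddCommGroup E] {a : ℝ} (ha : 0 ≤ a) (z : E) :
    ENNReal.ofReal a * ‖z‖ₑ ^ 2 = ENNReal.ofReal (a * ‖z‖ ^ 2) := by
  rw [ENNReal.ofReal_mul ha, ENNReal.ofReal_pow (norm_nonneg _), ofReal_norm]

theorem norm_sub_sq_le {E : Type*} [SeminormedAddCommGroup E] (a b : E) :
    ‖a - b‖ ^ 2 ≤ 2 * ‖a‖ ^ 2 + 2 * ‖b‖ ^ 2 :=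
  calc ‖a - b‖ ^ 2 ≤ (‖a‖ + ‖b‖) ^ 2 := by gcongr; exact norm_sub_le a b
    _ ≤ 2 * ‖a‖ ^ 2 + 2 * ‖b‖ ^ 2 := add_sq_le.trans_eq (mul_add _ _ _)

section Limits

variable {Ω : Type*} {m w : Ω → ℝ} {g₀ g₁ : Ω → ℂ} {c : ℝ → ℝ} {T ν s t : ℝ} {L : ℝ≥0}

theorem exists_norm_wave_sub_sq_le (hc : IsWaveSpeed ν L c (Icc 0 T)) (m : Ω → ℝ) (g₀ g₁ : Ω → ℂ) :
    ∃ C, 0 ≤ C ∧ ∀ s ∈ Icc 0 T, ∀ t ∈ Icc 0 T, ∀ ξ,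
      ‖wave m g₀ g₁ c s ξ - wave m g₀ g₁ c t ξ‖ ^ 2 ≤ C * dataDensity m g₀ g₁ ξ * (s - t) ^ 2 := by
  obtain ⟨C, hC0, hC⟩ := exists_norm_sq_le hc m g₀ g₁
  refine ⟨C, hC0, fun s hs t ht ξ => ?_⟩
  have hlip := Convex.norm_image_sub_le_of_norm_hasDerivWithin_le
    (isOscillation_wave hc.lipschitz.continuousOn ξ).hasDerivWithinAt
    (fun x hx => Real.le_sqrt_of_sq_le (hC x hx ξ).2) (convex_Icc 0 T) ht hs
  have hpos : 0 ≤ C * dataDensity m g₀ g₁ ξ := mul_nonneg hC0 (dataDensity_nonneg m g₀ g₁ ξ)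
  calc _ ≤ (√(C * dataDensity m g₀ g₁ ξ) * ‖s - t‖) ^ 2 := by gcongr
    _ = _ := by rw [mul_pow, Real.sq_sqrt hpos, Real.norm_eq_abs, sq_abs]

theorem exists_norm_wave_slope_sub_sq_le (hc : IsWaveSpeed ν L c (Icc 0 T)) (m : Ω → ℝ)
    (g₀ g₁ : Ω → ℂ) :
    ∃ C, ∀ s ∈ Icc 0 T, ∀ t ∈ Icc 0 T, s ≠ t → ∀ ξ,
      ‖((s - t : ℝ) : ℂ)⁻¹ * (wave m g₀ g₁ c s ξ - wave m g₀ g₁ c t ξ) -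
        waveVelocity m g₀ g₁ c t ξ‖ ^ 2 ≤ C * dataDensity m g₀ g₁ ξ := by
  obtain ⟨C, -, hC⟩ := exists_norm_sq_le hc m g₀ g₁
  obtain ⟨C', -, hC'⟩ := exists_norm_wave_sub_sq_le hc m g₀ g₁
  refine ⟨2 * C' + 2 * C, fun s hs t ht hst ξ => ?_⟩
  have hslope : ‖((s - t : ℝ) : ℂ)⁻¹ * (wave m g₀ g₁ c s ξ - wave m g₀ g₁ c t ξ)‖ ^ 2 ≤
      C' * dataDensity m g₀ g₁ ξ := by
    rw [norm_mul, norm_inv, Complex.norm_real, mul_pow, inv_pow, Real.norm_eq_abs, sq_abs,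
      inv_mul_le_iff₀ (sq_pos_of_ne_zero (sub_ne_zero.2 hst)), mul_comm]
    exact hC' s hs t ht ξ
  calc _ ≤ 2 * (C' * dataDensity m g₀ g₁ ξ) + 2 * (C * dataDensity m g₀ g₁ ξ) :=
        (norm_sub_sq_le _ _).trans (by gcongr; exact (hC t ht ξ).2)
    _ = _ := by ring

variable [MeasurableSpace Ω] {μ : Measure Ω}

theorem tendsto_lintegral_mul_enorm_sq {ι : Type*} {l : Filter ι} [l.IsCountablyGenerated]
    {F : ι → Ω → ℂ} {v G : Ω → ℝ} (hv : Measurable v) (hv0 : ∀ ξ, 0 ≤ v ξ) (hG : Integrable G μ)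
    (hF : ∀ᶠ r in l, AEStronglyMeasurable (F r) μ)
    (hFG : ∀ᶠ r in l, ∀ ξ, v ξ * ‖F r ξ‖ ^ 2 ≤ G ξ)
    (hlim : ∀ ξ, Tendsto (fun r => F r ξ) l (𝓝 0)) :
    Tendsto (fun r => ∫⁻ ξ, ENNReal.ofReal (v ξ) * ‖F r ξ‖ₑ ^ 2 ∂μ) l (𝓝 0) := by
  simp only [ofReal_mul_enorm_sq (hv0 _)]
  rw [← lintegral_zero (μ := μ)]
  refine tendsto_lintegral_filter_of_dominated_convergence' (fun ξ => ENNReal.ofReal (G ξ))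
    ?_ ?_ hG.lintegral_lt_top.ne (.of_forall fun ξ => ?_)
  · filter_upwards [hF] with r hr
    exact (hv.aemeasurable.mul (hr.norm.aemeasurable.pow_const 2)).ennreal_ofReal
  · filter_upwards [hFG] with r hr
    exact .of_forall fun ξ => ENNReal.ofReal_le_ofReal (hr ξ)
  · have h : Tendsto (fun r => v ξ * ‖F r ξ‖ ^ 2) l (𝓝 0) := by
      simpa using (((hlim ξ).norm).pow 2).const_mul (v ξ)
    simpa using ENNReal.tendsto_ofReal h

namespace IsEnergyWeight

theorem lintegral_lt_top (hw : IsEnergyWeight μ m g₀ g₁ w) {k : Ω → ℝ} (hk : ∀ ξ, 0 ≤ k ξ)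
    {F : Ω → ℂ} {C : ℝ} (hFC : ∀ ξ, k ξ * ‖F ξ‖ ^ 2 ≤ C * dataDensity m g₀ g₁ ξ) :
    ∫⁻ ξ, ENNReal.ofReal (w ξ * k ξ) * ‖F ξ‖ₑ ^ 2 ∂μ < ∞ := by
  refine lt_of_le_of_lt (lintegral_mono fun ξ => ?_) (hw.integrable.const_mul C).lintegral_lt_top
  rw [ofReal_mul_enorm_sq (mul_nonneg (hw.nonneg ξ) (hk ξ)), mul_assoc, mul_left_comm C]
  exact ENNReal.ofReal_le_ofReal (mul_le_mul_of_nonneg_left (hFC ξ) (hw.nonneg ξ))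

theorem tendsto_lintegral (hw : IsEnergyWeight μ m g₀ g₁ w) {k : Ω → ℝ} (hk : Measurable k)
    (hk0 : ∀ ξ, 0 ≤ k ξ) {ι : Type*} {l : Filter ι} [l.IsCountablyGenerated] {F : ι → Ω → ℂ} {C : ℝ}
    (hF : ∀ᶠ r in l, AEStronglyMeasurable (F r) μ)
    (hFC : ∀ᶠ r in l, ∀ ξ, k ξ * ‖F r ξ‖ ^ 2 ≤ C * dataDensity m g₀ g₁ ξ)
    (hlim : ∀ ξ, Tendsto (fun r => F r ξ) l (𝓝 0)) :
    Tendsto (fun r => ∫⁻ ξ, ENNReal.ofReal (w ξ * k ξ) * ‖F r ξ‖ₑ ^ 2 ∂μ) l (𝓝 0) := by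
  refine tendsto_lintegral_mul_enorm_sq (hw.measurable.mul hk)
    (fun ξ => mul_nonneg (hw.nonneg ξ) (hk0 ξ)) (hw.integrable.const_mul C) hF ?_ hlim
  filter_upwards [hFC] with r hr ξ
  rw [mul_assoc, mul_left_comm C]
  exact mul_le_mul_of_nonneg_left (hr ξ) (hw.nonneg ξ)

theorem tendsto_lintegral_wave (hw : IsEnergyWeight μ m g₀ g₁ w) (hd : IsWaveData μ m g₀ g₁)
    (hc : IsWaveSpeed ν L c (Icc 0 T)) (ht : t ∈ Icc 0 T) :
    Tendsto (fun r => ∫⁻ ξ, ENNReal.ofReal (w ξ * m ξ ^ 2) *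
      ‖wave m g₀ g₁ c r ξ - wave m g₀ g₁ c t ξ‖ₑ ^ 2 ∂μ) (𝓝[Icc 0 T] t) (𝓝 0) := by
  obtain ⟨C, -, hC⟩ := exists_norm_sq_le hc m g₀ g₁
  have hcont := hc.lipschitz.continuousOn
  refine hw.tendsto_lintegral (C := 4 * C) (hd.measurable.pow_const 2) (fun ξ => sq_nonneg _)
    ?_ ?_ fun ξ => ?_
  · filter_upwards [self_mem_nhdsWithin] with r hr
    exact (aestronglyMeasurable_wave hd hcont hr).sub (aestronglyMeasurable_wave hd hcont ht)
  · filter_upwards [self_mem_nhdsWithin] with r hr ξ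
    calc _ ≤ m ξ ^ 2 * (2 * ‖wave m g₀ g₁ c r ξ‖ ^ 2 + 2 * ‖wave m g₀ g₁ c t ξ‖ ^ 2) := by
          gcongr; exact norm_sub_sq_le _ _
      _ ≤ _ := by linarith [(hC r hr ξ).1, (hC t ht ξ).1]
  · have h := (isOscillation_wave (m := m) (g₀ := g₀) (g₁ := g₁) hcont ξ).hasDerivWithinAt t ht
    simpa using h.continuousWithinAt.tendsto.sub_const (wave m g₀ g₁ c t ξ)

theorem tendsto_lintegral_waveVelocity (hw : IsEnergyWeight μ m g₀ g₁ w)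
    (hd : IsWaveData μ m g₀ g₁) (hc : IsWaveSpeed ν L c (Icc 0 T)) (ht : t ∈ Icc 0 T) :
    Tendsto (fun r => ∫⁻ ξ, ENNReal.ofReal (w ξ) *
      ‖waveVelocity m g₀ g₁ c r ξ - waveVelocity m g₀ g₁ c t ξ‖ₑ ^ 2 ∂μ) (𝓝[Icc 0 T] t) (𝓝 0) := by
  obtain ⟨C, -, hC⟩ := exists_norm_sq_le hc m g₀ g₁
  have hcont := hc.lipschitz.continuousOn
  have hlim := hw.tendsto_lintegral (k := 1) (C := 4 * C) (l := 𝓝[Icc 0 T] t)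
    (F := fun r ξ => waveVelocity m g₀ g₁ c r ξ - waveVelocity m g₀ g₁ c t ξ)
    measurable_const (fun _ => zero_le_one) ?_ ?_ fun ξ => ?_
  · simpa only [Pi.one_apply, mul_one] using hlim
  · filter_upwards [self_mem_nhdsWithin] with r hr
    exact (aestronglyMeasurable_waveVelocity hd hcont hr).sub
      (aestronglyMeasurable_waveVelocity hd hcont ht)
  · filter_upwards [self_mem_nhdsWithin] with r hr ξ
    rw [Pi.one_apply, one_mul]
    exact (norm_sub_sq_le _ _).trans (by linarith [(hC r hr ξ).2, (hC t ht ξ).2])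
  · have h := (isOscillation_wave (m := m) (g₀ := g₀) (g₁ := g₁) hcont ξ)
      |>.hasDerivWithinAt_velocity t ht
    simpa using h.continuousWithinAt.tendsto.sub_const (waveVelocity m g₀ g₁ c t ξ)

theorem tendsto_lintegral_wave_slope (hw : IsEnergyWeight μ m g₀ g₁ w)
    (hd : IsWaveData μ m g₀ g₁) (hc : IsWaveSpeed ν L c (Icc 0 T)) (ht : t ∈ Icc 0 T) :
    Tendsto (fun r => ∫⁻ ξ, ENNReal.ofReal (w ξ) * ‖((r - t : ℝ) : ℂ)⁻¹ *
      (wave m g₀ g₁ c r ξ - wave m g₀ g₁ c t ξ) - waveVelocity m g₀ g₁ c t ξ‖ₑ ^ 2 ∂μ)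
      (𝓝[Icc 0 T \ {t}] t) (𝓝 0) := by
  obtain ⟨C, hC⟩ := exists_norm_wave_slope_sub_sq_le hc m g₀ g₁
  have hcont := hc.lipschitz.continuousOn
  have hlim := hw.tendsto_lintegral (k := 1) (C := C) (l := 𝓝[Icc 0 T \ {t}] t)
    (F := fun r ξ => ((r - t : ℝ) : ℂ)⁻¹ * (wave m g₀ g₁ c r ξ - wave m g₀ g₁ c t ξ) -
      waveVelocity m g₀ g₁ c t ξ) measurable_const (fun _ => zero_le_one) ?_ ?_ fun ξ => ?_
  · simpa only [Pi.one_apply, mul_one] using hlim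
  · filter_upwards [self_mem_nhdsWithin] with r hr
    exact (((aestronglyMeasurable_wave hd hcont hr.1).sub
      (aestronglyMeasurable_wave hd hcont ht)).const_mul _).sub
      (aestronglyMeasurable_waveVelocity hd hcont ht)
  · filter_upwards [self_mem_nhdsWithin] with r hr ξ
    rw [Pi.one_apply, one_mul]
    exact hC r hr.1 t ht hr.2 ξ
  · have h := (isOscillation_wave (m := m) (g₀ := g₀) (g₁ := g₁) hcont ξ).hasDerivWithinAt t ht
    have hslope := (hasDerivWithinAt_iff_tendsto_slope.1 h).sub_const (waveVelocity m g₀ g₁ c t ξ)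
    rw [sub_self] at hslope
    refine hslope.congr fun r => ?_
    rw [slope_def_module, Complex.real_smul, Complex.ofReal_inv]

theorem lintegral_wave_lt_top (hw : IsEnergyWeight μ m g₀ g₁ w) (hc : IsWaveSpeed ν L c (Icc 0 T))
    (ht : t ∈ Icc 0 T) :
    ∫⁻ ξ, ENNReal.ofReal (w ξ * m ξ ^ 2) * ‖wave m g₀ g₁ c t ξ‖ₑ ^ 2 ∂μ < ∞ := by
  obtain ⟨C, -, hC⟩ := exists_norm_sq_le hc m g₀ g₁
  exact hw.lintegral_lt_top (fun ξ => sq_nonneg _) fun ξ => (hC t ht ξ).1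

theorem lintegral_waveVelocity_lt_top (hw : IsEnergyWeight μ m g₀ g₁ w)
    (hc : IsWaveSpeed ν L c (Icc 0 T)) (ht : t ∈ Icc 0 T) :
    ∫⁻ ξ, ENNReal.ofReal (w ξ) * ‖waveVelocity m g₀ g₁ c t ξ‖ₑ ^ 2 ∂μ < ∞ := by
  obtain ⟨C, -, hC⟩ := exists_norm_sq_le hc m g₀ g₁
  simpa only [mul_one] using hw.lintegral_lt_top (k := fun _ => 1) (fun _ => zero_le_one)
    fun ξ => (one_mul _).trans_le (hC t ht ξ).2

theorem lintegral_wave_sub_lt_top (hw : IsEnergyWeight μ m g₀ g₁ w)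
    (hc : IsWaveSpeed ν L c (Icc 0 T)) (hs : s ∈ Icc 0 T) (ht : t ∈ Icc 0 T) :
    ∫⁻ ξ, ENNReal.ofReal (w ξ) * ‖wave m g₀ g₁ c s ξ - wave m g₀ g₁ c t ξ‖ₑ ^ 2 ∂μ < ∞ := by
  obtain ⟨C, -, hC⟩ := exists_norm_wave_sub_sq_le hc m g₀ g₁
  simpa only [mul_one] using hw.lintegral_lt_top (k := fun _ => 1) (C := C * (s - t) ^ 2)
    (fun _ => zero_le_one) fun ξ => (one_mul _).trans_le ((hC s hs t ht ξ).trans_eq (by ring))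

end IsEnergyWeight

end Limits

theorem integrable_freq_pow_mul_norm_sq (Θ : 𝓢(Rn n, ℂ)) (k : ℕ) :
    Integrable (fun ξ => freq ξ ^ k * ‖Θ ξ‖ ^ 2) volume := by
  have h := ((Θ.integrable_pow_mul volume k).const_mul ((2 * Real.pi) ^ k)).bdd_mul
    Θ.continuous.norm.aestronglyMeasurable (.of_forall fun ξ =>
      (norm_norm (Θ ξ)).trans_le (SchwartzMap.norm_le_seminorm ℝ Θ ξ))
  refine h.congr (.of_forall fun ξ => ?_)
  simp only [freq, mul_pow]
  ring

section Flow

variable {g₀ g₁ : Rn n → ℂ} {c : ℝ → ℝ} {T ν t : ℝ} {L : ℝ≥0}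

theorem IsWaveData.isTemperedFunction_waveVelocity (hd : IsWaveData volume freq g₀ g₁)
    (hc : IsWaveSpeed ν L c (Icc 0 T)) (ht : t ∈ Icc 0 T) :
    IsTemperedFunction (waveVelocity freq g₀ g₁ c t) := by
  have hfin := hd.isEnergyWeight_one.lintegral_waveVelocity_lt_top hc ht
  have hL2 := memLp_two_of_lintegral_sq_lt_top
    (aestronglyMeasurable_waveVelocity hd hc.lipschitz.continuousOn ht) (by simpa using hfin)
  exact .of_lintegral_lt_top (hL2.locallyIntegrable one_le_two) (fun _ _ => le_rfl) hfin

theorem IsWaveData.isTemperedFunction_wave (hd : IsWaveData volume freq g₀ g₁)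
    (hg₀ : LocallyIntegrable g₀ volume) (hc : IsWaveSpeed ν L c (Icc 0 T)) (ht : t ∈ Icc 0 T) :
    IsTemperedFunction (wave freq g₀ g₁ c t) := by
  have h0 : (0 : ℝ) ∈ Icc 0 T := ⟨le_rfl, ht.1.trans ht.2⟩
  have hcont := hc.lipschitz.continuousOn
  have hL2 : MemLp (wave freq g₀ g₁ c t - wave freq g₀ g₁ c 0) 2 volume :=
    memLp_two_of_lintegral_sq_lt_top
      ((aestronglyMeasurable_wave hd hcont ht).sub (aestronglyMeasurable_wave hd hcont h0))
      (by simpa using hd.isEnergyWeight_one.lintegral_wave_sub_lt_top hc ht h0)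
  have hloc : LocallyIntegrable (wave freq g₀ g₁ c t) volume := by
    refine ((hL2.locallyIntegrable one_le_two).add hg₀).congr (.of_forall fun ξ => ?_)
    simp only [Pi.add_apply, Pi.sub_apply, wave_zero, sub_add_cancel]
  refine .of_lintegral_lt_top hloc (w := fun ξ => (1 : Rn n → ℝ) ξ * freq ξ ^ 2)
    (fun ξ hξ => ?_) (hd.isEnergyWeight_one.lintegral_wave_lt_top hc ht)
  rw [Pi.one_apply, one_mul]
  exact one_le_pow₀ (one_le_freq hξ)

theorem norm_mul_wave_le {C M : ℝ} {z y : ℂ} {l q d : ℝ} (hl : 0 ≤ l) (hq : ‖q‖ ≤ M)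
    (hy : l * ‖y‖ ^ 2 ≤ C * d) :
    ‖z * (((-(l * q) : ℝ) : ℂ) * y)‖ ≤ M * (l * ‖z‖ ^ 2 + C * d) := by
  have hM : 0 ≤ M := (norm_nonneg _).trans hq
  have hzy : ‖z‖ * ‖y‖ ≤ ‖z‖ ^ 2 + ‖y‖ ^ 2 := by
    nlinarith [sq_nonneg (‖z‖ - ‖y‖), sq_nonneg ‖z‖, sq_nonneg ‖y‖]
  rw [norm_mul, norm_mul, Complex.norm_real, norm_neg, norm_mul, Real.norm_of_nonneg hl]
  calc ‖z‖ * (l * ‖q‖ * ‖y‖) = ‖q‖ * (l * (‖z‖ * ‖y‖)) := by ring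
    _ ≤ M * (l * (‖z‖ ^ 2 + ‖y‖ ^ 2)) := by gcongr
    _ ≤ M * (l * ‖z‖ ^ 2 + C * d) := by rw [mul_add]; gcongr

theorem IsWaveData.hasDerivAt_integral_mul_waveVelocity (hd : IsWaveData volume freq g₀ g₁)
    (hc : IsWaveSpeed ν L c (Icc 0 T)) (Θ : 𝓢(Rn n, ℂ)) (ht : t ∈ Ioo 0 T) :
    HasDerivAt (fun r => ∫ ξ, Θ ξ * waveVelocity freq g₀ g₁ c r ξ)
      (∫ ξ, Θ ξ * (((-(freq ξ ^ 2 * c t) : ℝ) : ℂ) * wave freq g₀ g₁ c t ξ)) t := by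
  obtain ⟨C, -, hC⟩ := exists_norm_sq_le hc freq g₀ g₁
  have hcont := hc.lipschitz.continuousOn
  obtain ⟨M, hM⟩ := isCompact_Icc.exists_bound_of_continuousOn hcont
  have ht' : t ∈ Icc 0 T := Ioo_subset_Icc_self ht
  have hdata : Integrable (dataDensity freq g₀ g₁) volume := by
    simpa using hd.isEnergyWeight_one.integrable
  refine (hasDerivAt_integral_of_dominated_loc_of_deriv_le (s := Ioo 0 T)
    (F' := fun r ξ => Θ ξ * (((-(freq ξ ^ 2 * c r) : ℝ) : ℂ) * wave freq g₀ g₁ c r ξ))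
    (bound := fun ξ => M * (freq ξ ^ 2 * ‖Θ ξ‖ ^ 2 + C * dataDensity freq g₀ g₁ ξ))
    (Ioo_mem_nhds ht.1 ht.2) ?_ ((hd.isTemperedFunction_waveVelocity hc ht').integrable_mul Θ)
    ?_ (.of_forall fun ξ r hr => ?_)
    (((integrable_freq_pow_mul_norm_sq Θ 2).add (hdata.const_mul C)).const_mul M)
    (.of_forall fun ξ r hr => ?_)).2
  · filter_upwards [Ioo_mem_nhds ht.1 ht.2] with r hr
    exact Θ.continuous.aestronglyMeasurable.mul
      (aestronglyMeasurable_waveVelocity hd hcont (Ioo_subset_Icc_self hr))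
  · refine Θ.continuous.aestronglyMeasurable.mul (AEStronglyMeasurable.mul ?_
      (aestronglyMeasurable_wave hd hcont ht'))
    exact (Complex.measurable_ofReal.comp
      (((measurable_freq.pow_const 2).mul_const _).neg)).aestronglyMeasurable
  · exact norm_mul_wave_le (sq_nonneg _) (hM r (Ioo_subset_Icc_self hr))
      (hC r (Ioo_subset_Icc_self hr) ξ).1
  · have h := (isOscillation_wave (m := freq) (g₀ := g₀) (g₁ := g₁) hcont ξ)
      |>.hasDerivWithinAt_velocity r (Ioo_subset_Icc_self hr)
    simpa using (h.hasDerivAt (Icc_mem_nhds hr.1 hr.2)).const_mul (Θ ξ)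

end Flow

section TimeInterval

variable {T : EReal} {t b : ℝ}

theorem zero_mem_timeInterval (ht : t ∈ timeInterval T) : 0 ∈ timeInterval T :=
  ⟨le_rfl, lt_of_le_of_lt (EReal.coe_le_coe_iff.2 ht.1) ht.2⟩

theorem Icc_subset_timeInterval (hb : b ∈ timeInterval T) : Icc 0 b ⊆ timeInterval T :=
  fun _ hx => ⟨hx.1, lt_of_le_of_lt (EReal.coe_le_coe_iff.2 hx.2) hb.2⟩

theorem exists_mem_timeInterval_gt (ht : t ∈ timeInterval T) : ∃ b ∈ timeInterval T, t < b := by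
  obtain ⟨b, htb, hbT⟩ := EReal.lt_iff_exists_real_btwn.1 ht.2
  have htb' : t < b := EReal.coe_lt_coe_iff.1 htb
  exact ⟨b, ⟨ht.1.trans htb'.le, hbT⟩, htb'⟩

theorem nhdsWithin_timeInterval_le (htb : t < b) : 𝓝[timeInterval T] t ≤ 𝓝[Icc 0 b] t := by
  refine nhdsWithin_le_iff.2 ?_
  filter_upwards [self_mem_nhdsWithin, nhdsWithin_le_nhds (Iio_mem_nhds htb)] with r hr hrb
  exact ⟨hr.1, le_of_lt hrb⟩

theorem continuousOn_timeInterval {E : Type*} [TopologicalSpace E] {f : ℝ → E}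
    (h : ∀ b ∈ timeInterval T, ContinuousOn f (Icc 0 b)) : ContinuousOn f (timeInterval T) :=
  fun t ht =>
    let ⟨b, hb, htb⟩ := exists_mem_timeInterval_gt ht
    (h b hb t ⟨ht.1, htb.le⟩).mono_left (nhdsWithin_timeInterval_le htb)

theorem nhdsWithin_timeInterval_diff_le (htb : t < b) :
    𝓝[timeInterval T \ {t}] t ≤ 𝓝[Icc 0 b \ {t}] t := by
  rw [sdiff_eq, nhdsWithin_inter', sdiff_eq, nhdsWithin_inter']
  exact inf_le_inf_right _ (nhdsWithin_timeInterval_le htb)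

end TimeInterval

/-- The pair `(u, v)` is the solution on `[0, T)`, with time derivative `v`, of the linear wave
equation with speed `c` whose data have the Fourier transforms `g₀` and `g₁`. -/
structure IsFlow (g₀ g₁ : Rn n → ℂ) (c : ℝ → ℝ) (T : EReal) (u v : ℝ → 𝓢'(Rn n, ℂ)) : Prop where
  hasFourierFunction : ∀ t ∈ timeInterval T, HasFourierFunction (u t) (wave freq g₀ g₁ c t)
  hasFourierFunction_velocity :
    ∀ t ∈ timeInterval T, HasFourierFunction (v t) (waveVelocity freq g₀ g₁ c t)

section IsFlow

variable {g₀ g₁ : Rn n → ℂ} {w : Rn n → ℝ} {c : ℝ → ℝ} {T : EReal} {ν t : ℝ}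
  {u v : ℝ → 𝓢'(Rn n, ℂ)} {u₀ u₁ : 𝓢'(Rn n, ℂ)}

theorem exists_isFlow (hd : IsWaveData volume freq g₀ g₁) (hg₀ : LocallyIntegrable g₀ volume)
    (hc : ∀ b ∈ timeInterval T, ∃ L, IsWaveSpeed ν L c (Icc 0 b)) :
    ∃ u v : ℝ → 𝓢'(Rn n, ℂ), IsFlow g₀ g₁ c T u v := by
  have hu (t : ℝ) (ht : t ∈ timeInterval T) :
      ∃ f : 𝓢'(Rn n, ℂ), HasFourierFunction f (wave freq g₀ g₁ c t) := by
    obtain ⟨L, hL⟩ := hc t ht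
    exact (hd.isTemperedFunction_wave hg₀ hL ⟨ht.1, le_rfl⟩).exists_hasFourierFunction
  have hv (t : ℝ) (ht : t ∈ timeInterval T) :
      ∃ f : 𝓢'(Rn n, ℂ), HasFourierFunction f (waveVelocity freq g₀ g₁ c t) := by
    obtain ⟨L, hL⟩ := hc t ht
    exact (hd.isTemperedFunction_waveVelocity hL ⟨ht.1, le_rfl⟩).exists_hasFourierFunction
  choose! u hu using hu
  choose! v hv using hv
  exact ⟨u, v, hu, hv⟩

namespace IsFlow

theorem apply_zero (h : IsFlow g₀ g₁ c T u v) (hT : 0 ∈ timeInterval T)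
    (h₀ : HasFourierFunction u₀ g₀) : u 0 = u₀ :=
  ((h.hasFourierFunction 0 hT).congr (.of_forall (wave_zero _ _ _ _))).ext h₀

theorem velocity_apply_zero (h : IsFlow g₀ g₁ c T u v) (hT : 0 ∈ timeInterval T)
    (h₁ : HasFourierFunction u₁ g₁) : v 0 = u₁ :=
  ((h.hasFourierFunction_velocity 0 hT).congr (.of_forall (waveVelocity_zero _ _ _ _))).ext h₁

theorem isC0Curve (h : IsFlow g₀ g₁ c T u v) (hd : IsWaveData volume freq g₀ g₁)
    (hc : ∀ b ∈ timeInterval T, ∃ L, IsWaveSpeed ν L c (Icc 0 b))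
    (hw : IsEnergyWeight volume freq g₀ g₁ w) :
    IsC0Curve (fourierNormSq fun ξ => w ξ * freq ξ ^ 2) T u where
  mem t ht := by
    obtain ⟨L, hL⟩ := hc t ht
    rw [(h.hasFourierFunction t ht).fourierNormSq_eq]
    exact hw.lintegral_wave_lt_top hL ⟨ht.1, le_rfl⟩
  continuous t ht := by
    obtain ⟨b, hb, htb⟩ := exists_mem_timeInterval_gt ht
    obtain ⟨L, hL⟩ := hc b hb
    refine ((hw.tendsto_lintegral_wave hd hL ⟨ht.1, htb.le⟩).mono_left
      (nhdsWithin_timeInterval_le htb)).congr' ?_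
    filter_upwards [self_mem_nhdsWithin] with r hr
    rw [((h.hasFourierFunction r hr).sub (h.hasFourierFunction t ht)).fourierNormSq_eq]

theorem isC0Curve_velocity (h : IsFlow g₀ g₁ c T u v) (hd : IsWaveData volume freq g₀ g₁)
    (hc : ∀ b ∈ timeInterval T, ∃ L, IsWaveSpeed ν L c (Icc 0 b))
    (hw : IsEnergyWeight volume freq g₀ g₁ w) : IsC0Curve (fourierNormSq w) T v where
  mem t ht := by
    obtain ⟨L, hL⟩ := hc t ht
    rw [(h.hasFourierFunction_velocity t ht).fourierNormSq_eq]
    exact hw.lintegral_waveVelocity_lt_top hL ⟨ht.1, le_rfl⟩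
  continuous t ht := by
    obtain ⟨b, hb, htb⟩ := exists_mem_timeInterval_gt ht
    obtain ⟨L, hL⟩ := hc b hb
    refine ((hw.tendsto_lintegral_waveVelocity hd hL ⟨ht.1, htb.le⟩).mono_left
      (nhdsWithin_timeInterval_le htb)).congr' ?_
    filter_upwards [self_mem_nhdsWithin] with r hr
    rw [((h.hasFourierFunction_velocity r hr).sub
      (h.hasFourierFunction_velocity t ht)).fourierNormSq_eq]

theorem isC1Curve (h : IsFlow g₀ g₁ c T u v) (hd : IsWaveData volume freq g₀ g₁)
    (hc : ∀ b ∈ timeInterval T, ∃ L, IsWaveSpeed ν L c (Icc 0 b))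
    (hw : IsEnergyWeight volume freq g₀ g₁ w) :
    IsC1Curve (fourierNormSq w) T (fun t => u t - u 0) v where
  mem t ht := by
    obtain ⟨L, hL⟩ := hc t ht
    rw [((h.hasFourierFunction t ht).sub
      (h.hasFourierFunction 0 (zero_mem_timeInterval ht))).fourierNormSq_eq]
    exact hw.lintegral_wave_sub_lt_top hL ⟨ht.1, le_rfl⟩ ⟨le_rfl, ht.1⟩
  hasDeriv t ht := by
    obtain ⟨b, hb, htb⟩ := exists_mem_timeInterval_gt ht
    obtain ⟨L, hL⟩ := hc b hb
    refine ((hw.tendsto_lintegral_wave_slope hd hL ⟨ht.1, htb.le⟩).mono_left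
      (nhdsWithin_timeInterval_diff_le htb)).congr' ?_
    filter_upwards [self_mem_nhdsWithin] with r hr
    rw [sub_sub_sub_cancel_right, ((((h.hasFourierFunction r hr.1).sub
      (h.hasFourierFunction t ht)).const_smul _).sub
      (h.hasFourierFunction_velocity t ht)).fourierNormSq_eq]
  deriv_isC0 := h.isC0Curve_velocity hd hc hw

theorem gradNormSq_eq (h : IsFlow g₀ g₁ c T u v) (hd : IsWaveData volume freq g₀ g₁)
    (hc : ∀ b ∈ timeInterval T, ∃ L, IsWaveSpeed ν L c (Icc 0 b)) (ht : t ∈ timeInterval T) :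
    gradNormSq (u t) = ENNReal.ofReal (waveGradSq volume freq g₀ g₁ c t) := by
  obtain ⟨L, hL⟩ := hc t ht
  rw [(h.hasFourierFunction t ht).gradNormSq_eq, waveGradSq, ofReal_integral_eq_lintegral_ofReal
    (integrable_sq_mul_wave_sq hd hL ⟨ht.1, le_rfl⟩) (.of_forall fun ξ => by positivity)]
  simp only [ofReal_mul_enorm_sq (sq_nonneg _)]

theorem hasDerivAt_apply (h : IsFlow g₀ g₁ c T u v) (hd : IsWaveData volume freq g₀ g₁)
    (hg₀ : LocallyIntegrable g₀ volume)
    (hc : ∀ b ∈ timeInterval T, ∃ L, IsWaveSpeed ν L c (Icc 0 b)) (ht : t ∈ timeInterval T)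
    (ht0 : 0 < t) (ψ : 𝓢(Rn n, ℂ)) :
    HasDerivAt (fun r => v r ψ) ((c t : ℂ) * (Δ (u t)) ψ) t := by
  obtain ⟨b, hb, htb⟩ := exists_mem_timeInterval_gt ht
  obtain ⟨L, hL⟩ := hc b hb
  have hv : (fun r => v r ψ) =ᶠ[𝓝 t]
      fun r => ∫ ξ, (𝓕⁻ ψ) ξ * waveVelocity freq g₀ g₁ c r ξ := by
    filter_upwards [Ioo_mem_nhds ht0 htb] with r hr
    have hr' := Ioo_subset_Icc_self hr
    exact (h.hasFourierFunction_velocity r (Icc_subset_timeInterval hb hr')).apply_eq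
      (hd.isTemperedFunction_waveVelocity hL hr') ψ
  refine ((hd.hasDerivAt_integral_mul_waveVelocity hL (𝓕⁻ ψ)
    ⟨ht0, htb⟩).congr_of_eventuallyEq hv).congr_deriv ?_
  rw [(h.hasFourierFunction t ht).laplacian_apply
    (hd.isTemperedFunction_wave hg₀ hL ⟨ht.1, htb.le⟩), ← integral_const_mul]
  refine integral_congr_ae (.of_forall fun ξ => ?_)
  push_cast
  ring

end IsFlow

end IsFlow

/-! ### Curves of distributions as curves in `L²` -/

section WeightedFourier

variable {w : Rn n → ℝ} {f f' : 𝓢'(Rn n, ℂ)} {g : Rn n → ℂ}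

theorem enorm_sqrt_mul_sq (a : ℝ) (z : ℂ) : ‖(√a : ℂ) * z‖ₑ ^ 2 = ENNReal.ofReal a * ‖z‖ₑ ^ 2 := by
  rw [enorm_mul, mul_pow, ← ofReal_norm (√a : ℂ), Complex.norm_real,
    Real.norm_of_nonneg (Real.sqrt_nonneg _), ← ENNReal.ofReal_pow (Real.sqrt_nonneg _),
    Real.sq_sqrt', ENNReal.ofReal_max, ENNReal.ofReal_zero, max_eq_left zero_le]

theorem HasFourierFunction.fourierNormSq_lt_top_iff (hw : Measurable w)
    (hg : HasFourierFunction f g) :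
    fourierNormSq w f < ∞ ↔ MemLp (fun ξ => (√(w ξ) : ℂ) * g ξ) 2 volume := by
  have hm : AEStronglyMeasurable (fun ξ => (√(w ξ) : ℂ) * g ξ) volume :=
    (Complex.measurable_ofReal.comp hw.sqrt).aestronglyMeasurable.mul hg.1.aestronglyMeasurable
  simp only [hg.fourierNormSq_eq, ← enorm_sqrt_mul_sq]
  refine ⟨memLp_two_of_lintegral_sq_lt_top hm, fun h => ?_⟩
  rw [← enorm_toLp_sq h]
  exact ENNReal.pow_lt_top enorm_lt_top

theorem exists_memLp_sqrt_mul (hw : Measurable w) (h : fourierNormSq w f < ∞) :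
    ∃ g, HasFourierFunction f g ∧ MemLp (fun ξ => (√(w ξ) : ℂ) * g ξ) 2 volume := by
  obtain ⟨g, hg⟩ := exists_hasFourierFunction_of_fourierNormSq_lt_top h
  exact ⟨g, hg, (hg.fourierNormSq_lt_top_iff hw).1 h⟩

theorem fourierNormSq_sub_lt_top (hw : Measurable w) (h : fourierNormSq w f < ∞)
    (h' : fourierNormSq w f' < ∞) : fourierNormSq w (f - f') < ∞ := by
  obtain ⟨g, hg, hm⟩ := exists_memLp_sqrt_mul hw h
  obtain ⟨g', hg', hm'⟩ := exists_memLp_sqrt_mul hw h'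
  refine ((hg.sub hg').fourierNormSq_lt_top_iff hw).2 ?_
  simpa only [mul_sub, Pi.sub_def] using hm.sub hm'

theorem fourierNormSq_smul_lt_top (hw : Measurable w) (a : ℂ) (h : fourierNormSq w f < ∞) :
    fourierNormSq w (a • f) < ∞ := by
  obtain ⟨g, hg, hm⟩ := exists_memLp_sqrt_mul hw h
  refine ((hg.const_smul a).fourierNormSq_lt_top_iff hw).2 ?_
  simpa only [mul_left_comm] using hm.const_mul a

open Classical in
/-- The function `√w · 𝓕 f` as an element of `L²`; it is `0` if `fourierNormSq w f = ∞`. This makes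
the space with square norm `fourierNormSq w` a subspace of `L²`. -/
def weightedFourier (w : Rn n → ℝ) (f : 𝓢'(Rn n, ℂ)) : Lp ℂ 2 (volume : Measure (Rn n)) :=
  if h : ∃ g, HasFourierFunction f g ∧ MemLp (fun ξ => (√(w ξ) : ℂ) * g ξ) 2 volume then
    h.choose_spec.2.toLp _ else 0

theorem weightedFourier_eq (hg : HasFourierFunction f g)
    (hm : MemLp (fun ξ => (√(w ξ) : ℂ) * g ξ) 2 volume) : weightedFourier w f = hm.toLp _ := by
  have h : ∃ g, HasFourierFunction f g ∧ MemLp (fun ξ => (√(w ξ) : ℂ) * g ξ) 2 volume :=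
    ⟨g, hg, hm⟩
  rw [weightedFourier, dif_pos h, MemLp.toLp_eq_toLp_iff]
  filter_upwards [h.choose_spec.1.ae_eq hg] with ξ hξ
  rw [hξ]

theorem coeFn_weightedFourier (hw : Measurable w) (hg : HasFourierFunction f g)
    (h : fourierNormSq w f < ∞) :
    weightedFourier w f =ᵐ[volume] fun ξ => (√(w ξ) : ℂ) * g ξ := by
  have hm := (hg.fourierNormSq_lt_top_iff hw).1 h
  rw [weightedFourier_eq hg hm]
  exact hm.coeFn_toLp

theorem enorm_weightedFourier_sq (hw : Measurable w) (h : fourierNormSq w f < ∞) :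
    ‖weightedFourier w f‖ₑ ^ 2 = fourierNormSq w f := by
  obtain ⟨g, hg, hm⟩ := exists_memLp_sqrt_mul hw h
  simp only [weightedFourier_eq hg hm, enorm_toLp_sq, enorm_sqrt_mul_sq, hg.fourierNormSq_eq]

theorem weightedFourier_sub (hw : Measurable w) (h : fourierNormSq w f < ∞)
    (h' : fourierNormSq w f' < ∞) :
    weightedFourier w (f - f') = weightedFourier w f - weightedFourier w f' := by
  obtain ⟨g, hg, hm⟩ := exists_memLp_sqrt_mul hw h
  obtain ⟨g', hg', hm'⟩ := exists_memLp_sqrt_mul hw h'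
  have hs := ((hg.sub hg').fourierNormSq_lt_top_iff hw).1 (fourierNormSq_sub_lt_top hw h h')
  rw [weightedFourier_eq hg hm, weightedFourier_eq hg' hm', weightedFourier_eq (hg.sub hg') hs,
    ← MemLp.toLp_sub, MemLp.toLp_eq_toLp_iff]
  exact .of_forall fun ξ => mul_sub _ _ _

theorem weightedFourier_smul (hw : Measurable w) (a : ℂ) (h : fourierNormSq w f < ∞) :
    weightedFourier w (a • f) = a • weightedFourier w f := by
  obtain ⟨g, hg, hm⟩ := exists_memLp_sqrt_mul hw h
  have hs := ((hg.const_smul a).fourierNormSq_lt_top_iff hw).1 (fourierNormSq_smul_lt_top hw a h)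
  rw [weightedFourier_eq hg hm, weightedFourier_eq (hg.const_smul a) hs,
    ← MemLp.toLp_const_smul, MemLp.toLp_eq_toLp_iff]
  exact .of_forall fun ξ => mul_left_comm _ _ _

theorem tendsto_fourierNormSq_iff (hw : Measurable w) {ι : Type*} {l : Filter ι}
    {F : ι → 𝓢'(Rn n, ℂ)} (hF : ∀ᶠ i in l, fourierNormSq w (F i) < ∞) :
    Tendsto (fun i => fourierNormSq w (F i)) l (𝓝 0) ↔
      Tendsto (fun i => weightedFourier w (F i)) l (𝓝 0) := by
  rw [tendsto_zero_iff_enorm_tendsto_zero]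
  have hF' : (fun i => fourierNormSq w (F i)) =ᶠ[l] fun i => ‖weightedFourier w (F i)‖ₑ ^ 2 :=
    hF.mono fun i hi => (enorm_weightedFourier_sq hw hi).symm
  refine (tendsto_congr' hF').trans ⟨fun h => ?_, fun h => ?_⟩
  · have h' := (ENNReal.continuous_rpow_const (y := (1 / 2 : ℝ))).tendsto 0 |>.comp h
    rw [ENNReal.zero_rpow_of_pos (by norm_num)] at h'
    refine h'.congr fun i => ?_
    rw [Function.comp_apply, ← ENNReal.rpow_natCast, ← ENNReal.rpow_mul]
    norm_num
  · simpa using ENNReal.Tendsto.pow (n := 2) h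

end WeightedFourier

section Curves

variable {w : Rn n → ℝ} {T : EReal} {t : ℝ} {u v u' v' : ℝ → 𝓢'(Rn n, ℂ)}

theorem isC0Curve_iff (hw : Measurable w) :
    IsC0Curve (fourierNormSq w) T u ↔ (∀ t ∈ timeInterval T, fourierNormSq w (u t) < ∞) ∧
      ContinuousOn (fun t => weightedFourier w (u t)) (timeInterval T) := by
  have key (hu : ∀ t ∈ timeInterval T, fourierNormSq w (u t) < ∞) (t : ℝ)
      (ht : t ∈ timeInterval T) :
      Tendsto (fun r => fourierNormSq w (u r - u t)) (𝓝[timeInterval T] t) (𝓝 0) ↔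
        ContinuousWithinAt (fun t => weightedFourier w (u t)) (timeInterval T) t := by
    rw [ContinuousWithinAt]
    refine (tendsto_fourierNormSq_iff hw ?_).trans
      ((tendsto_congr' ?_).trans tendsto_sub_nhds_zero_iff)
    · filter_upwards [self_mem_nhdsWithin] with r hr
      exact fourierNormSq_sub_lt_top hw (hu r hr) (hu t ht)
    · filter_upwards [self_mem_nhdsWithin] with r hr
      exact weightedFourier_sub hw (hu r hr) (hu t ht)
  exact ⟨fun h => ⟨h.mem, fun t ht => (key h.mem t ht).1 (h.continuous t ht)⟩,
    fun h => ⟨h.1, fun t ht => (key h.1 t ht).2 (h.2 t ht)⟩⟩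

theorem isC1Curve_iff (hw : Measurable w) :
    IsC1Curve (fourierNormSq w) T u v ↔ (∀ t ∈ timeInterval T, fourierNormSq w (u t) < ∞) ∧
      IsC0Curve (fourierNormSq w) T v ∧ ∀ t ∈ timeInterval T, HasDerivWithinAt
        (fun t => weightedFourier w (u t)) (weightedFourier w (v t)) (timeInterval T) t := by
  have key (hu : ∀ t ∈ timeInterval T, fourierNormSq w (u t) < ∞)
      (hv : IsC0Curve (fourierNormSq w) T v) (t : ℝ) (ht : t ∈ timeInterval T) :
      Tendsto (fun r => fourierNormSq w (((r - t : ℝ) : ℂ)⁻¹ • (u r - u t) - v t))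
        (𝓝[timeInterval T \ {t}] t) (𝓝 0) ↔ HasDerivWithinAt
        (fun t => weightedFourier w (u t)) (weightedFourier w (v t)) (timeInterval T) t := by
    have hsub (r : ℝ) (hr : r ∈ timeInterval T) : fourierNormSq w (u r - u t) < ∞ :=
      fourierNormSq_sub_lt_top hw (hu r hr) (hu t ht)
    rw [hasDerivWithinAt_iff_tendsto_slope]
    refine (tendsto_fourierNormSq_iff hw ?_).trans
      ((tendsto_congr' ?_).trans tendsto_sub_nhds_zero_iff)
    · filter_upwards [self_mem_nhdsWithin] with r hr
      exact fourierNormSq_sub_lt_top hw (fourierNormSq_smul_lt_top hw _ (hsub r hr.1)) (hv.mem t ht)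
    · filter_upwards [self_mem_nhdsWithin] with r hr
      rw [weightedFourier_sub hw (fourierNormSq_smul_lt_top hw _ (hsub r hr.1)) (hv.mem t ht),
        weightedFourier_smul hw _ (hsub r hr.1), weightedFourier_sub hw (hu r hr.1) (hu t ht),
        slope_def_module, ← Complex.ofReal_inv, Complex.coe_smul]
      rfl
  exact ⟨fun h => ⟨h.mem, h.deriv_isC0,
      fun t ht => (key h.mem h.deriv_isC0 t ht).1 (h.hasDeriv t ht)⟩,
    fun h => ⟨h.1, fun t ht => (key h.1 h.2.1 t ht).2 (h.2.2 t ht), h.2.1⟩⟩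

theorem IsC1Curve.isC0Curve (hw : Measurable w) (h : IsC1Curve (fourierNormSq w) T u v) :
    IsC0Curve (fourierNormSq w) T u :=
  (isC0Curve_iff hw).2
    ⟨h.mem, fun t ht => (((isC1Curve_iff hw).1 h).2.2 t ht).continuousWithinAt⟩

theorem IsC0Curve.sub (hw : Measurable w) (h : IsC0Curve (fourierNormSq w) T u)
    (h' : IsC0Curve (fourierNormSq w) T u') :
    IsC0Curve (fourierNormSq w) T (fun t => u t - u' t) :=
  (isC0Curve_iff hw).2 ⟨fun t ht => fourierNormSq_sub_lt_top hw (h.mem t ht) (h'.mem t ht),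
    (((isC0Curve_iff hw).1 h).2.sub ((isC0Curve_iff hw).1 h').2).congr fun t ht =>
      weightedFourier_sub hw (h.mem t ht) (h'.mem t ht)⟩

theorem IsC1Curve.sub (hw : Measurable w) (h : IsC1Curve (fourierNormSq w) T u v)
    (h' : IsC1Curve (fourierNormSq w) T u' v') :
    IsC1Curve (fourierNormSq w) T (fun t => u t - u' t) (fun t => v t - v' t) := by
  refine (isC1Curve_iff hw).2 ⟨fun t ht => fourierNormSq_sub_lt_top hw (h.mem t ht) (h'.mem t ht),
    h.deriv_isC0.sub hw h'.deriv_isC0, fun t ht => ?_⟩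
  rw [weightedFourier_sub hw (h.deriv_isC0.mem t ht) (h'.deriv_isC0.mem t ht)]
  exact ((((isC1Curve_iff hw).1 h).2.2 t ht).sub (((isC1Curve_iff hw).1 h').2.2 t ht)).congr_of_mem
    (fun r hr => weightedFourier_sub hw (h.mem r hr) (h'.mem r hr)) ht

theorem fourierNormSq_mono {w w' : Rn n → ℝ} (h : ∀ ξ, w' ξ ≤ w ξ) (f : 𝓢'(Rn n, ℂ)) :
    fourierNormSq w' f ≤ fourierNormSq w f :=
  iInf₂_mono fun g _ => lintegral_mono fun ξ => by gcongr; exact h ξ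

variable {N N' : 𝓢'(Rn n, ℂ) → ℝ≥0∞}

theorem IsC0Curve.mono (hN : ∀ f, N' f ≤ N f) (h : IsC0Curve N T u) : IsC0Curve N' T u where
  mem t ht := (hN _).trans_lt (h.mem t ht)
  continuous t ht := tendsto_of_tendsto_of_tendsto_of_le_of_le tendsto_const_nhds
    (h.continuous t ht) (fun _ => zero_le) (fun _ => hN _)

theorem IsC1Curve.mono (hN : ∀ f, N' f ≤ N f) (h : IsC1Curve N T u v) : IsC1Curve N' T u v where
  mem t ht := (hN _).trans_lt (h.mem t ht)
  hasDeriv t ht := tendsto_of_tendsto_of_tendsto_of_le_of_le tendsto_const_nhds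
    (h.hasDeriv t ht) (fun _ => zero_le) (fun _ => hN _)
  deriv_isC0 := h.deriv_isC0.mono hN

end Curves

/-! ### Uniqueness for the linear wave equation -/

section Hierarchy

variable {E : Type*} [NormedAddCommGroup E] [NormedSpace ℝ E] [CompleteSpace E] {b : ℝ}

theorem norm_le_of_norm_deriv_le_pow_div_factorial {h h' : ℝ → E} {K : ℝ} {j : ℕ}
    (hh : ContinuousOn h (Icc 0 b)) (hh' : ContinuousOn h' (Icc 0 b))
    (hd : ∀ t ∈ Ioo 0 b, HasDerivAt h (h' t) t) (h0 : h 0 = 0)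
    (hK : ∀ t ∈ Icc 0 b, ‖h' t‖ ≤ K * (t ^ j / j.factorial)) {t : ℝ} (ht : t ∈ Icc 0 b) :
    ‖h t‖ ≤ K * (t ^ (j + 1) / (j + 1).factorial) := by
  have hsub : Icc 0 t ⊆ Icc 0 b := Icc_subset_Icc_right ht.2
  have hint : ∫ x in (0 : ℝ)..t, h' x = h t := by
    rw [intervalIntegral.integral_eq_sub_of_hasDerivAt_of_le ht.1 (hh.mono hsub)
      (fun x hx => hd x ⟨hx.1, hx.2.trans_le ht.2⟩)
      ((hh'.mono hsub).intervalIntegrable_of_Icc ht.1), h0, sub_zero]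
  rw [← hint]
  refine (intervalIntegral.norm_integral_le_of_norm_le ht.1
    (.of_forall fun x hx => hK x (hsub (Ioc_subset_Icc_self hx)))
    (Continuous.intervalIntegrable (by fun_prop) _ _)).trans_eq ?_
  rw [intervalIntegral.integral_const_mul, intervalIntegral.integral_div, integral_pow,
    Nat.factorial_succ]
  push_cast
  field_simp
  ring

/-- The functions `f k`, with derivatives `g k` and zero initial data, satisfy
`f k'' = c f (k + 1)` on `[0, b]`. For a solution `u` of the wave equation with zero data and a
test function `ψ` this holds with `f k = ⟨u, Δ ^ k ψ⟩`. -/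
structure IsWaveHierarchy (c : ℝ → ℝ) (f g : ℕ → ℝ → E) (b : ℝ) : Prop where
  continuousOn_speed : ContinuousOn c (Icc 0 b)
  continuousOn k : ContinuousOn (f k) (Icc 0 b)
  continuousOn_velocity k : ContinuousOn (g k) (Icc 0 b)
  apply_zero k : f k 0 = 0
  velocity_apply_zero k : g k 0 = 0
  hasDerivAt k : ∀ t ∈ Ioo 0 b, HasDerivAt (f k) (g k t) t
  hasDerivAt_velocity k : ∀ t ∈ Ioo 0 b, HasDerivAt (g k) (c t • f (k + 1) t) t

namespace IsWaveHierarchy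

variable {c : ℝ → ℝ} {f g : ℕ → ℝ → E} {A B M : ℝ}

theorem norm_le (h : IsWaveHierarchy c f g b) (hM : ∀ t ∈ Icc 0 b, ‖c t‖ ≤ M)
    (hAB : ∀ k, ∀ t ∈ Icc 0 b, ‖f k t‖ ≤ A * B ^ k) (j k : ℕ) {t : ℝ} (ht : t ∈ Icc 0 b) :
    ‖f k t‖ ≤ A * B ^ k * (M * B) ^ j * (t ^ (2 * j) / (2 * j).factorial) := by
  induction j generalizing k t with
  | zero => simpa using hAB k t ht
  | succ j ih =>
    refine norm_le_of_norm_deriv_le_pow_div_factorial (h.continuousOn k) (h.continuousOn_velocity k)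
      (h.hasDerivAt k) (h.apply_zero k) (fun s hs => ?_) ht
    refine norm_le_of_norm_deriv_le_pow_div_factorial (h.continuousOn_velocity k)
      (h.continuousOn_speed.smul (h.continuousOn (k + 1))) (h.hasDerivAt_velocity k)
      (h.velocity_apply_zero k) (fun r hr => ?_) hs
    calc ‖c r • f (k + 1) r‖ = ‖c r‖ * ‖f (k + 1) r‖ := norm_smul _ _
      _ ≤ M * (A * B ^ (k + 1) * (M * B) ^ j * (r ^ (2 * j) / (2 * j).factorial)) :=
        mul_le_mul (hM r hr) (ih (k + 1) hr) (norm_nonneg _) ((norm_nonneg _).trans (hM r hr))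
      _ = A * B ^ k * (M * B) ^ (j + 1) * (r ^ (2 * j) / (2 * j).factorial) := by ring

theorem eq_zero (h : IsWaveHierarchy c f g b)
    (hAB : ∀ k, ∀ t ∈ Icc 0 b, ‖f k t‖ ≤ A * B ^ k) (k : ℕ) {t : ℝ} (ht : t ∈ Icc 0 b) :
    f k t = 0 := by
  obtain ⟨M, hM⟩ := isCompact_Icc.exists_bound_of_continuousOn h.continuousOn_speed
  have hlim : Tendsto (fun j : ℕ => A * B ^ k * ((√|M * B| * t) ^ (2 * j) / (2 * j).factorial))
      atTop (𝓝 0) := by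
    simpa using ((FloorSemiring.tendsto_pow_div_factorial_atTop (√|M * B| * t)).comp
      (tendsto_id.const_mul_atTop' two_pos)).const_mul (A * B ^ k)
  have hA : 0 ≤ A * B ^ k := (norm_nonneg _).trans (hAB k t ht)
  have ht0 := ht.1
  refine norm_le_zero_iff.1 (ge_of_tendsto' hlim fun j => ?_)
  calc ‖f k t‖ ≤ A * B ^ k * (M * B) ^ j * (t ^ (2 * j) / (2 * j).factorial) :=
        h.norm_le hM hAB j k ht
    _ ≤ A * B ^ k * |M * B| ^ j * (t ^ (2 * j) / (2 * j).factorial) :=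
        mul_le_mul_of_nonneg_right (mul_le_mul_of_nonneg_left
          ((le_abs_self _).trans_eq (abs_pow _ _)) hA) (by positivity)
    _ = A * B ^ k * ((√|M * B| * t) ^ (2 * j) / (2 * j).factorial) := by
        rw [mul_pow, pow_mul √_, Real.sq_sqrt (abs_nonneg _)]
        ring

end IsWaveHierarchy

end Hierarchy

/-- The function whose `L²` inner product with `weightedFourier freq f` is `(Δ f) ψ`. -/
def laplacianDual (ψ : 𝓢(Rn n, ℂ)) (ξ : Rn n) : ℂ :=
  -((√(freq ξ) : ℂ) ^ 3 * (starRingEnd ℂ) ((𝓕⁻ ψ) ξ))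

theorem norm_laplacianDual_sq (ψ : 𝓢(Rn n, ℂ)) (ξ : Rn n) :
    ‖laplacianDual ψ ξ‖ ^ 2 = freq ξ ^ 3 * ‖(𝓕⁻ ψ) ξ‖ ^ 2 := by
  rw [laplacianDual, norm_neg, norm_mul, norm_pow, Complex.norm_real, RCLike.norm_conj,
    Real.norm_of_nonneg (Real.sqrt_nonneg _), mul_pow, ← pow_mul, mul_comm 3, pow_mul,
    Real.sq_sqrt (freq_nonneg ξ)]

theorem memLp_laplacianDual (ψ : 𝓢(Rn n, ℂ)) : MemLp (laplacianDual ψ) 2 volume := by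
  have hm : AEStronglyMeasurable (laplacianDual ψ) volume :=
    (((Complex.measurable_ofReal.comp measurable_freq.sqrt).pow_const 3).aestronglyMeasurable.mul
      (Complex.continuous_conj.comp (𝓕⁻ ψ).continuous).aestronglyMeasurable).neg
  rw [memLp_two_iff_integrable_sq_norm hm]
  simpa only [norm_laplacianDual_sq] using integrable_freq_pow_mul_norm_sq (𝓕⁻ ψ) 3

theorem laplacian_apply_eq_inner {f : 𝓢'(Rn n, ℂ)} (hf : fourierNormSq freq f < ∞)
    (ψ : 𝓢(Rn n, ℂ)) :
    (Δ f) ψ = inner ℂ ((memLp_laplacianDual ψ).toLp _) (weightedFourier freq f) := by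
  obtain ⟨g, hg⟩ := exists_hasFourierFunction_of_fourierNormSq_lt_top hf
  have ht : IsTemperedFunction g :=
    .of_lintegral_lt_top hg.1 (fun _ => one_le_freq) (by rwa [← hg.fourierNormSq_eq])
  rw [hg.laplacian_apply ht, L2.inner_def]
  refine integral_congr_ae ?_
  filter_upwards [(memLp_laplacianDual ψ).coeFn_toLp, coeFn_weightedFourier measurable_freq hg hf]
    with ξ h₁ h₂
  have hsq : (√(freq ξ) : ℂ) ^ 2 = freq ξ := by
    rw [← Complex.ofReal_pow, Real.sq_sqrt (freq_nonneg ξ)]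
  rw [h₁, h₂, RCLike.inner_apply, laplacianDual, map_neg, map_mul, map_pow, Complex.conj_ofReal,
    Complex.conj_conj, Complex.ofReal_pow, ← hsq]
  ring

/-- The Laplacian of Schwartz functions, as a function that can be iterated. -/
def schwartzLaplacian (ψ : 𝓢(Rn n, ℂ)) : 𝓢(Rn n, ℂ) := Δ ψ

theorem fourierInv_schwartzLaplacian_iterate_apply (ψ : 𝓢(Rn n, ℂ)) (k : ℕ) (ξ : Rn n) :
    (𝓕⁻ (schwartzLaplacian^[k] ψ)) ξ = (-((freq ξ ^ 2 : ℝ) : ℂ)) ^ k * (𝓕⁻ ψ) ξ := by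
  induction k with
  | zero => simp
  | succ k ih =>
    rw [Function.iterate_succ_apply', schwartzLaplacian, fourierInv_laplacian_apply, ih, pow_succ']
    ring

theorem norm_toLp_laplacianDual_le {ψ : 𝓢(Rn n, ℂ)} {B : ℝ}
    (hB : ∀ ξ, (𝓕⁻ ψ) ξ ≠ 0 → freq ξ ^ 2 ≤ B) (k : ℕ) :
    ‖(memLp_laplacianDual (schwartzLaplacian^[k] ψ)).toLp _‖ ≤
      B ^ k * ‖(memLp_laplacianDual ψ).toLp _‖ := by
  refine Lp.norm_le_mul_norm_of_ae_le_mul ?_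
  filter_upwards [(memLp_laplacianDual (schwartzLaplacian^[k] ψ)).coeFn_toLp,
    (memLp_laplacianDual ψ).coeFn_toLp] with ξ h₁ h₂
  rw [h₁, h₂, laplacianDual, laplacianDual, fourierInv_schwartzLaplacian_iterate_apply]
  simp only [norm_neg, norm_mul, norm_pow, RCLike.norm_conj, Complex.norm_real]
  by_cases h : (𝓕⁻ ψ) ξ = 0
  · simp [h]
  · have := hB ξ h
    rw [Real.norm_of_nonneg (freq_nonneg ξ)]
    calc _ = (freq ξ ^ 2) ^ k * (‖√(freq ξ)‖ ^ 3 * ‖(𝓕⁻ ψ) ξ‖) := by ring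
      _ ≤ _ := by gcongr

section Curves

variable {T : EReal} {t b B : ℝ} {c : ℝ → ℝ} {u v : ℝ → 𝓢'(Rn n, ℂ)}

theorem timeInterval_mem_nhds (ht : t ∈ timeInterval T) (ht0 : 0 < t) : timeInterval T ∈ 𝓝 t := by
  obtain ⟨b, hb, htb⟩ := exists_mem_timeInterval_gt ht
  exact mem_of_superset (Icc_mem_nhds ht0 htb) (Icc_subset_timeInterval hb)

theorem IsC0Curve.continuousOn_laplacian_apply (h : IsC0Curve (fourierNormSq freq) T u)
    (ψ : 𝓢(Rn n, ℂ)) : ContinuousOn (fun t => (Δ (u t)) ψ) (timeInterval T) :=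
  (continuousOn_const.inner (𝕜 := ℂ) ((isC0Curve_iff measurable_freq).1 h).2).congr fun t ht =>
    laplacian_apply_eq_inner (h.mem t ht) ψ

theorem IsC1Curve.hasDerivAt_laplacian_apply (h : IsC1Curve (fourierNormSq freq) T u v)
    (ht : t ∈ timeInterval T) (ht0 : 0 < t) (ψ : 𝓢(Rn n, ℂ)) :
    HasDerivAt (fun t => (Δ (u t)) ψ) ((Δ (v t)) ψ) t := by
  have hT := timeInterval_mem_nhds ht ht0
  have hd := (hasDerivAt_const t ((memLp_laplacianDual ψ).toLp _)).inner ℂ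
    ((((isC1Curve_iff measurable_freq).1 h).2.2 t ht).hasDerivAt hT)
  rw [inner_zero_left, add_zero, ← laplacian_apply_eq_inner (h.deriv_isC0.mem t ht)] at hd
  exact hd.congr_of_eventuallyEq (mem_of_superset hT fun r hr =>
    laplacian_apply_eq_inner (h.mem r hr) ψ)

theorem IsC0Curve.exists_norm_laplacian_iterate_apply_le (h : IsC0Curve (fourierNormSq freq) T u)
    (hb : b ∈ timeInterval T) {ψ : 𝓢(Rn n, ℂ)} (hB0 : 0 ≤ B)
    (hB : ∀ ξ, (𝓕⁻ ψ) ξ ≠ 0 → freq ξ ^ 2 ≤ B) :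
    ∃ A : ℝ, ∀ k, ∀ t ∈ Icc 0 b, ‖(Δ (u t)) (schwartzLaplacian^[k] ψ)‖ ≤ A * B ^ k := by
  have hsub := Icc_subset_timeInterval hb
  obtain ⟨A, hA⟩ := isCompact_Icc.exists_bound_of_continuousOn
    (((isC0Curve_iff measurable_freq).1 h).2.mono hsub)
  refine ⟨‖(memLp_laplacianDual ψ).toLp _‖ * A, fun k t ht => ?_⟩
  rw [laplacian_apply_eq_inner (h.mem t (hsub ht))]
  calc _ ≤ _ := norm_inner_le_norm _ _
    _ ≤ (B ^ k * ‖(memLp_laplacianDual ψ).toLp _‖) * A :=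
      mul_le_mul (norm_toLp_laplacianDual_le hB k) (hA t ht) (norm_nonneg _) (by positivity)
    _ = _ := by ring

theorem IsC1Curve.laplacian_apply_eq_zero (h : IsC1Curve (fourierNormSq freq) T u v)
    (hc : ContinuousOn c (timeInterval T)) (hu : u 0 = 0) (hv : v 0 = 0)
    (heq : ∀ t ∈ timeInterval T, 0 < t → ∀ ψ : 𝓢(Rn n, ℂ),
      HasDerivAt (fun r => v r ψ) ((c t : ℂ) * (Δ (u t)) ψ) t) (ht : t ∈ timeInterval T)
    {ψ : 𝓢(Rn n, ℂ)} (hψ : HasCompactSupport (𝓕⁻ ψ : 𝓢(Rn n, ℂ))) : (Δ (u t)) ψ = 0 := by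
  obtain ⟨R, hR⟩ := hψ.isCompact.isBounded.exists_norm_le
  have hB : ∀ ξ, (𝓕⁻ ψ) ξ ≠ 0 → freq ξ ^ 2 ≤ (2 * Real.pi * R) ^ 2 := fun ξ hξ => by
    have := hR ξ (subset_tsupport _ hξ)
    unfold freq
    gcongr
  have hsub := Icc_subset_timeInterval ht
  have hu' := h.isC0Curve measurable_freq
  obtain ⟨A, hA⟩ := hu'.exists_norm_laplacian_iterate_apply_le ht (sq_nonneg _) hB
  have hier : IsWaveHierarchy c (fun k t => (Δ (u t)) (schwartzLaplacian^[k] ψ))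
      (fun k t => (Δ (v t)) (schwartzLaplacian^[k] ψ)) t :=
    { continuousOn_speed := hc.mono hsub
      continuousOn k := (hu'.continuousOn_laplacian_apply _).mono hsub
      continuousOn_velocity k := (h.deriv_isC0.continuousOn_laplacian_apply _).mono hsub
      apply_zero k := by simp [hu, TemperedDistribution.laplacian_apply_apply]
      velocity_apply_zero k := by simp [hv, TemperedDistribution.laplacian_apply_apply]
      hasDerivAt k r hr :=
        h.hasDerivAt_laplacian_apply (hsub (Ioo_subset_Icc_self hr)) hr.1 _
      hasDerivAt_velocity k r hr := by
        simp only [Function.iterate_succ_apply', TemperedDistribution.laplacian_apply_apply (v _),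
          Complex.real_smul]
        exact heq r (hsub (Ioo_subset_Icc_self hr)) hr.1 _ }
  exact hier.eq_zero hA 0 (right_mem_Icc.2 ht.1)

end Curves

theorem hasFourierFunction_zero : HasFourierFunction (0 : 𝓢'(Rn n, ℂ)) (fun _ => 0) :=
  ⟨locallyIntegrable_const 0, fun ψ _ => by rw [TemperedDistribution.fourier_apply]; simp⟩

theorem HasFourierFunction.laplacian {f : 𝓢'(Rn n, ℂ)} {g : Rn n → ℂ} (hf : HasFourierFunction f g)
    (hg : IsTemperedFunction g) :
    HasFourierFunction (Δ f) (fun ξ => -((freq ξ ^ 2 : ℝ) : ℂ) * g ξ) := by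
  have hc : Continuous fun ξ : Rn n => -((freq ξ ^ 2 : ℝ) : ℂ) := by
    unfold freq
    fun_prop
  refine ⟨hf.1.continuous_mul hc, fun Θ _ => ?_⟩
  rw [TemperedDistribution.fourier_apply, hf.laplacian_apply hg,
    FourierTransform.fourierInv_fourier_eq]
  exact integral_congr_ae (.of_forall fun ξ => by ring)

theorem ae_freq_ne_zero (hn : 1 ≤ n) : ∀ᵐ ξ : Rn n, freq ξ ≠ 0 := by
  have : Nonempty (Fin n) := ⟨⟨0, hn⟩⟩
  have hz : ∀ᵐ ξ : Rn n, ξ ≠ 0 := by simp [ae_iff]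
  filter_upwards [hz] with ξ hξ
  have := norm_pos_iff.2 hξ
  unfold freq
  positivity

/-- In `Ḣ^{1/2}` there are no harmonic functions, since `{0}` is a null set. -/
theorem eq_zero_of_laplacian_eq_zero (hn : 1 ≤ n) {f : 𝓢'(Rn n, ℂ)}
    (hf : fourierNormSq freq f < ∞) (h : Δ f = 0) : f = 0 := by
  obtain ⟨g, hg⟩ := exists_hasFourierFunction_of_fourierNormSq_lt_top hf
  have ht : IsTemperedFunction g :=
    .of_lintegral_lt_top hg.1 (fun _ => one_le_freq) (by rwa [← hg.fourierNormSq_eq])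
  have hΔ := hg.laplacian ht
  rw [h] at hΔ
  refine (hg.congr ?_).ext hasFourierFunction_zero
  filter_upwards [hΔ.ae_eq hasFourierFunction_zero, ae_freq_ne_zero hn] with ξ hξ hξ0
  simpa [hξ0] using hξ

theorem IsC1Curve.eq_zero_of_wave (hn : 1 ≤ n) {T : EReal} {c : ℝ → ℝ} {u v : ℝ → 𝓢'(Rn n, ℂ)}
    (h : IsC1Curve (fourierNormSq freq) T u v) (hc : ContinuousOn c (timeInterval T))
    (hu : u 0 = 0) (hv : v 0 = 0)
    (heq : ∀ t ∈ timeInterval T, 0 < t → ∀ ψ : 𝓢(Rn n, ℂ),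
      HasDerivAt (fun r => v r ψ) ((c t : ℂ) * (Δ (u t)) ψ) t) {t : ℝ} (ht : t ∈ timeInterval T) :
    u t = 0 := by
  have hΔ : 𝓕 (Δ (u t)) = 0 := temperedDistribution_ext_of_hasCompactSupport fun Θ hΘ => by
    rw [TemperedDistribution.fourier_apply]
    exact h.laplacian_apply_eq_zero hc hu hv heq ht
      (by rwa [FourierTransform.fourierInv_fourier_eq])
  refine eq_zero_of_laplacian_eq_zero hn (h.mem t ht) ?_
  rw [← FourierTransform.fourierInv_fourier_eq (F := 𝓢'(Rn n, ℂ)) (Δ (u t)), hΔ]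
  exact FourierTransform.fourierInv_zero

section WeightedSquare

variable {Ω E : Type*} [MeasurableSpace Ω] {μ : Measure Ω} [SeminormedAddCommGroup E] {w : Ω → ℝ}
  {g : Ω → E}

theorem aestronglyMeasurable_mul_norm_sq (hw : Measurable w) (hg : AEStronglyMeasurable g μ) :
    AEStronglyMeasurable (fun ξ => w ξ * ‖g ξ‖ ^ 2) μ :=
  hw.aestronglyMeasurable.mul (hg.norm.pow 2)

theorem integrable_mul_norm_sq (hw : Measurable w) (hw0 : ∀ ξ, 0 ≤ w ξ)
    (hg : AEStronglyMeasurable g μ) (h : ∫⁻ ξ, ENNReal.ofReal (w ξ) * ‖g ξ‖ₑ ^ 2 ∂μ < ∞) :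
    Integrable (fun ξ => w ξ * ‖g ξ‖ ^ 2) μ := by
  refine ⟨aestronglyMeasurable_mul_norm_sq hw hg, ?_⟩
  rw [hasFiniteIntegral_iff_ofReal (.of_forall fun ξ => mul_nonneg (hw0 ξ) (sq_nonneg _))]
  simpa only [ofReal_mul_enorm_sq (hw0 _)] using h

theorem toReal_lintegral_mul_enorm_sq (hw : Measurable w) (hw0 : ∀ ξ, 0 ≤ w ξ)
    (hg : AEStronglyMeasurable g μ) :
    (∫⁻ ξ, ENNReal.ofReal (w ξ) * ‖g ξ‖ₑ ^ 2 ∂μ).toReal = ∫ ξ, w ξ * ‖g ξ‖ ^ 2 ∂μ := by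
  simp only [ofReal_mul_enorm_sq (hw0 _)]
  exact (integral_eq_lintegral_of_nonneg_ae (.of_forall fun ξ => mul_nonneg (hw0 ξ) (sq_nonneg _))
    (aestronglyMeasurable_mul_norm_sq hw hg)).symm

end WeightedSquare

theorem measurable_sq_freq : Measurable (fun ξ : Rn n => freq ξ ^ 2) := measurable_freq.pow_const 2

section Gradient

variable {f f' : 𝓢'(Rn n, ℂ)} {g : Rn n → ℂ}

theorem integrable_sq_freq_mul (hg : HasFourierFunction f g) (h : gradNormSq f < ∞) :
    Integrable (fun ξ => freq ξ ^ 2 * ‖g ξ‖ ^ 2) volume :=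
  integrable_mul_norm_sq measurable_sq_freq (fun _ => sq_nonneg _) hg.1.aestronglyMeasurable
    (hg.gradNormSq_eq ▸ h)

theorem toReal_gradNormSq (hg : HasFourierFunction f g) :
    (gradNormSq f).toReal = ∫ ξ, freq ξ ^ 2 * ‖g ξ‖ ^ 2 := by
  rw [hg.gradNormSq_eq, toReal_lintegral_mul_enorm_sq measurable_sq_freq (fun _ => sq_nonneg _)
    hg.1.aestronglyMeasurable]

theorem toReal_fourierNormSq {w : Rn n → ℝ} (hg : HasFourierFunction f g) (hw : Measurable w)
    (hw0 : ∀ ξ, 0 ≤ w ξ) : (fourierNormSq w f).toReal = ∫ ξ, w ξ * ‖g ξ‖ ^ 2 := by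
  rw [hg.fourierNormSq_eq, toReal_lintegral_mul_enorm_sq hw hw0 hg.1.aestronglyMeasurable]

theorem measurable_freq_mul_sq : Measurable (fun ξ : Rn n => freq ξ * freq ξ ^ 2) :=
  measurable_freq.mul measurable_sq_freq

theorem re_inner_sub_add {E : Type*} [SeminormedAddCommGroup E] [InnerProductSpace ℂ E] (a b : E) :
    RCLike.re (inner ℂ (a - b) (a + b)) = ‖a‖ ^ 2 - ‖b‖ ^ 2 := by
  have h : RCLike.re (inner ℂ b a) = RCLike.re (inner ℂ a b) := inner_re_symm b a
  rw [inner_sub_left, inner_add_right, inner_add_right, map_sub, map_add, map_add, h,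
    inner_self_eq_norm_sq, inner_self_eq_norm_sq]
  ring

/-- The duality of `Ḣ^{1/2}` and `Ḣ^{3/2}` over `Ḣ^1`. -/
theorem toReal_gradNormSq_sub (h : gradNormSq f < ∞) (h' : gradNormSq f' < ∞)
    (h₃ : fourierNormSq (fun ξ => freq ξ * freq ξ ^ 2) f < ∞)
    (h₃' : fourierNormSq (fun ξ => freq ξ * freq ξ ^ 2) f' < ∞)
    (h₁ : fourierNormSq freq (f - f') < ∞) :
    (gradNormSq f).toReal - (gradNormSq f').toReal =
      RCLike.re (inner ℂ (weightedFourier freq (f - f'))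
        (weightedFourier (fun ξ => freq ξ * freq ξ ^ 2) f +
          weightedFourier (fun ξ => freq ξ * freq ξ ^ 2) f')) := by
  obtain ⟨g, hg⟩ := exists_hasFourierFunction_of_fourierNormSq_lt_top h₃
  obtain ⟨g', hg'⟩ := exists_hasFourierFunction_of_fourierNormSq_lt_top h₃'
  rw [toReal_gradNormSq hg, toReal_gradNormSq hg', ← integral_sub (integrable_sq_freq_mul hg h)
    (integrable_sq_freq_mul hg' h'), L2.inner_def, ← integral_re (L2.integrable_inner _ _)]
  refine integral_congr_ae ?_
  filter_upwards [coeFn_weightedFourier measurable_freq (hg.sub hg') h₁,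
    coeFn_weightedFourier measurable_freq_mul_sq hg h₃,
    coeFn_weightedFourier measurable_freq_mul_sq hg' h₃', Lp.coeFn_add
      (weightedFourier (fun ξ => freq ξ * freq ξ ^ 2) f) (weightedFourier _ f')] with ξ h1 h2 h3 h4
  have hsqrt : (√(freq ξ * freq ξ ^ 2) : ℂ) = (√(freq ξ) * freq ξ : ℝ) := by
    rw [Real.sqrt_mul (freq_nonneg ξ), Real.sqrt_sq (freq_nonneg ξ)]
  have hsq : √(freq ξ) * (√(freq ξ) * freq ξ) = freq ξ ^ 2 := by
    rw [← mul_assoc, Real.mul_self_sqrt (freq_nonneg ξ), sq]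
  calc freq ξ ^ 2 * ‖g ξ‖ ^ 2 - freq ξ ^ 2 * ‖g' ξ‖ ^ 2
      = freq ξ ^ 2 * RCLike.re (inner ℂ (g ξ - g' ξ) (g ξ + g' ξ)) := by
        rw [re_inner_sub_add]
        ring
    _ = RCLike.re (inner ℂ ((√(freq ξ) : ℂ) * (g ξ - g' ξ))
          ((√(freq ξ * freq ξ ^ 2) : ℂ) * g ξ + (√(freq ξ * freq ξ ^ 2) : ℂ) * g' ξ)) := by
        rw [hsqrt, ← mul_add, ← smul_eq_mul (√_ : ℂ), ← smul_eq_mul (Complex.ofReal _),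
          inner_smul_left, inner_smul_right, Complex.conj_ofReal, ← mul_assoc,
          ← Complex.ofReal_mul, hsq]
        exact (RCLike.re_ofReal_mul _ _).symm
    _ = _ := by rw [h1, h4, Pi.add_apply, h2, h3]

theorem exists_lipschitzOnWith_toReal_gradNormSq {T : EReal} {w z : ℝ → 𝓢'(Rn n, ℂ)}
    (h₀ : IsC0Curve (fourierNormSq fun ξ => freq ξ * freq ξ ^ 2) T w)
    (h₁ : IsC1Curve (fourierNormSq freq) T (fun t => w t - w 0) z)
    (hfin : ∀ t ∈ timeInterval T, gradNormSq (w t) < ∞) {b : ℝ} (hb : b ∈ timeInterval T) :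
    ∃ K, LipschitzOnWith K (fun t => (gradNormSq (w t)).toReal) (Icc 0 b) := by
  have hsub := Icc_subset_timeInterval hb
  obtain ⟨A, hA⟩ := isCompact_Icc.exists_bound_of_continuousOn
    (((isC0Curve_iff measurable_freq).1 h₁.deriv_isC0).2.mono hsub)
  obtain ⟨M, hM⟩ := isCompact_Icc.exists_bound_of_continuousOn
    (((isC0Curve_iff measurable_freq_mul_sq).1 h₀).2.mono hsub)
  have h0b : (0 : ℝ) ∈ Icc 0 b := ⟨le_rfl, hb.1⟩
  have hA0 : 0 ≤ A := (norm_nonneg _).trans (hA 0 h0b)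
  have hM0 : 0 ≤ M := (norm_nonneg _).trans (hM 0 h0b)
  refine ⟨⟨A * (M + M), by positivity⟩, .of_dist_le_mul fun t ht s hs => ?_⟩
  have hincr : w t - w s = (w t - w 0) - (w s - w 0) := (sub_sub_sub_cancel_right _ _ _).symm
  have hfin' : fourierNormSq freq (w t - w s) < ∞ := by
    rw [hincr]
    exact fourierNormSq_sub_lt_top measurable_freq (h₁.mem t (hsub ht)) (h₁.mem s (hsub hs))
  have hdiff : ‖weightedFourier freq (w t - w s)‖ ≤ A * ‖t - s‖ := by
    rw [hincr, weightedFourier_sub measurable_freq (h₁.mem t (hsub ht)) (h₁.mem s (hsub hs))]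
    exact Convex.norm_image_sub_le_of_norm_hasDerivWithin_le (fun x hx =>
      (((isC1Curve_iff measurable_freq).1 h₁).2.2 x (hsub hx)).mono hsub) hA (convex_Icc 0 b) hs ht
  rw [Real.dist_eq, toReal_gradNormSq_sub (hfin t (hsub ht)) (hfin s (hsub hs))
    (h₀.mem t (hsub ht)) (h₀.mem s (hsub hs)) hfin']
  refine (RCLike.abs_re_le_norm _).trans ((norm_inner_le_norm _ _).trans ?_)
  calc _ ≤ (A * ‖t - s‖) * (M + M) := mul_le_mul hdiff
        ((norm_add_le _ _).trans (add_le_add (hM t ht) (hM s hs))) (norm_nonneg _) (by positivity)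
    _ = A * (M + M) * dist t s := by
        rw [dist_eq_norm]
        ring

end Gradient

/-! ### Solutions of the Kirchhoff equation -/

/-- The weight of the space `(-Δ)^(-1/4) γ^s_{η,L²}`. The weight of `(-Δ)^(-3/4) γ^s_{η,L²}` is
`freq ^ 2` times this one. -/
def gevreyWeight (s η : ℝ) (ξ : Rn n) : ℝ := freq ξ * Real.exp (η * freq ξ ^ (1 / s))

section GevreyWeight

variable {s η : ℝ}

theorem measurable_gevreyWeight : Measurable (gevreyWeight s η : Rn n → ℝ) :=
  measurable_freq.mul (Real.measurable_exp.comp ((measurable_freq.pow_const _).const_mul _))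

theorem gevreyWeight_nonneg (ξ : Rn n) : 0 ≤ gevreyWeight s η ξ :=
  mul_nonneg (freq_nonneg ξ) (Real.exp_pos _).le

theorem freq_le_gevreyWeight (hη : 0 ≤ η) (ξ : Rn n) : freq ξ ≤ gevreyWeight s η ξ :=
  le_mul_of_one_le_right (freq_nonneg ξ) (Real.one_le_exp
    (mul_nonneg hη (Real.rpow_nonneg (freq_nonneg ξ) _)))

theorem homGevreyNormSq_half (s η : ℝ) :
    (homGevreyNormSq (1 / 2) s η : 𝓢'(Rn n, ℂ) → ℝ≥0∞) = fourierNormSq (gevreyWeight s η) := by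
  unfold homGevreyNormSq gevreyWeight freq
  norm_num

theorem freq_rpow_three (ξ : Rn n) :
    (2 * Real.pi * ‖ξ‖) ^ (2 * (3 / 2) : ℝ) = freq ξ * freq ξ ^ 2 := by
  rw [show (2 * (3 / 2) : ℝ) = ((3 : ℕ) : ℝ) by norm_num, Real.rpow_natCast, freq, pow_succ']

theorem homGevreyNormSq_three_half (s η : ℝ) :
    (homGevreyNormSq (3 / 2) s η : 𝓢'(Rn n, ℂ) → ℝ≥0∞) =
      fourierNormSq fun ξ => gevreyWeight s η ξ * freq ξ ^ 2 := by
  unfold homGevreyNormSq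
  simp only [freq_rpow_three, gevreyWeight, mul_right_comm, freq]

theorem homSobolevNormSq_half :
    (homSobolevNormSq (1 / 2) : 𝓢'(Rn n, ℂ) → ℝ≥0∞) = fourierNormSq freq := by
  unfold homSobolevNormSq freq
  norm_num

theorem homSobolevNormSq_three_half :
    (homSobolevNormSq (3 / 2) : 𝓢'(Rn n, ℂ) → ℝ≥0∞) =
      fourierNormSq fun ξ => freq ξ * freq ξ ^ 2 := by
  unfold homSobolevNormSq
  simp only [freq_rpow_three]

end GevreyWeight

namespace IsSolution

variable {φ : ℝ → ℝ} {ν s η t : ℝ} {u₀ u₁ : 𝓢'(Rn n, ℂ)} {T : EReal} {w z u v : ℝ → 𝓢'(Rn n, ℂ)}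
  {g₀ g₁ : Rn n → ℂ}

theorem isC0Curve (h : IsSolution φ s η u₀ u₁ T w z) (hη : 0 ≤ η) :
    IsC0Curve (fourierNormSq fun ξ => freq ξ * freq ξ ^ 2) T w := by
  refine h.isC0.mono fun f => ?_
  rw [homGevreyNormSq_three_half]
  exact fourierNormSq_mono
    (fun ξ => mul_le_mul_of_nonneg_right (freq_le_gevreyWeight hη ξ) (sq_nonneg _)) f

theorem isC1Curve (h : IsSolution φ s η u₀ u₁ T w z) (hη : 0 ≤ η) :
    IsC1Curve (fourierNormSq freq) T (fun t => w t - u₀) z := by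
  have h1 := h.isC1
  rw [h.init] at h1
  refine h1.mono fun f => ?_
  rw [homGevreyNormSq_half]
  exact fourierNormSq_mono (freq_le_gevreyWeight hη) f

theorem exists_lipschitzOnWith (h : IsSolution φ s η u₀ u₁ T w z) (hη : 0 ≤ η) {b : ℝ}
    (hb : b ∈ timeInterval T) :
    ∃ K, LipschitzOnWith K (fun t => (gradNormSq (w t)).toReal) (Icc 0 b) :=
  exists_lipschitzOnWith_toReal_gradNormSq (h.isC0Curve hη) (h.init ▸ h.isC1Curve hη) h.grad_finite
    hb

theorem exists_isWaveSpeed (h : IsSolution φ s η u₀ u₁ T w z) (hη : 0 ≤ η)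
    (hφ : IsKirchhoffCoefficient ν φ) {b : ℝ} (hb : b ∈ timeInterval T) :
    ∃ L, IsWaveSpeed ν L (φ ∘ fun t => (gradNormSq (w t)).toReal) (Icc 0 b) := by
  obtain ⟨K, hK⟩ := h.exists_lipschitzOnWith hη hb
  exact hφ.exists_isWaveSpeed_comp isCompact_Icc hK fun t _ => ENNReal.toReal_nonneg

theorem eq_of_isFlow (h : IsSolution φ s η u₀ u₁ T w z) (hn : 1 ≤ n) (hη : 0 ≤ η)
    (hφ : IsKirchhoffCoefficient ν φ) (hd : IsWaveData volume freq g₀ g₁)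
    (h₀ : HasFourierFunction u₀ g₀) (h₁ : HasFourierFunction u₁ g₁)
    (hflow : IsFlow g₀ g₁ (φ ∘ fun t => (gradNormSq (w t)).toReal) T u v)
    (ht : t ∈ timeInterval T) : w t = u t := by
  have hc := fun b hb => h.exists_isWaveSpeed hη hφ (b := b) hb
  have hu₀ : u 0 = u₀ := hflow.apply_zero (zero_mem_timeInterval ht) h₀
  have hv₀ : v 0 = u₁ := hflow.velocity_apply_zero (zero_mem_timeInterval ht) h₁
  have hdiff : IsC1Curve (fourierNormSq freq) T (fun t => w t - u t) fun t => z t - v t := by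
    simpa only [hu₀, sub_sub_sub_cancel_right] using
      (h.isC1Curve hη).sub measurable_freq (hflow.isC1Curve hd hc hd.isEnergyWeight_self)
  refine sub_eq_zero.1 (hdiff.eq_zero_of_wave hn (continuousOn_timeInterval fun b hb =>
    (hc b hb).elim fun _ hL => hL.lipschitz.continuousOn) (by rw [h.init, hu₀, sub_self])
    (by rw [h.init_deriv, hv₀, sub_self]) (fun r hr hr0 ψ => ?_) ht)
  refine ((h.equation r hr hr0 ψ).sub (hflow.hasDerivAt_apply hd h₀.1 hc hr hr0 ψ)).congr_deriv ?_
  simp only [TemperedDistribution.laplacian_apply_apply]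
  exact (mul_sub _ _ _).symm

theorem isProfile (h : IsSolution φ s η u₀ u₁ T w z) (hn : 1 ≤ n) (hη : 0 ≤ η)
    (hφ : IsKirchhoffCoefficient ν φ) (hd : IsWaveData volume freq g₀ g₁)
    (h₀ : HasFourierFunction u₀ g₀) (h₁ : HasFourierFunction u₁ g₁) (ht : t ∈ timeInterval T) :
    IsProfile volume freq g₀ g₁ φ t (fun t => (gradNormSq (w t)).toReal) ∧
      HasFourierFunction (w t) (wave freq g₀ g₁ (φ ∘ fun t => (gradNormSq (w t)).toReal) t) := by
  have hc := fun b hb => h.exists_isWaveSpeed hη hφ (b := b) hb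
  obtain ⟨u, v, hflow⟩ := exists_isFlow hd h₀.1 hc
  have hwu := fun r hr => h.eq_of_isFlow hn hη hφ hd h₀ h₁ hflow (t := r) hr
  refine ⟨⟨h.exists_lipschitzOnWith hη ht, fun r hr => ?_⟩, ?_⟩
  · have hr' := Icc_subset_timeInterval ht hr
    rw [hwu r hr', hflow.gradNormSq_eq hd hc hr', ENNReal.toReal_ofReal (waveGradSq_nonneg ..)]
  · rw [hwu t ht]
    exact hflow.hasFourierFunction t ht

end IsSolution

/-! ### The maximal solution -/

theorem limsup_nhdsLT_eq_top {f : ℝ → ℝ} {b : ℝ}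
    (h : ∀ a < b, ∀ M, ∃ t ∈ Ico a b, M < f t) :
    limsup (fun t => (f t : EReal)) (𝓝[<] b) = ⊤ := by
  by_contra hlim
  obtain ⟨M, hM, -⟩ := EReal.lt_iff_exists_real_btwn.1 (lt_top_iff_ne_top.2 hlim)
  have hev := eventually_lt_of_limsup_lt hM
  rw [eventually_iff, mem_nhdsLT_iff_exists_Ico_subset] at hev
  obtain ⟨a, ha, hsub⟩ := hev
  obtain ⟨t, ht, hMt⟩ := h a ha M
  exact (hMt.trans (EReal.coe_lt_coe_iff.1 (hsub ht))).false

section LifeSpan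

variable {Ω : Type*} [MeasurableSpace Ω] {μ : Measure Ω} {m : Ω → ℝ} {g₀ g₁ : Ω → ℂ} {φ r : ℝ → ℝ}
  {ν T : ℝ}

/-- The life span of the solution of the Kirchhoff equation, that is the supremum of the times up to
which it has a profile. -/
def lifeSpan (μ : Measure Ω) (m : Ω → ℝ) (g₀ g₁ : Ω → ℂ) (φ : ℝ → ℝ) : EReal :=
  sSup ((fun T : ℝ => (T : EReal)) '' {T | 0 ≤ T ∧ ∃ r, IsProfile μ m g₀ g₁ φ T r})

theorem IsProfile.le_lifeSpan (h : IsProfile μ m g₀ g₁ φ T r) (hT : 0 ≤ T) :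
    (T : EReal) ≤ lifeSpan μ m g₀ g₁ φ :=
  le_sSup ⟨T, ⟨hT, r, h⟩, rfl⟩

theorem exists_isProfile_of_mem_timeInterval_lifeSpan {b : ℝ}
    (hb : b ∈ timeInterval (lifeSpan μ m g₀ g₁ φ)) : ∃ r, IsProfile μ m g₀ g₁ φ b r := by
  obtain ⟨_, ⟨T, ⟨-, r, hr⟩, rfl⟩, hbT⟩ := lt_sSup_iff.1 hb.2
  exact ⟨r, hr.mono (EReal.coe_lt_coe_iff.1 hbT).le⟩

theorem exists_isProfile_lifeSpan (hd : IsWaveData μ m g₀ g₁) (hφ : IsKirchhoffCoefficient ν φ) :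
    ∃ r, ∀ b ∈ timeInterval (lifeSpan μ m g₀ g₁ φ), IsProfile μ m g₀ g₁ φ b r := by
  choose! R hR using fun b => exists_isProfile_of_mem_timeInterval_lifeSpan
    (μ := μ) (m := m) (g₀ := g₀) (g₁ := g₁) (φ := φ) (b := b)
  refine ⟨fun t => R t t, fun b hb => (hR b hb).congr fun t ht => ?_⟩
  exact ((hR b hb).mono ht.2).unique hd hφ (hR t (Icc_subset_timeInterval hb ht)) ⟨ht.1, le_rfl⟩

/-- Otherwise the extension time would be bounded from below up to `T`. -/
theorem exists_lt_waveEnergy {Ω : Type} [MeasurableSpace Ω] {μ : Measure Ω} {m : Ω → ℝ}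
    {g₀ g₁ : Ω → ℂ} (hd : IsWaveData μ m g₀ g₁) (hφ : IsKirchhoffCoefficient ν φ)
    (hT : lifeSpan μ m g₀ g₁ φ = T)
    (hr : ∀ b ∈ timeInterval (lifeSpan μ m g₀ g₁ φ), IsProfile μ m g₀ g₁ φ b r) {a : ℝ}
    (ha : 0 ≤ a) (haT : a < T) (M : ℝ) :
    ∃ t ∈ Ico a T, M < waveEnergy μ m g₀ g₁ (φ ∘ r) t := by
  by_contra! hM
  have hprofile : ∀ b ∈ Ico a T, IsProfile μ m g₀ g₁ φ b r := fun b hb =>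
    hr b ⟨ha.trans hb.1, hT ▸ EReal.coe_lt_coe_iff.2 hb.2⟩
  have haI : a ∈ Ico a T := ⟨le_rfl, haT⟩
  have hM0 : 0 ≤ M := by
    obtain ⟨L, hL⟩ := (hprofile a haI).exists_isWaveSpeed hφ
    exact (waveEnergy_nonneg hd hL ⟨ha, le_rfl⟩).trans (hM a haI)
  set ρ := waveGradSq μ m g₀ g₁ (φ ∘ r) a + M / √ν * (T - a)
  have hρ : ∀ b ∈ Ico a T, r b ≤ ρ := fun b hb => by
    obtain ⟨L, hL⟩ := (hprofile b hb).exists_isWaveSpeed hφ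
    rw [(hprofile b hb).eq b ⟨ha.trans hb.1, le_rfl⟩]
    refine (waveGradSq_le_of_waveEnergy_le hd hL ha hb.1 fun t ht =>
      hM t ⟨ht.1, ht.2.trans hb.2⟩).trans (add_le_add_right ?_ _)
    exact mul_le_mul_of_nonneg_left (sub_le_sub_right hb.2.le a) (by positivity)
  obtain ⟨τ, hτ, hext⟩ := exists_extension_time hφ ρ hM0
  have hb : max a (T - τ / 2) ∈ Ico a T := ⟨le_max_left _ _, max_lt haT (by linarith)⟩
  have hb0 := ha.trans hb.1
  obtain ⟨r', hr'⟩ := hext Ω μ m g₀ g₁ hd _ r ⟨hprofile _ hb, hb0, hρ _ hb, hM _ hb⟩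
  have hle := hr'.le_lifeSpan (by positivity)
  rw [hT, EReal.coe_le_coe_iff] at hle
  linarith [le_max_right a (T - τ / 2)]

end LifeSpan

section Data

variable {u₀ u₁ : 𝓢'(Rn n, ℂ)} {g₀ g₁ : Rn n → ℂ} {φ : ℝ → ℝ} {ν s η t : ℝ}

theorem isEnergyWeight_freq {w : Rn n → ℝ} (hw : Measurable w) (hw0 : ∀ ξ, 0 ≤ w ξ)
    (h₀ : HasFourierFunction u₀ g₀) (h₁ : HasFourierFunction u₁ g₁)
    (hu₀ : fourierNormSq (fun ξ => w ξ * freq ξ ^ 2) u₀ < ∞) (hu₁ : fourierNormSq w u₁ < ∞) :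
    IsEnergyWeight volume freq g₀ g₁ w := by
  rw [h₀.fourierNormSq_eq] at hu₀
  rw [h₁.fourierNormSq_eq] at hu₁
  refine ⟨hw, hw0, ((integrable_mul_norm_sq (hw.mul measurable_sq_freq)
    (fun ξ => mul_nonneg (hw0 ξ) (sq_nonneg _)) h₀.1.aestronglyMeasurable hu₀).add
    (integrable_mul_norm_sq hw hw0 h₁.1.aestronglyMeasurable hu₁)).congr (.of_forall fun ξ => ?_)⟩
  simp only [dataDensity, oscillationEnergy, Pi.add_apply, Pi.mul_apply]
  ring

theorem isEnergyWeight_gevreyWeight (h₀ : HasFourierFunction u₀ g₀) (h₁ : HasFourierFunction u₁ g₁)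
    (hu₀ : homGevreyNormSq (3 / 2) s η u₀ < ∞) (hu₁ : homGevreyNormSq (1 / 2) s η u₁ < ∞) :
    IsEnergyWeight volume freq g₀ g₁ (gevreyWeight s η) := by
  rw [homGevreyNormSq_three_half] at hu₀
  rw [homGevreyNormSq_half] at hu₁
  exact isEnergyWeight_freq measurable_gevreyWeight gevreyWeight_nonneg h₀ h₁ hu₀ hu₁

theorem isEnergyWeight_freq_one (h₀ : HasFourierFunction u₀ g₀) (h₁ : HasFourierFunction u₁ g₁)
    (hu₀ : gradNormSq u₀ < ∞) (hu₁ : l2NormSq u₁ < ∞) :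
    IsEnergyWeight volume freq g₀ g₁ 1 := by
  rw [h₀.gradNormSq_eq] at hu₀
  rw [h₁.l2NormSq_eq] at hu₁
  refine isEnergyWeight_freq measurable_one (fun _ => zero_le_one) h₀ h₁ ?_ ?_
  · simpa only [h₀.fourierNormSq_eq, Pi.one_apply, one_mul] using hu₀
  · simpa only [h₁.fourierNormSq_eq, Pi.one_apply, ENNReal.ofReal_one, one_mul] using hu₁

theorem isWaveData_of_isEnergyWeight (hη : 0 ≤ η) (h₀ : HasFourierFunction u₀ g₀)
    (h₁ : HasFourierFunction u₁ g₁) (h : IsEnergyWeight volume freq g₀ g₁ 1)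
    (hs : IsEnergyWeight volume freq g₀ g₁ (gevreyWeight s η)) :
    IsWaveData volume freq g₀ g₁ where
  aestronglyMeasurable := h₀.1.aestronglyMeasurable
  aestronglyMeasurable_velocity := h₁.1.aestronglyMeasurable
  isEnergyWeight_one := h
  isEnergyWeight_self := by
    have hdata : AEStronglyMeasurable (dataDensity freq g₀ g₁) volume := by
      simpa only [Pi.one_apply, one_mul] using h.integrable.1
    refine ⟨measurable_freq, freq_nonneg, hs.integrable.mono'
      (measurable_freq.aestronglyMeasurable.mul hdata) (.of_forall fun ξ => ?_)⟩
    rw [Real.norm_of_nonneg (mul_nonneg (freq_nonneg ξ) (dataDensity_nonneg _ _ _ _))]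
    exact mul_le_mul_of_nonneg_right (freq_le_gevreyWeight hη ξ) (dataDensity_nonneg _ _ _ _)

theorem energy32_eq_waveEnergy {L : ℝ≥0} {c : ℝ → ℝ} (hd : IsWaveData volume freq g₀ g₁)
    (hc : IsWaveSpeed ν L c (Icc 0 t)) (ht : 0 ≤ t)
    (h₀ : HasFourierFunction u₀ (wave freq g₀ g₁ c t))
    (h₁ : HasFourierFunction u₁ (waveVelocity freq g₀ g₁ c t))
    (hφ : φ (gradNormSq u₀).toReal = c t) :
    energy32 φ u₀ u₁ = waveEnergy volume freq g₀ g₁ c t := by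
  have htt : t ∈ Icc 0 t := ⟨ht, le_rfl⟩
  have hpos := hd.isEnergyWeight_self.integrable_mul_wave_sq hd hc htt
  have hvel := hd.isEnergyWeight_self.integrable_mul_waveVelocity_sq hd hc htt
  simp only [← mul_assoc] at hpos
  rw [energy32, hφ, homSobolevNormSq_three_half, homSobolevNormSq_half,
    toReal_fourierNormSq h₀ measurable_freq_mul_sq
      fun ξ => mul_nonneg (freq_nonneg ξ) (sq_nonneg _),
    toReal_fourierNormSq h₁ measurable_freq freq_nonneg, waveEnergy, ← integral_const_mul,
    ← integral_add (hpos.const_mul _) hvel]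
  refine integral_congr_ae (.of_forall fun ξ => ?_)
  simp only [waveDensity, oscillationEnergy]
  ring

theorem mul_gradNormSq_le_hamiltonian (hφ : IsKirchhoffCoefficient ν φ) (f g : 𝓢'(Rn n, ℂ)) :
    ν * (gradNormSq f).toReal ≤ hamiltonian φ f g := by
  have h0 : 0 ≤ (gradNormSq f).toReal := ENNReal.toReal_nonneg
  calc ν * (gradNormSq f).toReal = ∫ _ in (0 : ℝ)..(gradNormSq f).toReal, ν := by
        rw [intervalIntegral.integral_const, sub_zero, smul_eq_mul, mul_comm]
    _ ≤ ∫ ρ in (0 : ℝ)..(gradNormSq f).toReal, φ ρ :=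
        intervalIntegral.integral_mono_on h0 intervalIntegrable_const
          ((hφ.locallyLipschitzOn.continuousOn.mono Icc_subset_Ici_self).intervalIntegrable_of_Icc
            h0) fun ρ hρ => hφ.le_apply ρ hρ.1
    _ ≤ hamiltonian φ f g := le_add_of_nonneg_left ENNReal.toReal_nonneg

theorem isBoundedProfile_zero (hφ : IsKirchhoffCoefficient ν φ) (hd : IsWaveData volume freq g₀ g₁)
    (h₀ : HasFourierFunction u₀ g₀) (h₁ : HasFourierFunction u₁ g₁) :
    IsBoundedProfile volume freq g₀ g₁ φ (hamiltonian φ u₀ u₁ / ν) (energy32 φ u₀ u₁) 0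
      fun _ => ∫ ξ, freq ξ ^ 2 * ‖g₀ ξ‖ ^ 2 := by
  have hprofile := isProfile_zero volume freq g₀ g₁ φ
  obtain ⟨L, hL⟩ := hprofile.exists_isWaveSpeed hφ
  have hgrad := toReal_gradNormSq h₀
  refine ⟨hprofile, le_rfl, ?_, ?_⟩
  · rw [← hgrad, le_div_iff₀' hφ.pos]
    exact mul_gradNormSq_le_hamiltonian hφ u₀ u₁
  · refine (energy32_eq_waveEnergy hd hL le_rfl (h₀.congr (.of_forall fun ξ => ?_))
      (h₁.congr (.of_forall fun ξ => ?_)) (by rw [hgrad, Function.comp_apply])).ge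
    · exact (wave_zero freq g₀ g₁ _ ξ).symm
    · exact (waveVelocity_zero freq g₀ g₁ _ ξ).symm

theorem exists_le_lifeSpan (hφ : IsKirchhoffCoefficient ν φ) :
    ∃ τ : ℝ → ℝ → ℝ, (∀ h e, 0 < τ h e) ∧
      ∀ (n : ℕ) (u₀ u₁ : 𝓢'(Rn n, ℂ)) (g₀ g₁ : Rn n → ℂ), HasFourierFunction u₀ g₀ →
        HasFourierFunction u₁ g₁ → IsWaveData volume freq g₀ g₁ →
          (τ (hamiltonian φ u₀ u₁) (energy32 φ u₀ u₁) : EReal) ≤ lifeSpan volume freq g₀ g₁ φ := by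
  choose τ hτ0 hτ using fun h e : ℝ => exists_extension_time hφ (h / ν) (abs_nonneg e)
  refine ⟨τ, hτ0, fun n u₀ u₁ g₀ g₁ h₀ h₁ hd => ?_⟩
  have hbdd := isBoundedProfile_zero hφ hd h₀ h₁
  obtain ⟨r, hr⟩ := hτ _ (energy32 φ u₀ u₁) _ volume freq g₀ g₁ hd 0 _
    { hbdd with waveEnergy_le := hbdd.waveEnergy_le.trans (le_abs_self _) }
  rw [zero_add] at hr
  exact hr.le_lifeSpan (hτ0 _ _).le

end Data

section MaximalSolution

variable {u₀ u₁ : 𝓢'(Rn n, ℂ)} {g₀ g₁ : Rn n → ℂ} {φ r : ℝ → ℝ} {ν s η t : ℝ} {T T' : EReal}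
  {u v w z : ℝ → 𝓢'(Rn n, ℂ)}

theorem IsFlow.toReal_gradNormSq (hflow : IsFlow g₀ g₁ (φ ∘ r) T u v)
    (hφ : IsKirchhoffCoefficient ν φ) (hd : IsWaveData volume freq g₀ g₁)
    (hr : ∀ b ∈ timeInterval T, IsProfile volume freq g₀ g₁ φ b r) (ht : t ∈ timeInterval T) :
    (gradNormSq (u t)).toReal = r t := by
  rw [hflow.gradNormSq_eq hd (fun b hb => (hr b hb).exists_isWaveSpeed hφ) ht,
    ENNReal.toReal_ofReal (waveGradSq_nonneg ..), (hr t ht).eq t ⟨ht.1, le_rfl⟩]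

theorem IsFlow.isSolution (hflow : IsFlow g₀ g₁ (φ ∘ r) T u v) (hφ : IsKirchhoffCoefficient ν φ)
    (hd : IsWaveData volume freq g₀ g₁) (h₀ : HasFourierFunction u₀ g₀)
    (h₁ : HasFourierFunction u₁ g₁) (hs : IsEnergyWeight volume freq g₀ g₁ (gevreyWeight s η))
    (hr : ∀ b ∈ timeInterval T, IsProfile volume freq g₀ g₁ φ b r) (hT : 0 ∈ timeInterval T) :
    IsSolution φ s η u₀ u₁ T u v := by
  have hc := fun b hb => (hr b hb).exists_isWaveSpeed hφ
  refine ⟨hflow.apply_zero hT h₀, hflow.velocity_apply_zero hT h₁, ?_, ?_, fun t ht => ?_,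
    fun t ht ht0 ψ => ?_⟩
  · rw [homGevreyNormSq_three_half]
    exact hflow.isC0Curve hd hc hs
  · rw [homGevreyNormSq_half]
    exact hflow.isC1Curve hd hc hs
  · rw [hflow.gradNormSq_eq hd hc ht]
    exact ENNReal.ofReal_lt_top
  · rw [hflow.toReal_gradNormSq hφ hd hr ht]
    exact hflow.hasDerivAt_apply hd h₀.1 hc ht ht0 ψ

theorem IsSolution.eq_of_isProfile (h : IsSolution φ s η u₀ u₁ T' w z) (hT : T' ≤ T) (hn : 1 ≤ n)
    (hη : 0 ≤ η) (hφ : IsKirchhoffCoefficient ν φ) (hd : IsWaveData volume freq g₀ g₁)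
    (h₀ : HasFourierFunction u₀ g₀) (h₁ : HasFourierFunction u₁ g₁)
    (hr : ∀ b ∈ timeInterval T, IsProfile volume freq g₀ g₁ φ b r)
    (hflow : IsFlow g₀ g₁ (φ ∘ r) T u v) (ht : t ∈ timeInterval T') : w t = u t := by
  have ht' : t ∈ timeInterval T := ⟨ht.1, ht.2.trans_le hT⟩
  obtain ⟨hprofile, hw⟩ := h.isProfile hn hη hφ hd h₀ h₁ ht
  have heq := hprofile.unique hd hφ (hr t ht')
  refine (hw.congr (.of_forall fun ξ => ?_)).ext (hflow.hasFourierFunction t ht')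
  rw [wave_congr (heq.comp_left (g := φ)) ⟨ht.1, le_rfl⟩]

theorem limsup_energy32_eq_top (hφ : IsKirchhoffCoefficient ν φ)
    (hd : IsWaveData volume freq g₀ g₁) (hpos : 0 < lifeSpan volume freq g₀ g₁ φ)
    (htop : lifeSpan volume freq g₀ g₁ φ ≠ ⊤)
    (hr : ∀ b ∈ timeInterval (lifeSpan volume freq g₀ g₁ φ), IsProfile volume freq g₀ g₁ φ b r)
    (hflow : IsFlow g₀ g₁ (φ ∘ r) (lifeSpan volume freq g₀ g₁ φ) u v) :
    limsup (fun t => (energy32 φ (u t) (v t) : EReal))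
      (𝓝[<] (lifeSpan volume freq g₀ g₁ φ).toReal) = ⊤ := by
  have hT := (EReal.coe_toReal htop (EReal.bot_lt_zero.trans hpos).ne').symm
  set T := (lifeSpan volume freq g₀ g₁ φ).toReal
  have hT0 : 0 < T := by rwa [hT, EReal.coe_pos] at hpos
  refine limsup_nhdsLT_eq_top fun a ha M => ?_
  obtain ⟨t, ht, hMt⟩ := exists_lt_waveEnergy hd hφ hT hr (le_max_right a 0) (max_lt ha hT0) M
  have ht0 : 0 ≤ t := (le_max_right a 0).trans ht.1
  have htm : t ∈ timeInterval (lifeSpan volume freq g₀ g₁ φ) :=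
    ⟨ht0, hT ▸ EReal.coe_lt_coe_iff.2 ht.2⟩
  obtain ⟨L, hL⟩ := (hr t htm).exists_isWaveSpeed hφ
  refine ⟨t, ⟨(le_max_left a 0).trans ht.1, ht.2⟩, ?_⟩
  rwa [energy32_eq_waveEnergy hd hL ht0 (hflow.hasFourierFunction t htm)
    (hflow.hasFourierFunction_velocity t htm)
    (by rw [hflow.toReal_gradNormSq hφ hd hr htm, Function.comp_apply])]

end MaximalSolution

open Classical in
/-- A function which represents the Fourier transform of `f`, if there is one, and `0` otherwise. -/
def fourierFunction (f : 𝓢'(Rn n, ℂ)) : Rn n → ℂ :=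
  if h : ∃ g, HasFourierFunction f g then h.choose else 0

theorem hasFourierFunction_fourierFunction {w : Rn n → ℝ} {f : 𝓢'(Rn n, ℂ)}
    (h : fourierNormSq w f < ∞) : HasFourierFunction f (fourierFunction f) := by
  have hex := exists_hasFourierFunction_of_fourierNormSq_lt_top h
  rw [fourierFunction, dif_pos hex]
  exact hex.choose_spec

end Kirchhoff

end

theorem proposition2p3_general (φ : ℝ → ℝ) (hφ : LocallyLipschitzOn (Set.Ici 0) φ)
    (ν₀ : ℝ) (hν₀ : 0 < ν₀) (hφν : ∀ ρ : ℝ, 0 ≤ ρ → ν₀ ≤ φ ρ) :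
    ∃ τ : ℝ → ℝ → ℝ, (∀ h e : ℝ, 0 < τ h e) ∧
    ∀ n : ℕ, 1 ≤ n →
    ∃ Tm : 𝓢'(Kirchhoff.Rn n, ℂ) → 𝓢'(Kirchhoff.Rn n, ℂ) → EReal,
    ∀ s η : ℝ, s ≠ 0 → 0 ≤ η →
    ∀ u₀ u₁ : 𝓢'(Kirchhoff.Rn n, ℂ),
      Kirchhoff.homGevreyNormSq (3 / 2) s η u₀ < ∞ →
      Kirchhoff.homGevreyNormSq (1 / 2) s η u₁ < ∞ →
      Kirchhoff.gradNormSq u₀ < ∞ →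
      Kirchhoff.l2NormSq u₁ < ∞ →
      0 < Tm u₀ u₁ ∧
      (τ (Kirchhoff.hamiltonian φ u₀ u₁) (Kirchhoff.energy32 φ u₀ u₁) : EReal) ≤ Tm u₀ u₁ ∧
      ∃ u v : ℝ → 𝓢'(Kirchhoff.Rn n, ℂ),
        Kirchhoff.IsSolution φ s η u₀ u₁ (Tm u₀ u₁) u v ∧
        (∀ T : EReal, 0 < T → T ≤ Tm u₀ u₁ → ∀ w z : ℝ → 𝓢'(Kirchhoff.Rn n, ℂ),
          Kirchhoff.IsSolution φ s η u₀ u₁ T w z →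
            ∀ t ∈ Kirchhoff.timeInterval T, w t = u t) ∧
        (Tm u₀ u₁ = ⊤ ∨
          (Tm u₀ u₁ < ⊤ ∧
            Filter.limsup (fun t : ℝ => ((Kirchhoff.energy32 φ (u t) (v t) : ℝ) : EReal))
              (𝓝[<] (Tm u₀ u₁).toReal) = ⊤)) := by
  have hcoeff : Kirchhoff.IsKirchhoffCoefficient ν₀ φ := ⟨hν₀, hφν, hφ⟩
  obtain ⟨τ, hτ0, hτ⟩ := Kirchhoff.exists_le_lifeSpan hcoeff
  refine ⟨τ, hτ0, fun n hn => ⟨fun u₀ u₁ => Kirchhoff.lifeSpan volume Kirchhoff.freq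
    (Kirchhoff.fourierFunction u₀) (Kirchhoff.fourierFunction u₁) φ, ?_⟩⟩
  intro s η _ hη u₀ u₁ hu₀ hu₁ hgrad hl2
  have h₀ := Kirchhoff.hasFourierFunction_fourierFunction hu₀
  have h₁ := Kirchhoff.hasFourierFunction_fourierFunction hu₁
  have hs := Kirchhoff.isEnergyWeight_gevreyWeight h₀ h₁ hu₀ hu₁
  have hd := Kirchhoff.isWaveData_of_isEnergyWeight hη h₀ h₁
    (Kirchhoff.isEnergyWeight_freq_one h₀ h₁ hgrad hl2) hs
  have hlow := hτ n u₀ u₁ _ _ h₀ h₁ hd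
  have hpos := (EReal.coe_pos.2 (hτ0 _ _)).trans_le hlow
  obtain ⟨r, hr⟩ := Kirchhoff.exists_isProfile_lifeSpan hd hcoeff
  obtain ⟨u, v, hflow⟩ :=
    Kirchhoff.exists_isFlow hd h₀.1 fun b hb => (hr b hb).exists_isWaveSpeed hcoeff
  exact ⟨hpos, hlow, u, v, hflow.isSolution hcoeff hd h₀ h₁ hs hr ⟨le_rfl, hpos⟩,
    fun T _ hT w z h t ht => h.eq_of_isProfile hT hn hη hcoeff hd h₀ h₁ hr hflow ht,
    (eq_or_ne _ ⊤).imp_right fun htop => ⟨htop.lt_top,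
      Kirchhoff.limsup_energy32_eq_top hcoeff hd hpos htop hr hflow⟩⟩

theorem proposition2p3 (φ : ℝ → ℝ) (hφ : LocallyLipschitzOn (Set.Ici 0) φ)
    (ν₀ : ℝ) (hν₀ : 0 < ν₀) (hφν : ∀ ρ : ℝ, 0 ≤ ρ → ν₀ ≤ φ ρ) :
    -- the lower bound for the life span, a function of the Hamiltonian and the energy of order 3/2
    ∃ τ : ℝ → ℝ → ℝ, (∀ h e : ℝ, 0 < τ h e) ∧
    ∀ n : ℕ, 1 ≤ n →
    -- the life span of the data
    ∃ Tm : 𝓢'(Kirchhoff.Rn n, ℂ) → 𝓢'(Kirchhoff.Rn n, ℂ) → EReal,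
    ∀ s η : ℝ, 1 < s → 0 < η →
    ∀ u₀ u₁ : 𝓢'(Kirchhoff.Rn n, ℂ), (u₀ ≠ 0 ∨ u₁ ≠ 0) →
      Kirchhoff.homGevreyNormSq (3 / 2) s η u₀ < ∞ →
      Kirchhoff.homGevreyNormSq (1 / 2) s η u₁ < ∞ →
      -- the initial Hamiltonian is finite
      Kirchhoff.gradNormSq u₀ < ∞ →
      Kirchhoff.l2NormSq u₁ < ∞ →
      0 < Tm u₀ u₁ ∧
      (τ (Kirchhoff.hamiltonian φ u₀ u₁) (Kirchhoff.energy32 φ u₀ u₁) : EReal) ≤ Tm u₀ u₁ ∧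
      ∃ u v : ℝ → 𝓢'(Kirchhoff.Rn n, ℂ),
        Kirchhoff.IsSolution φ s η u₀ u₁ (Tm u₀ u₁) u v ∧
        (∀ T : EReal, 0 < T → T ≤ Tm u₀ u₁ → ∀ w z : ℝ → 𝓢'(Kirchhoff.Rn n, ℂ),
          Kirchhoff.IsSolution φ s η u₀ u₁ T w z →
            ∀ t ∈ Kirchhoff.timeInterval T, w t = u t) ∧
        (Tm u₀ u₁ = ⊤ ∨
          (Tm u₀ u₁ < ⊤ ∧
            Filter.limsup (fun t : ℝ => ((Kirchhoff.energy32 φ (u t) (v t) : ℝ) : EReal))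
              (𝓝[<] (Tm u₀ u₁).toReal) = ⊤)) := by
  obtain ⟨τ, hτ0, hτ⟩ := proposition2p3_general φ hφ ν₀ hν₀ hφν
  exact ⟨τ, hτ0, fun n hn => (hτ n hn).imp fun _ h s η hs hη u₀ u₁ _ =>
    h s η (one_pos.trans hs).ne' hη.le u₀ u₁⟩
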